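/- **Setting.** Let $\mathfrak g$ be a finite-dimensional real Lie algebra and let $e_i$ be a basis of $\mathfrak g^2=\mathfrak g\oplus\mathfrak g$. For $\xi=(\xi^1,\xi^2)\in\mathfrak g^2$ let $X^\xi(x,y)=(-[\xi^1,x],-[\xi^2,y])$ be the vector field on $\mathfrak g^2$ generated by $\xi$ under the adjoint action. For a function $\beta$ with values in $\mathfrak g^2$ write $\beta=\sum_i\beta^ie_i$ and $X^\beta(p)=X^{\beta(p)}(p)$. On functions, $(L(X)f)(p)=df_p(X(p))$ and $L_i=L(X^{e_i})$. For $\Omega$ open, $\mathcal D'_{\rm comp}(\Omega)$ is the space of compactly supported distributions on $\Omega$, i.e. of continuous linear functionals on $C^\infty(\Omega)$; on it, $\langle gu,f\rangle=\langle u,gf\rangle$ for $g\in C^\infty(\Omega)$, $\langle L_iu,f\rangle=-\langle u,L_if\rangle$ and $\langle\Phi_*u,f\rangle=\langle u,f\circ\Phi\rangle$. Time derivatives of maps between spaces of distributions are taken weakly (after applying the map to a distribution and pairing with a smooth function), one-sided at end points. **(1) General families.** Let $I\subseteq\mathbb R$ be an interval with more than one point, $O\subseteq\mathfrak g$ open,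 and let $\Phi_t\colon O^2\to\mathfrak g$, $\kappa_t\colon O^2\to\mathbb R$, $\beta_t\colon O^2\to\mathfrak g^2$ be families of functions that are smooth in $(t,p)\in I\times O^2$. Put $m_t=(\Phi_t)_*\circ\kappa_t\colon\mathcal D'_{\rm comp}(O^2)\to\mathcal D'_{\rm comp}(\mathfrak g)$. Consider, for all $t\in I$, $$\text{(a)}\quad \dot m_t=-m_t\circ\sum_i\beta_t^iL_i,\qquad\qquad \text{(b)}\quad \dot\Phi_t=L(X^{\beta_t})\Phi_t\ \text{ and }\ \dot\kappa_t=\Big(\sum_iL_i\circ\beta_t^i\Big)\kappa_t .$$ Then (b) implies (a). If the set of $(t,p)\in I\times O^2$ with $\kappa_t(p)\neq0$ is dense in $I\times O^2$ (for instance, if $\kappa_t$ has no zeros), then (a) and (b) are equivalent. **(2) The Kashiwara–Vergne equations.** Let $G$ be a Lie group with Lie algebra $\mathfrak g$ (for instance the connected, simply connected one), and let $U\subseteq\mathfrak g$ and $O\subseteq U$ be star-shaped open neighbourhoods of $0$ such that $\exp$ is a diffeomorphism from $U$ onto an open subset $\exp(U)$ of $G$, and $\exp(x)\exp(y)\in\exp(U)$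 for all $x,y\in O$; let $\log\colon\exp(U)\to U$ be the inverse of $\exp$. For $(x,y)\in O^2$ put $$\Phi(x,y)=\log(\exp(x)\exp(y)),\quad \kappa(x,y)=\frac{J^{1/2}(x)J^{1/2}(y)}{J^{1/2}(\Phi(x,y))},\quad J(x)={\det}_{\mathfrak g}\Big(\frac{1-e^{-\mathrm{ad}_x}}{\mathrm{ad}_x}\Big),$$ and for $0<t\le1$ put $\Phi_t(p)=t^{-1}\Phi(tp)$, $\kappa_t(p)=\kappa(tp)$, $m_t=(\Phi_t)_*\circ\kappa_t$, and $\beta_t(p)=t^{-1}\beta(tp)$ for $\beta=(\beta^1,\beta^2)\colon O^2\to\mathfrak g^2$. For every smooth $\beta\colon O^2\to\mathfrak g^2$ the following three conditions are equivalent. * **I.** $\dot m_t=-m_t\circ\sum_i\beta_t^iL_i$ for $0<t\le1$. * **II.** $\dot\Phi_t=L(X^{\beta_t})\Phi_t$ and $\dot\kappa_t=\big(\sum_iL_i\circ\beta_t^i\big)\kappa_t$ on $O^2$ for $0<t\le1$. * **III.** For all $x,y\in O$, with $z=\log(\exp(x)\exp(y))$, $$(1-e^{-\mathrm{ad}_x})\beta^1(x,y)+(e^{\mathrm{ad}_y}-1)\beta^2(x,y)=x+y-\log(\exp(y)\exp(x)),$$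 $$\mathrm{tr}\big(\mathrm{ad}_x\circ\partial_x\beta^1(x,y)+\mathrm{ad}_y\circ\partial_y\beta^2(x,y)\big)=\tfrac12\,\mathrm{tr}\Big(\frac{\mathrm{ad}_x}{e^{\mathrm{ad}_x}-1}+\frac{\mathrm{ad}_y}{e^{\mathrm{ad}_y}-1}-\frac{\mathrm{ad}_z}{e^{\mathrm{ad}_z}-1}-1\Big).$$ Here $\partial_x\beta^1,\partial_y\beta^2\in\mathrm{End}(\mathfrak g)$ are the partial derivatives. **(3) The three versions.** Consequently, versions I, II and III of the Kashiwara–Vergne conjecture are equivalent, where version N (N = I, II, III) says: there are a star-shaped open neighbourhood $O'\subseteq O$ of $0$ and a smooth $\mathfrak g$-equivariant (for the diagonal adjoint action) function $\beta\colon O'^2\to\mathfrak g^2$ with $\beta(0,0)=0$ that satisfies condition N on $O'$. -/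

import Mathlib

open Set TopologicalSpace
open scoped Manifold ContDiff

noncomputable section

namespace KV

/-! ### Compactly supported distributions -/

section Distributions

variable {V W F : Type*} [NormedAddCommGroup V] [NormedSpace ℝ V]
  [NormedAddCommGroup W] [NormedSpace ℝ W] [NormedAddCommGroup F] [NormedSpace ℝ F]

/-- The space `C^∞(Ω)`. Its elements are represented by functions on all of `V` that are smooth
on the open set `Ω`; the values outside `Ω` never matter. -/
def SmoothFn (Ω : Opens V) : Submodule ℝ (V → ℝ) where
  carrier := {f | ContDiffOn ℝ ∞ f (Ω : Set V)}
  add_mem' hf hg := ContDiffOn.add hf hg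
  zero_mem' := contDiffOn_const
  smul_mem' c _ hf := ContDiffOn.const_smul c hf

/-- All derivatives of `f` of order at most `N` are bounded by `M` on `K`. -/
def JetBound (K : Set V) (N : ℕ) (f : V → ℝ) (M : ℝ) : Prop :=
  ∀ k ≤ N, ∀ x ∈ K, ‖iteratedFDeriv ℝ k f x‖ ≤ M

theorem JetBound.mono {K K' : Set V} {N N' : ℕ} {f : V → ℝ} {M : ℝ} (h : JetBound K' N' f M)
    (hK : K ⊆ K') (hN : N ≤ N') : JetBound K N f M :=
  fun k hk x hx => h k (hk.trans hN) x (hK hx)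

/-- The space of (real) compactly supported distributions on the open set `Ω`: the continuous
linear functionals on `C^∞(Ω)`, continuity being expressed by the usual seminorm estimate
`|⟨u, f⟩| ≤ C sup {|D^k f(x)| : x ∈ K, k ≤ N}` for some compact `K ⊆ Ω` and some `N`, `C`. -/
def CompDistr (Ω : Opens V) : Submodule ℝ (SmoothFn Ω →ₗ[ℝ] ℝ) where
  carrier := {u | ∃ K : Set V, IsCompact K ∧ K ⊆ Ω ∧ ∃ (N : ℕ) (C : ℝ), 0 ≤ C ∧
    ∀ (f : SmoothFn Ω) (M : ℝ), 0 ≤ M → JetBound K N f M → |u f| ≤ C * M}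
  add_mem' := by
    rintro u v ⟨K, hK, hKΩ, N, C, hC, hu⟩ ⟨K', hK', hKΩ', N', C', hC', hv⟩
    refine ⟨K ∪ K', hK.union hK', union_subset hKΩ hKΩ', max N N', C + C', by positivity, ?_⟩
    intro f M hM h
    have h1 := hu f M hM (h.mono subset_union_left (le_max_left _ _))
    have h2 := hv f M hM (h.mono subset_union_right (le_max_right _ _))
    calc |(u + v) f| ≤ |u f| + |v f| := abs_add_le _ _
      _ ≤ (C + C') * M := by linarith
  zero_mem' := ⟨∅, isCompact_empty, empty_subset _, 0, 0, le_rfl, by simp⟩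
  smul_mem' := by
    rintro c u ⟨K, hK, hKΩ, N, C, hC, hu⟩
    refine ⟨K, hK, hKΩ, N, |c| * C, by positivity, ?_⟩
    intro f M hM h
    have h1 := hu f M hM h
    calc |(c • u) f| = |c| * |u f| := by simp [abs_mul]
      _ ≤ |c| * C * M := by
        rw [mul_assoc]; exact mul_le_mul_of_nonneg_left h1 (abs_nonneg c)

/-- Continuity of a linear map between spaces of smooth functions. -/
def IsContOp {Ω : Opens V} {Ω' : Opens W} (T : SmoothFn Ω' →ₗ[ℝ] SmoothFn Ω) : Prop :=
  ∀ K : Set V, IsCompact K → K ⊆ Ω → ∀ N : ℕ,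
    ∃ K' : Set W, IsCompact K' ∧ K' ⊆ Ω' ∧ ∃ (N' : ℕ) (C : ℝ), 0 ≤ C ∧
      ∀ (f : SmoothFn Ω') (M : ℝ), 0 ≤ M → JetBound K' N' f M → JetBound K N (T f) (C * M)

/-- The transpose of a continuous operator, acting on compactly supported distributions by
`⟨Tᵗ u, f⟩ = ⟨u, T f⟩`. -/
def transpose {Ω : Opens V} {Ω' : Opens W} (T : SmoothFn Ω' →ₗ[ℝ] SmoothFn Ω) (hT : IsContOp T) :
    CompDistr Ω →ₗ[ℝ] CompDistr Ω' where
  toFun u := ⟨u.1 ∘ₗ T, by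
    obtain ⟨K, hK, hKΩ, N, C, hC, hu⟩ := u.2
    obtain ⟨K', hK', hKΩ', N', C', hC', hT'⟩ := hT K hK hKΩ N
    refine ⟨K', hK', hKΩ', N', C * C', by positivity, fun f M hM h => ?_⟩
    rw [mul_assoc]
    exact hu (T f) (C' * M) (by positivity) (hT' f M hM h)⟩
  map_add' _ _ := rfl
  map_smul' _ _ := rfl

/-- The derivatives up to order `N` of a smooth function are bounded on compact sets. -/
theorem exists_bound {Ω : Opens V} {g : V → F} (hg : ContDiffOn ℝ ∞ g (Ω : Set V)) {K : Set V}
    (hK : IsCompact K) (hKΩ : K ⊆ Ω) (N : ℕ) :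
    ∃ B : ℝ, 1 ≤ B ∧ ∀ k ≤ N, ∀ x ∈ K, ‖iteratedFDerivWithin ℝ k g Ω x‖ ≤ B := by
  have key : ∀ k : ℕ, ∃ B : ℝ, ∀ x ∈ K, ‖iteratedFDerivWithin ℝ k g Ω x‖ ≤ B := by
    intro k
    have hc : ContinuousOn (iteratedFDerivWithin ℝ k g Ω) (Ω : Set V) :=
      hg.continuousOn_iteratedFDerivWithin (by exact_mod_cast le_top) Ω.isOpen.uniqueDiffOn
    exact hK.exists_bound_of_continuousOn (hc.mono hKΩ)
  choose B hB using key
  refine ⟨1 + ∑ k ∈ Finset.range (N + 1), |B k|, ?_, ?_⟩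
  · have : 0 ≤ ∑ k ∈ Finset.range (N + 1), |B k| := Finset.sum_nonneg fun _ _ => abs_nonneg _
    linarith
  · intro k hk x hx
    have h1 : |B k| ≤ ∑ k ∈ Finset.range (N + 1), |B k| :=
      Finset.single_le_sum (f := fun k => |B k|) (fun _ _ => abs_nonneg _)
        (Finset.mem_range.2 (by omega))
    have h2 := hB k x hx
    have h3 := le_abs_self (B k)
    linarith

theorem jetBound_iff {Ω : Opens V} {K : Set V} (hKΩ : K ⊆ Ω) (N : ℕ) (f : V → ℝ) (M : ℝ) :
    JetBound K N f M ↔ ∀ k ≤ N, ∀ x ∈ K, ‖iteratedFDerivWithin ℝ k f Ω x‖ ≤ M := by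
  refine forall₂_congr fun k _ => forall₂_congr fun x hx => ?_
  rw [iteratedFDerivWithin_of_isOpen k Ω.isOpen (hKΩ hx)]

/-- Multiplication of functions by the smooth function `g`. -/
def mulFn {Ω : Opens V} (g : V → ℝ) (hg : ContDiffOn ℝ ∞ g (Ω : Set V)) :
    SmoothFn Ω →ₗ[ℝ] SmoothFn Ω where
  toFun f := ⟨fun p => g p * f.1 p, hg.mul f.2⟩
  map_add' f f' := by ext p; simp [mul_add]
  map_smul' c f := by ext p; simp [mul_left_comm]

/-- Pull-back of functions under the smooth map `Φ : Ω → W`. -/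
def compFn {Ω : Opens V} (Φ : V → W) (hΦ : ContDiffOn ℝ ∞ Φ (Ω : Set V)) :
    SmoothFn (⊤ : Opens W) →ₗ[ℝ] SmoothFn Ω where
  toFun f := ⟨fun p => f.1 (Φ p), ContDiffOn.comp f.2 hΦ (fun _ _ => trivial)⟩
  map_add' f f' := by ext p; simp
  map_smul' c f := by ext p; simp

/-- The derivative `L(X) f` of a function along a vector field: `(L(X) f)(p) = df_p(X(p))`. -/
def lieDer (X : V → V) (f : V → F) (p : V) : F := fderiv ℝ f p (X p)

theorem contDiffOn_lieDer {Ω : Opens V} {X : V → V} (hX : ContDiffOn ℝ ∞ X (Ω : Set V))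
    {f : V → F} (hf : ContDiffOn ℝ ∞ f (Ω : Set V)) :
    ContDiffOn ℝ ∞ (lieDer X f) (Ω : Set V) :=
  ContDiffOn.clm_apply (hf.fderiv_of_isOpen Ω.isOpen (by simp)) hX

theorem SmoothFn.differentiableAt {Ω : Opens V} (f : SmoothFn Ω) {p : V} (hp : p ∈ Ω) :
    DifferentiableAt ℝ f.1 p :=
  (ContDiffOn.differentiableOn f.2 (by simp) p hp).differentiableAt (Ω.isOpen.mem_nhds hp)

open Classical in
/-- The operator `f ↦ L(X) f` on `C^∞(Ω)`, extended by `0` outside of `Ω`. -/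
def derFn {Ω : Opens V} (X : V → V) (hX : ContDiffOn ℝ ∞ X (Ω : Set V)) :
    SmoothFn Ω →ₗ[ℝ] SmoothFn Ω where
  toFun f := ⟨(Ω : Set V).indicator (lieDer X f.1),
    (contDiffOn_lieDer hX f.2).congr fun _ hp => indicator_of_mem hp _⟩
  map_add' f f' := by
    ext p
    by_cases hp : p ∈ Ω
    · simp [hp, lieDer, fderiv_add (SmoothFn.differentiableAt f hp) (SmoothFn.differentiableAt f' hp)]
    · simp [hp]
  map_smul' c f := by
    ext p
    by_cases hp : p ∈ Ω
    · simp [hp, lieDer, fderiv_const_smul (SmoothFn.differentiableAt f hp) c]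
    · simp [hp]

theorem isContOp_mulFn {Ω : Opens V} (g : V → ℝ) (hg : ContDiffOn ℝ ∞ g (Ω : Set V)) :
    IsContOp (mulFn g hg) := by
  intro K hK hKΩ N
  obtain ⟨B, hB1, hB⟩ := exists_bound hg hK hKΩ N
  refine ⟨K, hK, hKΩ, N, 2 ^ N * B, by positivity, fun f M hM h => ?_⟩
  rw [jetBound_iff hKΩ] at h ⊢
  intro k hk x hx
  refine (norm_iteratedFDerivWithin_mul_le hg f.2 Ω.isOpen.uniqueDiffOn (hKΩ hx)
    (n := k) (by exact_mod_cast le_top)).trans ?_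
  calc _ ≤ ∑ i ∈ Finset.range (k + 1), (k.choose i : ℝ) * B * M := by
        refine Finset.sum_le_sum fun i hi => ?_
        have hi' : i ≤ k := by simpa [Nat.lt_succ_iff] using hi
        have h1 := hB i (hi'.trans hk) x hx
        have h2 := h (k - i) ((Nat.sub_le _ _).trans hk) x hx
        gcongr
    _ = 2 ^ k * B * M := by
        rw [← Finset.sum_mul, ← Finset.sum_mul]
        congr 2
        exact_mod_cast Nat.sum_range_choose k
    _ ≤ 2 ^ N * B * M := by
        gcongr
        norm_num

theorem isContOp_compFn {Ω : Opens V} (Φ : V → W) (hΦ : ContDiffOn ℝ ∞ Φ (Ω : Set V)) :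
    IsContOp (compFn Φ hΦ) := by
  intro K hK hKΩ N
  obtain ⟨B, hB1, hB⟩ := exists_bound hΦ hK hKΩ N
  refine ⟨Φ '' K, hK.image_of_continuousOn (hΦ.continuousOn.mono hKΩ), fun _ _ => trivial, N,
    N.factorial * B ^ N, by positivity, fun f M hM h => ?_⟩
  rw [jetBound_iff (Ω := ⊤) (fun _ _ => trivial)] at h
  rw [jetBound_iff hKΩ]
  intro k hk x hx
  have := norm_iteratedFDerivWithin_comp_le (g := f.1) (f := Φ) (n := k) (t := ((⊤ : Opens W) : Set W))
    (s := (Ω : Set V)) (x := x) (N := ∞) f.2 hΦ (by exact_mod_cast le_top)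
    (⊤ : Opens W).isOpen.uniqueDiffOn Ω.isOpen.uniqueDiffOn (fun _ _ => trivial) (hKΩ hx)
    (C := M) (D := B) (fun i hi => h i (hi.trans hk) _ (mem_image_of_mem _ hx))
    (fun i hi hik => (hB i (hik.trans hk) x hx).trans (le_self_pow₀ hB1 (by omega)))
  refine this.trans ?_
  have h1 : (k.factorial : ℝ) ≤ N.factorial := by exact_mod_cast Nat.factorial_le hk
  have h2 : B ^ k ≤ B ^ N := pow_le_pow_right₀ hB1 hk
  calc (k.factorial : ℝ) * M * B ^ k ≤ N.factorial * M * B ^ N := by gcongr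
    _ = N.factorial * B ^ N * M := by ring

theorem isContOp_derFn {Ω : Opens V} (X : V → V) (hX : ContDiffOn ℝ ∞ X (Ω : Set V)) :
    IsContOp (derFn X hX) := by
  intro K hK hKΩ N
  obtain ⟨B, hB1, hB⟩ := exists_bound hX hK hKΩ N
  refine ⟨K, hK, hKΩ, N + 1, 2 ^ N * B, by positivity, fun f M hM h => ?_⟩
  rw [jetBound_iff hKΩ] at h ⊢
  intro k hk x hx
  have hu := Ω.isOpen.uniqueDiffOn (𝕜 := ℝ)
  have e : iteratedFDerivWithin ℝ k ((derFn X hX f : SmoothFn Ω) : V → ℝ) Ω x =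
      iteratedFDerivWithin ℝ k (fun y => (fderivWithin ℝ f.1 Ω y) (X y)) Ω x := by
    refine iteratedFDerivWithin_congr (fun y hy => ?_) (hKΩ hx) k
    change (Ω : Set V).indicator (lieDer X f.1) y = _
    rw [indicator_of_mem hy, lieDer, fderivWithin_of_isOpen Ω.isOpen hy]
  rw [e]
  have hf' : ContDiffOn ℝ ∞ (fderivWithin ℝ f.1 Ω) (Ω : Set V) :=
    ContDiffOn.fderivWithin f.2 hu (by simp)
  refine (norm_iteratedFDerivWithin_clm_apply hf' hX hu (hKΩ hx)
    (n := k) (by exact_mod_cast le_top)).trans ?_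
  calc _ ≤ ∑ i ∈ Finset.range (k + 1), (k.choose i : ℝ) * M * B := by
        refine Finset.sum_le_sum fun i hi => ?_
        have hi' : i ≤ k := by simpa [Nat.lt_succ_iff] using hi
        have h1 := hB (k - i) ((Nat.sub_le _ _).trans hk) x hx
        have h2 := h (i + 1) (by omega) x hx
        rw [← norm_iteratedFDerivWithin_fderivWithin hu (hKΩ hx)] at h2
        gcongr
    _ = 2 ^ k * B * M := by
        rw [← Finset.sum_mul, ← Finset.sum_mul]
        have : (∑ i ∈ Finset.range (k + 1), (k.choose i : ℝ)) = 2 ^ k := by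
          exact_mod_cast Nat.sum_range_choose k
        rw [this]; ring
    _ ≤ 2 ^ N * B * M := by
        gcongr
        norm_num

open Classical in
/-- The operator of multiplication by the smooth function `g` on compactly supported distributions,
`⟨g u, f⟩ = ⟨u, g f⟩`. (Set to `0` if `g` is not smooth on `Ω`.) -/
def mulOp (Ω : Opens V) (g : V → ℝ) : CompDistr Ω →ₗ[ℝ] CompDistr Ω :=
  if h : ContDiffOn ℝ ∞ g (Ω : Set V) then transpose (mulFn g h) (isContOp_mulFn g h) else 0

open Classical in
/-- The push-forward under the smooth map `Φ : Ω → W` of compactly supported distributions,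
`⟨Φ_* u, f⟩ = ⟨u, f ∘ Φ⟩`. (Set to `0` if `Φ` is not smooth on `Ω`.) -/
def push (Ω : Opens V) (Φ : V → W) : CompDistr Ω →ₗ[ℝ] CompDistr (⊤ : Opens W) :=
  if h : ContDiffOn ℝ ∞ Φ (Ω : Set V) then transpose (compFn Φ h) (isContOp_compFn Φ h) else 0

open Classical in
/-- The Lie derivative along the smooth vector field `X` of compactly supported distributions,
`⟨L(X) u, f⟩ = - ⟨u, L(X) f⟩`. (Set to `0` if `X` is not smooth on `Ω`.) -/
def lieDistr (Ω : Opens V) (X : V → V) : CompDistr Ω →ₗ[ℝ] CompDistr Ω :=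
  if h : ContDiffOn ℝ ∞ X (Ω : Set V) then (-1 : ℝ) • transpose (derFn X h) (isContOp_derFn X h)
  else 0

end Distributions

/-! ### Finite-dimensional real Lie algebras and the equations for general families -/

/-- A Lie ring whose underlying additive group is normed. No relation between the norm and the
bracket is required; in finite dimensions the norm only serves to speak of smooth functions. -/
class NormedLieRing (𝔤 : Type*) extends NormedAddCommGroup 𝔤, LieRing 𝔤

/-- A real Lie algebra on a normed space. Every finite-dimensional real Lie algebra becomes one
after the choice of any norm, and all norms are equivalent. -/
class NormedLieAlgebra (𝔤 : Type*) [NormedLieRing 𝔤] extends NormedSpace ℝ 𝔤, LieAlgebra ℝ 𝔤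

section Families

variable {𝔤 : Type*} [NormedLieRing 𝔤] [NormedLieAlgebra 𝔤] {ι : Type*} [Fintype ι]

/-- The open subset `O² = O × O` of `𝔤² = 𝔤 ⊕ 𝔤`. -/
def sq (O : Opens 𝔤) : Opens (𝔤 × 𝔤) := ⟨(O : Set 𝔤) ×ˢ (O : Set 𝔤), O.isOpen.prod O.isOpen⟩

/-- The vector field `X^ξ` on `𝔤²` generated by `ξ ∈ 𝔤²` under the adjoint action. It is the
derivation `(X^ξ f)(p) = d/ds f(exp(-s ξ) p)` at `s = 0`, so `ξ ↦ X^ξ` is a homomorphism of Lie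
algebras. -/
def adField (ξ p : 𝔤 × 𝔤) : 𝔤 × 𝔤 := (-⁅ξ.1, p.1⁆, -⁅ξ.2, p.2⁆)

/-- The vector field `X^β(p) = X^{β(p)}(p)` generated by a function `β` with values in `𝔤²`. -/
def genField (β : 𝔤 × 𝔤 → 𝔤 × 𝔤) (p : 𝔤 × 𝔤) : 𝔤 × 𝔤 := adField (β p) p

/-- The map `m = Φ_* ∘ κ` from distributions on `O²` to distributions on `𝔤`. -/
def prodMap (O : Opens 𝔤) (Φ : 𝔤 × 𝔤 → 𝔤) (κ : 𝔤 × 𝔤 → ℝ) :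
    CompDistr (sq O) →ₗ[ℝ] CompDistr (⊤ : Opens 𝔤) :=
  push (sq O) Φ ∘ₗ mulOp (sq O) κ

/-- The operator `∑ᵢ βⁱ Lᵢ` on distributions on `O²`, where `β = ∑ᵢ βⁱ eᵢ` in the basis `e` of `𝔤²`
and `Lᵢ` is the Lie derivative along the vector field generated by `eᵢ`. -/
def betaL (e : Module.Basis ι ℝ (𝔤 × 𝔤)) (O : Opens 𝔤) (β : 𝔤 × 𝔤 → 𝔤 × 𝔤) :
    CompDistr (sq O) →ₗ[ℝ] CompDistr (sq O) :=
  ∑ i, mulOp (sq O) (fun p => e.repr (β p) i) ∘ₗ lieDistr (sq O) (adField (e i))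

/-- The equation `ṁ_t = - m_t ∘ ∑ᵢ β_tⁱ Lᵢ`, `t ∈ I`, for `m_t = (Φ_t)_* ∘ κ_t`. The derivative is
taken in the weak sense: for every distribution `u` on `O²` and smooth function `f` on `𝔤`, the
function `s ↦ ⟨m_s u, f⟩` on `I` has the derivative `-⟨m_t (∑ᵢ β_tⁱ Lᵢ u), f⟩` at `t`. -/
def DistrEq (e : Module.Basis ι ℝ (𝔤 × 𝔤)) (I : Set ℝ) (O : Opens 𝔤) (Φ : ℝ → 𝔤 × 𝔤 → 𝔤)
    (κ : ℝ → 𝔤 × 𝔤 → ℝ) (β : ℝ → 𝔤 × 𝔤 → 𝔤 × 𝔤) : Prop :=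
  ∀ t ∈ I, ∀ (u : CompDistr (sq O)) (f : SmoothFn (⊤ : Opens 𝔤)),
    HasDerivWithinAt (fun s => (prodMap O (Φ s) (κ s) u).1 f)
      (-((prodMap O (Φ t) (κ t) ∘ₗ betaL e O (β t)) u).1 f) I t

/-- The equation `Φ̇_t = L(X^{β_t}) Φ_t` on `O²`, `t ∈ I`. -/
def PhiEq (I : Set ℝ) (O : Opens 𝔤) (Φ : ℝ → 𝔤 × 𝔤 → 𝔤) (β : ℝ → 𝔤 × 𝔤 → 𝔤 × 𝔤) : Prop :=
  ∀ t ∈ I, ∀ p ∈ sq O, HasDerivWithinAt (fun s => Φ s p) (lieDer (genField (β t)) (Φ t) p) I t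

/-- The equation `κ̇_t = (∑ᵢ Lᵢ ∘ β_tⁱ) κ_t` on `O²`, `t ∈ I`. -/
def KappaEq (e : Module.Basis ι ℝ (𝔤 × 𝔤)) (I : Set ℝ) (O : Opens 𝔤) (κ : ℝ → 𝔤 × 𝔤 → ℝ)
    (β : ℝ → 𝔤 × 𝔤 → 𝔤 × 𝔤) : Prop :=
  ∀ t ∈ I, ∀ p ∈ sq O, HasDerivWithinAt (fun s => κ s p)
    (∑ i, lieDer (adField (e i)) (fun q => e.repr (β t q) i * κ t q) p) I t

/-- The functions `f_t : O² → F`, `t ∈ I`, form a smooth family. -/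
def SmoothFamily {F : Type*} [NormedAddCommGroup F] [NormedSpace ℝ F] (I : Set ℝ) (O : Opens 𝔤)
    (f : ℝ → 𝔤 × 𝔤 → F) : Prop :=
  ContDiffOn ℝ ∞ (fun q : ℝ × (𝔤 × 𝔤) => f q.1 q.2) (I ×ˢ (sq O : Set (𝔤 × 𝔤)))

/-- The rescaled family `f_t = t⁻¹ r_t^* f`, that is, `f_t(p) = t⁻¹ f(t p)`. -/
def rescale {F : Type*} [AddCommGroup F] [Module ℝ F] (f : 𝔤 × 𝔤 → F) (t : ℝ) (p : 𝔤 × 𝔤) : F :=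
  t⁻¹ • f (t • p)

end Families

/-! ### The Campbell-Hausdorff function, the Duflo density, and the three versions -/

section KashiwaraVergne

variable {𝔤 : Type*} [NormedLieRing 𝔤] [NormedLieAlgebra 𝔤]

/-- A smooth Lie group is regular enough for its tangent space at `1` to be a Lie algebra. -/
instance : ENat.LEInfty (minSmoothness ℝ 3) := by
  rw [minSmoothness_of_isRCLikeNormedField]; infer_instance

section Group

variable {E : Type*} [NormedAddCommGroup E] [NormedSpace ℝ E] [CompleteSpace E]
  {G : Type*} [TopologicalSpace G] [ChartedSpace E G] [Group G] [LieGroup 𝓘(ℝ, E) ∞ G]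

open Classical in
/-- The exponential map `exp : 𝔤 → G` of a Lie group `G` whose Lie algebra is identified with `𝔤`
by `φ`: `exp x = γ(1)`, where `γ` is the integral curve through `γ(0) = 1` of the left-invariant
vector field given by `x`. (That field is complete, so the default value is never used.) -/
def lieExp (φ : 𝔤 ≃ₗ⁅ℝ⁆ GroupLieAlgebra 𝓘(ℝ, E) G) (x : 𝔤) : G :=
  if h : ∃ γ : ℝ → G, γ 0 = 1 ∧ IsMIntegralCurve (I := 𝓘(ℝ, E)) γ (mulInvariantVectorField (φ x))
  then h.choose 1 else 1

/-- Star-shaped open neighbourhoods `O ⊆ U` of the origin such that `exp` is a diffeomorphism from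
`U` onto an open subset of `G`, and `exp(x) exp(y) ∈ exp(U)` for all `x, y ∈ O`. -/
structure Admissible (φ : 𝔤 ≃ₗ⁅ℝ⁆ GroupLieAlgebra 𝓘(ℝ, E) G) (U O : Opens 𝔤) : Prop where
  zero_mem : (0 : 𝔤) ∈ O
  subset : O ≤ U
  starConvex_U : StarConvex ℝ (0 : 𝔤) (U : Set 𝔤)
  starConvex_O : StarConvex ℝ (0 : 𝔤) (O : Set 𝔤)
  injOn : InjOn (lieExp φ) (U : Set 𝔤)
  localDiffeo : IsLocalDiffeomorphOn 𝓘(ℝ, 𝔤) 𝓘(ℝ, E) ∞ (lieExp φ) (U : Set 𝔤)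
  mul_mem : ∀ x ∈ O, ∀ y ∈ O, lieExp φ x * lieExp φ y ∈ lieExp φ '' (U : Set 𝔤)

/-- The inverse `log : exp(U) → U` of the exponential map. -/
def lieLog (φ : 𝔤 ≃ₗ⁅ℝ⁆ GroupLieAlgebra 𝓘(ℝ, E) G) (U : Opens 𝔤) : G → 𝔤 :=
  Function.invFunOn (lieExp φ) (U : Set 𝔤)

/-- The Campbell-Hausdorff function `Φ(x, y) = log(exp(x) exp(y))`. -/
def bch (φ : 𝔤 ≃ₗ⁅ℝ⁆ GroupLieAlgebra 𝓘(ℝ, E) G) (U : Opens 𝔤) (p : 𝔤 × 𝔤) : 𝔤 :=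
  lieLog φ U (lieExp φ p.1 * lieExp φ p.2)

end Group

variable [FiniteDimensional ℝ 𝔤]

/-- `ad_x` as an element of the Banach algebra of endomorphisms of `𝔤`. -/
def adL (x : 𝔤) : 𝔤 →L[ℝ] 𝔤 := LinearMap.toContinuousLinearMap (LieAlgebra.ad ℝ 𝔤 x : 𝔤 →ₗ[ℝ] 𝔤)

/-- The entire function `(1 - e^{-a}) / a = ∑ₙ (-1)ⁿ aⁿ / (n+1)!` of an endomorphism. -/
def oneSubExpNegDiv (a : 𝔤 →L[ℝ] 𝔤) : 𝔤 →L[ℝ] 𝔤 :=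
  ∑' n : ℕ, ((-1 : ℝ) ^ n / ((n + 1).factorial : ℝ)) • a ^ n

/-- The entire function `(e^a - 1) / a = ∑ₙ aⁿ / (n+1)!` of an endomorphism. -/
def expSubOneDiv (a : 𝔤 →L[ℝ] 𝔤) : 𝔤 →L[ℝ] 𝔤 :=
  ∑' n : ℕ, (1 / ((n + 1).factorial : ℝ)) • a ^ n

/-- The function `a / (e^a - 1)` of an endomorphism: the inverse of `(e^a - 1) / a`. It is used only
where that operator is invertible (it is for `a = ad_x` when `exp` is a local diffeomorphism
at `x`). -/
def divExpSubOne (a : 𝔤 →L[ℝ] 𝔤) : 𝔤 →L[ℝ] 𝔤 := Ring.inverse (expSubOneDiv a)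

/-- The Jacobian of the exponential map, `J(x) = det((1 - e^{-ad_x}) / ad_x)`. -/
def jac (x : 𝔤) : ℝ := (oneSubExpNegDiv (adL x)).det

/-- The trace of an endomorphism of `𝔤`. -/
def tr (a : 𝔤 →L[ℝ] 𝔤) : ℝ := LinearMap.trace ℝ 𝔤 (a : 𝔤 →ₗ[ℝ] 𝔤)

variable {E : Type*} [NormedAddCommGroup E] [NormedSpace ℝ E] [CompleteSpace E]
  {G : Type*} [TopologicalSpace G] [ChartedSpace E G] [Group G] [LieGroup 𝓘(ℝ, E) ∞ G]
  {ι : Type*} [Fintype ι]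

/-- The density `κ(x, y) = J^{1/2}(x) J^{1/2}(y) / J^{1/2}(Φ(x, y))`. -/
def dufloDensity (φ : 𝔤 ≃ₗ⁅ℝ⁆ GroupLieAlgebra 𝓘(ℝ, E) G) (U : Opens 𝔤) (p : 𝔤 × 𝔤) : ℝ :=
  Real.sqrt (jac p.1) * Real.sqrt (jac p.2) / Real.sqrt (jac (bch φ U p))

/-- The condition of version I on `β : O² → 𝔤²`: with `Φ_t = t⁻¹ r_t^* Φ`, `κ_t = r_t^* κ`,
`m_t = (Φ_t)_* ∘ κ_t` and `β_t = t⁻¹ r_t^* β`, one has `ṁ_t = - m_t ∘ ∑ᵢ β_tⁱ Lᵢ` for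
`0 < t ≤ 1`. -/
def CondI (e : Module.Basis ι ℝ (𝔤 × 𝔤)) (φ : 𝔤 ≃ₗ⁅ℝ⁆ GroupLieAlgebra 𝓘(ℝ, E) G) (U O : Opens 𝔤)
    (β : 𝔤 × 𝔤 → 𝔤 × 𝔤) : Prop :=
  DistrEq e (Ioc 0 1) O (rescale (bch φ U)) (fun t p => dufloDensity φ U (t • p)) (rescale β)

/-- The condition of version II on `β : O² → 𝔤²`: `Φ̇_t = L(X^{β_t}) Φ_t` and
`κ̇_t = (∑ᵢ Lᵢ ∘ β_tⁱ) κ_t` for `0 < t ≤ 1`. -/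
def CondII (e : Module.Basis ι ℝ (𝔤 × 𝔤)) (φ : 𝔤 ≃ₗ⁅ℝ⁆ GroupLieAlgebra 𝓘(ℝ, E) G) (U O : Opens 𝔤)
    (β : 𝔤 × 𝔤 → 𝔤 × 𝔤) : Prop :=
  PhiEq (Ioc 0 1) O (rescale (bch φ U)) (rescale β) ∧
    KappaEq e (Ioc 0 1) O (fun t p => dufloDensity φ U (t • p)) (rescale β)

/-- The condition of version III on `β = (β¹, β²) : O² → 𝔤²`, the algebraic equations
`(1 - e^{-ad_x}) β¹ + (e^{ad_y} - 1) β² = x + y - log(exp(y) exp(x))` and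
`tr(ad_x ∘ ∂_x β¹ + ad_y ∘ ∂_y β²)
  = 1/2 tr(ad_x/(e^{ad_x} - 1) + ad_y/(e^{ad_y} - 1) - ad_z/(e^{ad_z} - 1) - 1)`
with `z = log(exp(x) exp(y))`, for all `x, y ∈ O`. -/
def CondIII (φ : 𝔤 ≃ₗ⁅ℝ⁆ GroupLieAlgebra 𝓘(ℝ, E) G) (U O : Opens 𝔤)
    (β : 𝔤 × 𝔤 → 𝔤 × 𝔤) : Prop :=
  (∀ x ∈ O, ∀ y ∈ O,
    (1 - NormedSpace.exp (-adL x)) (β (x, y)).1 + (NormedSpace.exp (adL y) - 1) (β (x, y)).2 =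
      x + y - bch φ U (y, x)) ∧
  (∀ x ∈ O, ∀ y ∈ O,
    tr (adL x ∘L fderiv ℝ (fun x' => (β (x', y)).1) x +
        adL y ∘L fderiv ℝ (fun y' => (β (x, y')).2) y) =
      1 / 2 * tr (divExpSubOne (adL x) + divExpSubOne (adL y) -
        divExpSubOne (adL (bch φ U (x, y))) - 1))

/-- The standing requirements on `β : O² → 𝔤²` in the conjecture: it is smooth, `𝔤`-equivariant
(for the diagonal adjoint action) and vanishes at the origin. -/
structure Candidate (O : Opens 𝔤) (β : 𝔤 × 𝔤 → 𝔤 × 𝔤) : Prop where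
  smooth : ContDiffOn ℝ ∞ β (sq O : Set (𝔤 × 𝔤))
  equivariant : ∀ ξ : 𝔤, ∀ p ∈ sq O,
    fderiv ℝ β p (⁅ξ, p.1⁆, ⁅ξ, p.2⁆) = (⁅ξ, (β p).1⁆, ⁅ξ, (β p).2⁆)
  map_zero : β 0 = 0

/-- A Kashiwara-Vergne type statement for the condition `C`: taking `O` smaller if necessary, there
is a smooth equivariant `β` on `O²` that vanishes at the origin and satisfies `C`. -/
def KVStatement (O : Opens 𝔤) (C : Opens 𝔤 → (𝔤 × 𝔤 → 𝔤 × 𝔤) → Prop) : Prop :=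
  ∃ O' : Opens 𝔤, O' ≤ O ∧ (0 : 𝔤) ∈ O' ∧ StarConvex ℝ (0 : 𝔤) (O' : Set 𝔤) ∧
    ∃ β : 𝔤 × 𝔤 → 𝔤 × 𝔤, Candidate O' β ∧ C O' β

end KashiwaraVergne

end KV

end

/-!
The proof has an analytic half, about distributions, and a Lie theoretic half, about the
Campbell-Hausdorff function.

**Distributions.** For a smooth family of functions `h_t` and a compactly supported distribution `u`,
`t ↦ ⟨u, h_t⟩` has the derivative `⟨u, ḣ_t⟩` (`CompDistr.hasDerivWithinAt`), because time derivatives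
commute with space derivatives up to the end points of the interval and the difference quotients
converge uniformly on compact sets. Since delta distributions separate functions, the equation
`ṁ_t = - m_t ∘ ∑ᵢ β_tⁱ Lᵢ` therefore says that for every test function `f` on `𝔤`
`∂ₜ(κ_t · f ∘ Φ_t) = ∑ᵢ Lᵢ(β_tⁱ κ_t · f ∘ Φ_t)` pointwise (`distrEq_iff_pointwise`). By the Leibniz
rule this follows from the equations for `Φ_t` and `κ_t`. Conversely `f = 1` gives the equation for
`κ_t`, and linear `f` then give the equation for `Φ_t` where `κ_t ≠ 0`, hence everywhere by
continuity.

**The differential of the Campbell-Hausdorff function.** The frame of left-invariant vector fields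
of `G`, pulled back under `exp`, has the structure constants of `𝔤` and the rays as integral curves.
These two facts alone determine the dual frame: it is `N(x) = (1 - e^{-ad x})/ad x`, since
`t ↦ t N(tx)v` solves a linear differential equation (`frame_inverse_eq`). From here on only the
properties of `Φ(x, y) = log(exp(x) exp(y))` collected in `IsLocalGroupLaw` matter. The
Maurer-Cartan equation along `t ↦ Φ(x, ty)` gives
`N(Φ(x, y)) dΦ(v, w) = e^{-ad y} N(x) v + N(y) w` (`IsLocalGroupLaw.leftDexp_fderiv`), and uniqueness
for an ordinary differential equation gives `Φ(y, x) = e^{ad y} Φ(x, y)` (`IsLocalGroupLaw.swap`).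

**Versions II and III.** For rescaled families the equations hold for all `t` as soon as they hold at
`t = 1`, where `∂ₜ` turns into the Euler field: `dΦ_p(p) - Φ(p) = dΦ_p(X^β(p))` and
`dκ_p(p) = dκ_p(X^β(p)) + κ(p) ∑ᵢ Lᵢ βⁱ(p)`. Applying the invertible operator `e^{ad y} N(Φ(x, y))` to
the first one turns it into the first equation of version III. The sum `∑ᵢ Lᵢ βⁱ` is the trace of
`ξ ↦ dβ(X^ξ)`, which is `tr(ad_x ∂_x β¹ + ad_y ∂_y β²)`. Finally `d log κ` is evaluated on
`p - X^β(p)`, whose image under `dΦ_p` is `Φ(p)`: as `J` is invariant under the adjoint action, only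
radial derivatives of `log J` remain, and these are the traces of `ad_x/(e^{ad_x} - 1) - 1`.
-/

namespace KV

open Filter Topology
open NormedSpace (exp)

/-! ### Smooth families and differentiation under a distribution -/

section SmoothFamilies

variable {V F : Type*} [NormedAddCommGroup V] [NormedSpace ℝ V]
  [NormedAddCommGroup F] [NormedSpace ℝ F] {I : Set ℝ} {Ω : Opens V} {f : ℝ → V → F}

/-- The functions `f t`, `t ∈ I`, form a family on `Ω` that is smooth in `(t, p) ∈ I × Ω`. -/
def SmoothFamilyOn (I : Set ℝ) (Ω : Opens V) (f : ℝ → V → F) : Prop :=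
  ContDiffOn ℝ ∞ (fun q : ℝ × V => f q.1 q.2) (I ×ˢ (Ω : Set V))

/-- The velocity `∂f_t(p)/∂t` of a family, one-sided at the end points of `I`. -/
noncomputable def velocity (I : Set ℝ) (f : ℝ → V → F) (t : ℝ) (p : V) : F :=
  derivWithin (fun s => f s p) I t

theorem uniqueDiffOn_of_ordConnected (hI : I.OrdConnected) (hI' : I.Nontrivial) :
    UniqueDiffOn ℝ I :=
  uniqueDiffOn_convex hI.convex (hI.convex.nontrivial_iff_nonempty_interior.1 hI')

theorem subset_closure_interior_of_ordConnected (hI : I.OrdConnected) (hI' : I.Nontrivial) :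
    I ⊆ closure (interior I) := by
  have hc : Convex ℝ I := hI.convex
  rw [hc.closure_interior_eq_closure_of_nonempty_interior
    (hI.convex.nontrivial_iff_nonempty_interior.1 hI')]
  exact subset_closure

theorem _root_.Convex.norm_sub_sub_smul_le {S : Set ℝ} (hS : Convex ℝ S) {a a' : ℝ → F} {b : F}
    {ε : ℝ} (ha : ∀ r ∈ S, HasDerivWithinAt a (a' r) S r) (hε : ∀ r ∈ S, ‖a' r - b‖ ≤ ε)
    {s t : ℝ} (ht : t ∈ S) (hs : s ∈ S) : ‖a s - a t - (s - t) • b‖ ≤ ε * |s - t| := by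
  have h1 : ∀ r ∈ S, HasDerivWithinAt (fun r => a r - r • b) (a' r - b) S r := fun r hr => by
    have := (ha r hr).sub ((hasDerivWithinAt_id r S).smul_const b)
    simp only [one_smul] at this
    exact this
  have h2 := hS.norm_image_sub_le_of_norm_hasDerivWithin_le h1 hε ht hs
  rw [Real.norm_eq_abs] at h2
  have h3 : a s - a t - (s - t) • b = a s - s • b - (a t - t • b) := by
    rw [sub_smul]; abel
  rwa [h3]

namespace SmoothFamilyOn

theorem contDiffOn (hf : SmoothFamilyOn I Ω f) {t : ℝ} (ht : t ∈ I) :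
    ContDiffOn ℝ ∞ (f t) (Ω : Set V) :=
  ContDiffOn.comp (g := fun q : ℝ × V => f q.1 q.2) hf
    (contDiffOn_const.prodMk contDiffOn_id) fun _ hp => ⟨ht, hp⟩

theorem uniqueDiffOn_prod (hI : UniqueDiffOn ℝ I) (Ω : Opens V) :
    UniqueDiffOn ℝ (I ×ˢ (Ω : Set V)) :=
  hI.prod Ω.isOpen.uniqueDiffOn

theorem hasFDerivWithinAt (hf : SmoothFamilyOn I Ω f) {t : ℝ} {p : V} (ht : t ∈ I) (hp : p ∈ Ω) :
    HasFDerivWithinAt (fun q : ℝ × V => f q.1 q.2)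
      (fderivWithin ℝ (fun q : ℝ × V => f q.1 q.2) (I ×ˢ (Ω : Set V)) (t, p))
      (I ×ˢ (Ω : Set V)) (t, p) :=
  (hf.differentiableOn (by simp) (t, p) ⟨ht, hp⟩).hasFDerivWithinAt

theorem hasFDerivAt_space {g : ℝ × V → F} {g' : ℝ × V →L[ℝ] F} {t : ℝ} {p : V} (ht : t ∈ I)
    (hp : p ∈ Ω) (hg : HasFDerivWithinAt g g' (I ×ˢ (Ω : Set V)) (t, p)) :
    HasFDerivAt (fun q => g (t, q)) (g'.comp (ContinuousLinearMap.inr ℝ ℝ V)) p := by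
  have h1 : HasFDerivWithinAt (fun q : V => (t, q)) (ContinuousLinearMap.inr ℝ ℝ V)
      (Ω : Set V) p := (hasFDerivAt_prodMk_right t p).hasFDerivWithinAt
  exact (hg.comp p h1 fun q hq => ⟨ht, hq⟩).hasFDerivAt (Ω.isOpen.mem_nhds hp)

theorem hasDerivWithinAt_time {g : ℝ × V → F} {g' : ℝ × V →L[ℝ] F} {t : ℝ} {p : V}
    (hp : p ∈ Ω) (hg : HasFDerivWithinAt g g' (I ×ˢ (Ω : Set V)) (t, p)) :
    HasDerivWithinAt (fun s => g (s, p)) (g' (1, 0)) I t := by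
  have h1 : HasFDerivWithinAt (fun s : ℝ => (s, p)) (ContinuousLinearMap.inl ℝ ℝ V) I t :=
    (hasFDerivAt_prodMk_left t p).hasFDerivWithinAt
  have h2 : MapsTo (fun s : ℝ => (s, p)) I (I ×ˢ (Ω : Set V)) := fun q hq => ⟨hq, hp⟩
  simpa [Function.comp_def] using (hg.comp t h1 h2).hasDerivWithinAt

theorem hasDerivWithinAt (hf : SmoothFamilyOn I Ω f) {t : ℝ} {p : V} (ht : t ∈ I) (hp : p ∈ Ω) :
    HasDerivWithinAt (fun s => f s p) (velocity I f t p) I t :=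
  (hasDerivWithinAt_time hp (hf.hasFDerivWithinAt ht hp)).differentiableWithinAt.hasDerivWithinAt

theorem velocity_eq (hf : SmoothFamilyOn I Ω f) (hI : UniqueDiffOn ℝ I) {t : ℝ} {p : V}
    (ht : t ∈ I) (hp : p ∈ Ω) : velocity I f t p =
      fderivWithin ℝ (fun q : ℝ × V => f q.1 q.2) (I ×ˢ (Ω : Set V)) (t, p) (1, 0) :=
  (hI t ht).eq_deriv _ (hf.hasDerivWithinAt ht hp)
    (hasDerivWithinAt_time hp (hf.hasFDerivWithinAt ht hp))

theorem fderiv_eq (hf : SmoothFamilyOn I Ω f) {t : ℝ} {p : V} (ht : t ∈ I) (hp : p ∈ Ω) :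
    fderiv ℝ (f t) p = (fderivWithin ℝ (fun q : ℝ × V => f q.1 q.2) (I ×ˢ (Ω : Set V)) (t, p)).comp
      (ContinuousLinearMap.inr ℝ ℝ V) :=
  (hasFDerivAt_space ht hp (hf.hasFDerivWithinAt ht hp)).fderiv

theorem contDiffOn_fderivWithin (hf : SmoothFamilyOn I Ω f) (hI : UniqueDiffOn ℝ I) :
    ContDiffOn ℝ ∞ (fderivWithin ℝ (fun q : ℝ × V => f q.1 q.2) (I ×ˢ (Ω : Set V)))
      (I ×ˢ (Ω : Set V)) :=
  ContDiffOn.fderivWithin hf (uniqueDiffOn_prod hI Ω) (by simp)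

theorem velocity (hf : SmoothFamilyOn I Ω f) (hI : UniqueDiffOn ℝ I) :
    SmoothFamilyOn I Ω (velocity I f) :=
  ((hf.contDiffOn_fderivWithin hI).clm_apply contDiffOn_const).congr
    fun _ hq => hf.velocity_eq hI hq.1 hq.2

theorem fderiv (hf : SmoothFamilyOn I Ω f) (hI : UniqueDiffOn ℝ I) :
    SmoothFamilyOn I Ω (fun t => fderiv ℝ (f t)) :=
  ((hf.contDiffOn_fderivWithin hI).clm_comp contDiffOn_const).congr
    fun _ hq => hf.fderiv_eq hq.1 hq.2

/-- Time and space derivatives of a smooth family commute, also at the end points of `I`. -/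
theorem hasDerivWithinAt_fderiv (hf : SmoothFamilyOn I Ω f) (hI : UniqueDiffOn ℝ I)
    (hI' : I ⊆ closure (interior I)) {t : ℝ} {p : V} (ht : t ∈ I) (hp : p ∈ Ω) :
    HasDerivWithinAt (fun s => _root_.fderiv ℝ (f s) p)
      (_root_.fderiv ℝ (KV.velocity I f t) p) I t := by
  set g : ℝ × V → F := fun q => f q.1 q.2 with hg
  set S : Set (ℝ × V) := I ×ˢ (Ω : Set V) with hS
  have hD : HasFDerivWithinAt (fderivWithin ℝ g S) (fderivWithin ℝ (fderivWithin ℝ g S) S (t, p))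
      S (t, p) :=
    ((hf.contDiffOn_fderivWithin hI).differentiableOn (by simp) (t, p)
      ⟨ht, hp⟩).hasFDerivWithinAt
  have hsymm : IsSymmSndFDerivWithinAt ℝ g S (t, p) := by
    refine ContDiffWithinAt.isSymmSndFDerivWithinAt (n := ∞) (hf (t, p) ⟨ht, hp⟩) ?_
      (uniqueDiffOn_prod hI Ω) ?_ ⟨ht, hp⟩
    · rw [minSmoothness_of_isRCLikeNormedField]; exact WithTop.coe_le_coe.2 le_top
    · rw [hS, interior_prod_eq, closure_prod_eq, Ω.isOpen.interior_eq]
      exact ⟨hI' ht, subset_closure hp⟩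
  have h1 : HasDerivWithinAt (fun s => (fderivWithin ℝ g S (s, p)).comp
      (ContinuousLinearMap.inr ℝ ℝ V))
      ((fderivWithin ℝ (fderivWithin ℝ g S) S (t, p) (1, 0)).comp
        (ContinuousLinearMap.inr ℝ ℝ V)) I t := by
    have := (hasDerivWithinAt_time hp hD).clm_comp
      (hasDerivWithinAt_const t I (ContinuousLinearMap.inr ℝ ℝ V))
    simpa using this
  have h2 : HasFDerivAt (fun q => fderivWithin ℝ g S (t, q) (1, 0))
      (((ContinuousLinearMap.apply ℝ F ((1, 0) : ℝ × V)).comp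
        (fderivWithin ℝ (fderivWithin ℝ g S) S (t, p))).comp (ContinuousLinearMap.inr ℝ ℝ V)) p :=
    hasFDerivAt_space ht hp
      ((ContinuousLinearMap.apply ℝ F ((1, 0) : ℝ × V)).hasFDerivAt.comp_hasFDerivWithinAt _ hD)
  have h3 : _root_.fderiv ℝ (KV.velocity I f t) p =
      (fderivWithin ℝ (fderivWithin ℝ g S) S (t, p) (1, 0)).comp
        (ContinuousLinearMap.inr ℝ ℝ V) := by
    have : KV.velocity I f t =ᶠ[𝓝 p] fun q => fderivWithin ℝ g S (t, q) (1, 0) := by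
      filter_upwards [Ω.isOpen.mem_nhds hp] with q hq using hf.velocity_eq hI ht hq
    rw [this.fderiv_eq, h2.fderiv]
    ext v
    simpa using hsymm.eq (0, v) (1, 0)
  rw [h3]
  exact h1.congr (fun s hs => hf.fderiv_eq hs hp) (hf.fderiv_eq ht hp)

/-- All space derivatives of a smooth family are smooth families, and they commute with the time
derivative. -/
theorem iteratedFDeriv (hf : SmoothFamilyOn I Ω f) (hI : UniqueDiffOn ℝ I)
    (hI' : I ⊆ closure (interior I)) (k : ℕ) :
    SmoothFamilyOn I Ω (fun t => iteratedFDeriv ℝ k (f t)) ∧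
      ∀ t ∈ I, ∀ p ∈ Ω, HasDerivWithinAt (fun s => iteratedFDeriv ℝ k (f s) p)
        (iteratedFDeriv ℝ k (KV.velocity I f t) p) I t := by
  induction k with
  | zero =>
    constructor
    · exact ((continuousMultilinearCurryFin0 ℝ V F).symm.contDiff.comp_contDiffOn hf)
    · intro t ht p hp
      exact ((continuousMultilinearCurryFin0 ℝ V F).symm.toContinuousLinearEquiv.hasFDerivAt).comp_hasDerivWithinAt
        t (hf.hasDerivWithinAt ht hp)
  | succ k ih =>
    obtain ⟨ih1, ih2⟩ := ih
    set L := (continuousMultilinearCurryLeftEquiv ℝ (fun _ : Fin (k + 1) => V) F).symm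
    constructor
    · exact L.contDiff.comp_contDiffOn (ih1.fderiv hI)
    · intro t ht p hp
      have h1 := ih1.hasDerivWithinAt_fderiv hI hI' ht hp
      have h2 : _root_.fderiv ℝ (KV.velocity I (fun t => _root_.iteratedFDeriv ℝ k (f t)) t) p =
          _root_.fderiv ℝ (_root_.iteratedFDeriv ℝ k (KV.velocity I f t)) p := by
        refine Filter.EventuallyEq.fderiv_eq ?_
        filter_upwards [Ω.isOpen.mem_nhds hp] with q hq
        exact (ih2 t ht q hq).derivWithin (hI t ht)
      rw [h2] at h1
      exact L.toContinuousLinearEquiv.hasFDerivAt.comp_hasDerivWithinAt t h1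

/-- Uniformly for `p` in a compact set, the space derivatives of order `k` of the difference
quotient in time converge to those of the velocity. -/
theorem eventually_norm_iteratedFDeriv_sub_le (hf : SmoothFamilyOn I Ω f) (hI : UniqueDiffOn ℝ I)
    (hconv : Convex ℝ I) (hI' : I ⊆ closure (interior I)) {K : Set V} (hK : IsCompact K)
    (hKΩ : K ⊆ Ω) (k : ℕ) {t : ℝ} (ht : t ∈ I) {ε : ℝ} (hε : 0 < ε) :
    ∀ᶠ s in 𝓝[I] t, ∀ p ∈ K, ‖_root_.iteratedFDeriv ℝ k (f s) p -
      _root_.iteratedFDeriv ℝ k (f t) p - (s - t) • _root_.iteratedFDeriv ℝ k (KV.velocity I f t) p‖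
        ≤ ε * |s - t| := by
  set A' : ℝ → V → _ := fun r p => _root_.iteratedFDeriv ℝ k (KV.velocity I f r) p with hA'
  have hcont : ContinuousOn (fun q : ℝ × V => A' q.1 q.2) (I ×ˢ (Ω : Set V)) :=
    (((hf.velocity hI).iteratedFDeriv hI hI' k).1).continuousOn
  have h1 : ∀ᶠ r in 𝓝 t, ∀ p ∈ K, r ∈ I → ‖A' r p - A' t p‖ ≤ ε := by
    refine hK.eventually_forall_of_forall_eventually
      (P := fun r p => r ∈ I → ‖A' r p - A' t p‖ ≤ ε) fun p hp => ?_
    have hc := hcont (t, p) ⟨ht, hKΩ hp⟩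
    have e1 := Metric.continuousWithinAt_iff'.1 hc (ε / 2) (half_pos hε)
    rw [eventually_nhdsWithin_iff] at e1
    have e2 : ∀ᶠ z : ℝ × V in 𝓝 (t, p), z.2 ∈ (Ω : Set V) :=
      continuous_snd.continuousAt.eventually (Ω.isOpen.mem_nhds (hKΩ hp))
    have e3 : ∀ᶠ z : ℝ × V in 𝓝 (t, p), ((t, z.2) : ℝ × V) ∈ I ×ˢ (Ω : Set V) →
        dist (A' t z.2) (A' t p) < ε / 2 := by
      have : Tendsto (fun z : ℝ × V => ((t, z.2) : ℝ × V)) (𝓝 (t, p)) (𝓝 (t, p)) := by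
        have : Continuous (fun z : ℝ × V => ((t, z.2) : ℝ × V)) := by fun_prop
        exact this.tendsto (t, p)
      exact this.eventually e1
    filter_upwards [e1, e2, e3] with z hz1 hz2 hz3 hz
    rw [← dist_eq_norm]
    linarith [dist_triangle_right (A' z.1 z.2) (A' t z.2) (A' t p), hz1 ⟨hz, hz2⟩, hz3 ⟨ht, hz2⟩]
  obtain ⟨δ, hδ, hball⟩ := Metric.eventually_nhds_iff_ball.1 h1
  have hmem : I ∩ Metric.ball t δ ∈ 𝓝[I] t :=
    inter_mem self_mem_nhdsWithin (mem_nhdsWithin_of_mem_nhds (Metric.ball_mem_nhds t hδ))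
  filter_upwards [hmem] with s hs p hp
  exact (hconv.inter (convex_ball t δ)).norm_sub_sub_smul_le
    (fun r hr => ((hf.iteratedFDeriv hI hI' k).2 r hr.1 p (hKΩ hp)).mono inter_subset_left)
    (fun r hr => hball r hr.2 p hp hr.1) ⟨ht, Metric.mem_ball_self hδ⟩ hs

end SmoothFamilyOn

/-- Compactly supported distributions may be differentiated under the bracket: the derivative of
`t ↦ ⟨u, h_t⟩` is `⟨u, ḣ_t⟩` for a smooth family of functions `h_t`. -/
theorem CompDistr.hasDerivWithinAt {Ω : Opens V} (u : CompDistr Ω) {h : ℝ → V → ℝ}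
    (hh : SmoothFamilyOn I Ω h) (hI : I.OrdConnected) (hI' : I.Nontrivial) {H : ℝ → SmoothFn Ω}
    (hH : ∀ s ∈ I, EqOn (H s).1 (h s) Ω) {t : ℝ} (ht : t ∈ I) {H' : SmoothFn Ω}
    (hH' : EqOn H'.1 (velocity I h t) Ω) :
    HasDerivWithinAt (fun s => u.1 (H s)) (u.1 H') I t := by
  obtain ⟨K, hK, hKΩ, N, C, hC, hu⟩ := u.2
  have hU := uniqueDiffOn_of_ordConnected hI hI'
  have hcl := subset_closure_interior_of_ordConnected hI hI'
  rw [hasDerivWithinAt_iff_isLittleO, Asymptotics.isLittleO_iff]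
  intro c hc
  have hε : 0 < c / (C + 1) := by positivity
  have hev : ∀ᶠ s in 𝓝[I] t, ∀ k ∈ Finset.range (N + 1), ∀ p ∈ K,
      ‖iteratedFDeriv ℝ k (h s) p - iteratedFDeriv ℝ k (h t) p -
        (s - t) • iteratedFDeriv ℝ k (velocity I h t) p‖ ≤ c / (C + 1) * |s - t| :=
    (eventually_all_finset _).2 fun k _ =>
      hh.eventually_norm_iteratedFDeriv_sub_le hU hI.convex hcl hK hKΩ k ht hε
  filter_upwards [hev, self_mem_nhdsWithin] with s hs hsI
  have hb : JetBound K N ((H s - H t - (s - t) • H' : SmoothFn Ω) : V → ℝ)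
      (c / (C + 1) * |s - t|) := by
    intro k hk x hx
    have hxΩ := hKΩ hx
    have hnx := Ω.isOpen.mem_nhds hxΩ
    have e : ((H s - H t - (s - t) • H' : SmoothFn Ω) : V → ℝ) =ᶠ[𝓝 x]
        h s - h t - (s - t) • velocity I h t := by
      filter_upwards [hnx] with y hy
      simp [← hH s hsI hy, ← hH t ht hy, ← hH' hy]
    have ca : ∀ {g : V → ℝ}, ContDiffOn ℝ ∞ g Ω → ContDiffAt ℝ k g x := fun hg =>
      (hg.contDiffAt hnx).of_le (by exact_mod_cast le_top)
    have c1 := ca (hh.contDiffOn hsI)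
    have c2 := ca (hh.contDiffOn ht)
    have c3 := ca ((hh.velocity hU).contDiffOn ht)
    rw [(e.iteratedFDeriv ℝ k).self_of_nhds, iteratedFDeriv_sub_apply (f := h s - h t)
        (g := (s - t) • velocity I h t) (c1.sub c2) (c3.const_smul (s - t)),
      iteratedFDeriv_sub_apply c1 c2, iteratedFDeriv_const_smul_apply c3]
    exact hs k (Finset.mem_range.2 (by omega)) x hx
  have h2 := hu _ _ (by positivity) hb
  rw [map_sub, map_sub, map_smul] at h2
  rw [Real.norm_eq_abs, Real.norm_eq_abs]
  refine h2.trans ?_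
  have : C * (c / (C + 1) * |s - t|) = (C / (C + 1)) * (c * |s - t|) := by ring
  rw [this]
  exact mul_le_of_le_one_left (by positivity) (by rw [div_le_one (by positivity)]; linarith)

end SmoothFamilies

/-! ### General families: the distributional and the pointwise equations -/

section GeneralFamilies

variable {V : Type*} [NormedAddCommGroup V] [NormedSpace ℝ V]

theorem abs_apply_le_jetBound {Ω : Opens V} {p : V} (f : SmoothFn Ω) {M : ℝ}
    (h : JetBound {p} 0 f.1 M) : |f.1 p| ≤ M := by
  have := h 0 le_rfl p rfl
  rwa [norm_iteratedFDeriv_zero] at this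

/-- The delta distribution at `p ∈ Ω`. -/
def dirac {Ω : Opens V} (p : V) (hp : p ∈ Ω) : CompDistr Ω :=
  ⟨{ toFun := fun f => f.1 p, map_add' := fun _ _ => rfl, map_smul' := fun _ _ => rfl },
    {p}, isCompact_singleton, singleton_subset_iff.2 hp, 0, 1, zero_le_one, fun f M _ h => by
      rw [one_mul]; exact abs_apply_le_jetBound f h⟩

theorem lieDer_mul {X : V → V} {f g : V → ℝ} {p : V} (hf : DifferentiableAt ℝ f p)
    (hg : DifferentiableAt ℝ g p) :
    lieDer X (fun q => f q * g q) p = lieDer X f p * g p + f p * lieDer X g p := by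
  unfold lieDer
  rw [fderiv_fun_mul hf hg]
  simp
  ring

variable {𝔤 : Type*} [NormedLieRing 𝔤] [NormedLieAlgebra 𝔤]
  {ι : Type*} [Fintype ι] (e : Module.Basis ι ℝ (𝔤 × 𝔤))

variable {I : Set ℝ} {O : Opens 𝔤} {Φ : ℝ → 𝔤 × 𝔤 → 𝔤} {κ : ℝ → 𝔤 × 𝔤 → ℝ}
  {β : ℝ → 𝔤 × 𝔤 → 𝔤 × 𝔤}

/-- The field `X^ξ(p)` as a linear function of `ξ`. -/
def adFieldLin (p : 𝔤 × 𝔤) : 𝔤 × 𝔤 →ₗ[ℝ] 𝔤 × 𝔤 where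
  toFun ξ := adField ξ p
  map_add' ξ η := by simp [adField, add_comm]
  map_smul' c ξ := by simp only [adField, Prod.smul_fst, Prod.smul_snd, smul_lie, ← smul_neg]; rfl

theorem sum_repr_smul_adField (ξ p : 𝔤 × 𝔤) : ∑ i, e.repr ξ i • adField (e i) p = adField ξ p := by
  have : adFieldLin p (∑ i, e.repr ξ i • e i) = adFieldLin p ξ := by rw [e.sum_repr]
  rw [map_sum] at this
  simp only [map_smul] at this
  exact this

theorem prodMap_apply {Φ : 𝔤 × 𝔤 → 𝔤} {κ : 𝔤 × 𝔤 → ℝ}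
    (hΦ : ContDiffOn ℝ ∞ Φ (sq O : Set (𝔤 × 𝔤))) (hκ : ContDiffOn ℝ ∞ κ (sq O : Set (𝔤 × 𝔤)))
    (u : CompDistr (sq O)) (f : SmoothFn (⊤ : Opens 𝔤)) :
    (prodMap O Φ κ u).1 f = u.1 (mulFn κ hκ (compFn Φ hΦ f)) := by
  simp only [prodMap, push, mulOp, dif_pos hΦ, dif_pos hκ]
  rfl

end GeneralFamilies

section FiniteDim

variable {𝔤 : Type*} [NormedLieRing 𝔤] [NormedLieAlgebra 𝔤] [FiniteDimensional ℝ 𝔤]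
  {ι : Type*} [Fintype ι] (e : Module.Basis ι ℝ (𝔤 × 𝔤))

variable {I : Set ℝ} {O : Opens 𝔤} {Φ : ℝ → 𝔤 × 𝔤 → 𝔤} {κ : ℝ → 𝔤 × 𝔤 → ℝ}
  {β : ℝ → 𝔤 × 𝔤 → 𝔤 × 𝔤}

theorem contDiff_adField (ξ : 𝔤 × 𝔤) : ContDiff ℝ ∞ (adField ξ) :=
  (LinearMap.toContinuousLinearMap
    ((-(LieAlgebra.ad ℝ 𝔤 ξ.1 : 𝔤 →ₗ[ℝ] 𝔤)).prodMap (-(LieAlgebra.ad ℝ 𝔤 ξ.2 : 𝔤 →ₗ[ℝ] 𝔤)))).contDiff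

/-- The coordinate `βⁱ` of `β` in the basis `e`. -/
noncomputable def coordCLM (i : ι) : 𝔤 × 𝔤 →L[ℝ] ℝ := LinearMap.toContinuousLinearMap (e.coord i)

omit [Fintype ι] in
theorem contDiffOn_coord {β : 𝔤 × 𝔤 → 𝔤 × 𝔤} (hβ : ContDiffOn ℝ ∞ β (sq O : Set (𝔤 × 𝔤))) (i : ι) :
    ContDiffOn ℝ ∞ (fun p => e.repr (β p) i) (sq O : Set (𝔤 × 𝔤)) :=
  (coordCLM e i).contDiff.comp_contDiffOn hβ

theorem betaL_apply {β : 𝔤 × 𝔤 → 𝔤 × 𝔤} (hβ : ContDiffOn ℝ ∞ β (sq O : Set (𝔤 × 𝔤)))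
    (u : CompDistr (sq O)) (f : SmoothFn (sq O)) :
    (betaL e O β u).1 f = -u.1 (∑ i, derFn (adField (e i)) (contDiff_adField (e i)).contDiffOn
      (mulFn (fun p => e.repr (β p) i) (contDiffOn_coord e hβ i) f)) := by
  have h : ∀ i, ((mulOp (sq O) (fun p => e.repr (β p) i) ∘ₗ lieDistr (sq O) (adField (e i))) u).1 f
      = -u.1 (derFn (adField (e i)) (contDiff_adField (e i)).contDiffOn
        (mulFn (fun p => e.repr (β p) i) (contDiffOn_coord e hβ i) f)) := fun i => by
    simp only [mulOp, lieDistr, dif_pos (contDiffOn_coord e hβ i),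
      dif_pos (contDiff_adField (e i)).contDiffOn]
    exact neg_one_mul _
  rw [map_sum, ← Finset.sum_neg_distrib, ← Finset.sum_congr rfl fun i _ => h i]
  simp [betaL]

omit [FiniteDimensional ℝ 𝔤] in
theorem SmoothFamily.toOn {F : Type*} [NormedAddCommGroup F] [NormedSpace ℝ F]
    {f : ℝ → 𝔤 × 𝔤 → F} (hf : SmoothFamily I O f) : SmoothFamilyOn I (sq O) f := hf

omit [FiniteDimensional ℝ 𝔤] in
theorem smoothFamilyOn_test (hΦ : SmoothFamily I O Φ) (hκ : SmoothFamily I O κ)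
    (f : SmoothFn (⊤ : Opens 𝔤)) :
    SmoothFamilyOn I (sq O) (fun t p => κ t p * f.1 (Φ t p)) :=
  ContDiffOn.mul hκ (ContDiffOn.comp f.2 hΦ fun _ _ => trivial)

/-- The equation for `m_t`, tested against delta distributions, is an identity between functions;
conversely that identity can be integrated against every distribution. -/
theorem distrEq_iff_pointwise (hI : I.OrdConnected) (hI' : I.Nontrivial)
    (hΦ : SmoothFamily I O Φ) (hκ : SmoothFamily I O κ) (hβ : SmoothFamily I O β) :
    DistrEq e I O Φ κ β ↔ ∀ t ∈ I, ∀ f : SmoothFn (⊤ : Opens 𝔤), ∀ p ∈ sq O,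
      HasDerivWithinAt (fun s => κ s p * f.1 (Φ s p))
        (∑ i, lieDer (adField (e i)) (fun q => e.repr (β t q) i * (κ t q * f.1 (Φ t q))) p) I t := by
  have hΦt := fun {s} (hs : s ∈ I) => hΦ.toOn.contDiffOn hs
  have hκt := fun {s} (hs : s ∈ I) => hκ.toOn.contDiffOn hs
  have hβt := fun {s} (hs : s ∈ I) => hβ.toOn.contDiffOn hs
  -- The right hand side of the equation for `m_t`, for a distribution `u`.
  have rhs : ∀ t (ht : t ∈ I) (u : CompDistr (sq O)) (f : SmoothFn (⊤ : Opens 𝔤)),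
      -((prodMap O (Φ t) (κ t) ∘ₗ betaL e O (β t)) u).1 f =
        u.1 (∑ i, derFn (adField (e i)) (contDiff_adField (e i)).contDiffOn
          (mulFn (fun p => e.repr (β t p) i) (contDiffOn_coord e (hβt ht) i)
            (mulFn (κ t) (hκt ht) (compFn (Φ t) (hΦt ht) f)))) := fun t ht u f => by
    rw [LinearMap.comp_apply, prodMap_apply (hΦt ht) (hκt ht), betaL_apply e (hβt ht), neg_neg]
  have rhs_apply : ∀ t (ht : t ∈ I) (f : SmoothFn (⊤ : Opens 𝔤)) (p : 𝔤 × 𝔤), p ∈ sq O →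
      (∑ i, derFn (adField (e i)) (contDiff_adField (e i)).contDiffOn
          (mulFn (fun p => e.repr (β t p) i) (contDiffOn_coord e (hβt ht) i)
            (mulFn (κ t) (hκt ht) (compFn (Φ t) (hΦt ht) f))) : SmoothFn (sq O)).1 p =
      ∑ i, lieDer (adField (e i)) (fun q => e.repr (β t q) i * (κ t q * f.1 (Φ t q))) p :=
    fun t ht f p hp => by
      rw [AddSubmonoidClass.coe_finsetSum, Finset.sum_apply]
      exact Finset.sum_congr rfl fun i _ => indicator_of_mem (s := (sq O : Set (𝔤 × 𝔤))) hp _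
  constructor
  · intro h t ht f p hp
    have := h t ht (dirac p hp) f
    rw [rhs t ht] at this
    rw [← rhs_apply t ht f p hp]
    refine this.congr (fun s hs => ?_) ?_
    · rw [prodMap_apply (hΦt hs) (hκt hs)]; rfl
    · rw [prodMap_apply (hΦt ht) (hκt ht)]; rfl
  · intro h t ht u f
    classical
    rw [rhs t ht]
    have key := CompDistr.hasDerivWithinAt u (smoothFamilyOn_test hΦ hκ f) hI hI'
      (H := fun s => if hs : s ∈ I then mulFn (κ s) (hκt hs) (compFn (Φ s) (hΦt hs) f) else 0)
      (fun s hs p _ => by simp only [dif_pos hs]; rfl) ht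
      (H' := ∑ i, derFn (adField (e i)) (contDiff_adField (e i)).contDiffOn
          (mulFn (fun p => e.repr (β t p) i) (contDiffOn_coord e (hβt ht) i)
            (mulFn (κ t) (hκt ht) (compFn (Φ t) (hΦt ht) f))))
      (fun p hp => by
        rw [rhs_apply t ht f p hp]
        exact ((h t ht f p hp).derivWithin (uniqueDiffOn_of_ordConnected hI hI' t ht)).symm)
    refine key.congr (fun s hs => ?_) ?_
    · rw [prodMap_apply (hΦt hs) (hκt hs), dif_pos hs]
    · rw [prodMap_apply (hΦt ht) (hκt ht), dif_pos ht]

/-- The Leibniz rule for the right hand side of the pointwise equation. -/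
theorem sum_lieDer_mul_comp {κ : 𝔤 × 𝔤 → ℝ} {Φ : 𝔤 × 𝔤 → 𝔤} {β : 𝔤 × 𝔤 → 𝔤 × 𝔤} {f : 𝔤 → ℝ}
    {p : 𝔤 × 𝔤} (hκ : DifferentiableAt ℝ κ p) (hΦ : DifferentiableAt ℝ Φ p)
    (hβ : DifferentiableAt ℝ β p) (hf : DifferentiableAt ℝ f (Φ p)) :
    ∑ i, lieDer (adField (e i)) (fun q => e.repr (β q) i * (κ q * f (Φ q))) p =
      (∑ i, lieDer (adField (e i)) (fun q => e.repr (β q) i * κ q) p) * f (Φ p) +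
        κ p * fderiv ℝ f (Φ p) (lieDer (genField β) Φ p) := by
  have hβi : ∀ i, DifferentiableAt ℝ (fun q => e.repr (β q) i) p := fun i =>
    (coordCLM e i).differentiableAt.comp p hβ
  have h1 : ∀ i, lieDer (adField (e i)) (fun q => e.repr (β q) i * (κ q * f (Φ q))) p =
      lieDer (adField (e i)) (fun q => e.repr (β q) i * κ q) p * f (Φ p) +
        κ p * fderiv ℝ f (Φ p) (fderiv ℝ Φ p (e.repr (β p) i • adField (e i) p)) := fun i => by
    have : (fun q => e.repr (β q) i * (κ q * f (Φ q))) =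
        fun q => (e.repr (β q) i * κ q) * f (Φ q) := by ext q; ring
    have h2 : fderiv ℝ (fun q => f (Φ q)) p = (fderiv ℝ f (Φ p)).comp (fderiv ℝ Φ p) :=
      fderiv_comp p hf hΦ
    rw [this, lieDer_mul (f := fun q => e.repr (β q) i * κ q) (g := fun q => f (Φ q))
      ((hβi i).mul hκ) (hf.comp p hΦ)]
    unfold lieDer
    rw [h2]
    simp
    ring
  rw [Finset.sum_congr rfl fun i _ => h1 i, Finset.sum_add_distrib, ← Finset.sum_mul,
    ← Finset.mul_sum, ← map_sum, ← map_sum, sum_repr_smul_adField]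
  rfl

omit [NormedLieAlgebra 𝔤] [FiniteDimensional ℝ 𝔤] in
theorem mem_sq_nhds {p : 𝔤 × 𝔤} (hp : p ∈ sq O) : (sq O : Set (𝔤 × 𝔤)) ∈ 𝓝 p :=
  (sq O).isOpen.mem_nhds hp

theorem differentiableAt_of_contDiffOn {F : Type*} [NormedAddCommGroup F] [NormedSpace ℝ F]
    {f : 𝔤 × 𝔤 → F} (hf : ContDiffOn ℝ ∞ f (sq O : Set (𝔤 × 𝔤))) {p : 𝔤 × 𝔤} (hp : p ∈ sq O) :
    DifferentiableAt ℝ f p :=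
  (hf.contDiffAt (mem_sq_nhds hp)).differentiableAt (by simp)

theorem distrEq_of_phiEq_kappaEq (hI : I.OrdConnected) (hI' : I.Nontrivial)
    (hΦ : SmoothFamily I O Φ) (hκ : SmoothFamily I O κ) (hβ : SmoothFamily I O β)
    (h1 : PhiEq I O Φ β) (h2 : KappaEq e I O κ β) : DistrEq e I O Φ κ β := by
  rw [distrEq_iff_pointwise e hI hI' hΦ hκ hβ]
  intro t ht f p hp
  have hf : DifferentiableAt ℝ f.1 (Φ t p) := SmoothFn.differentiableAt f trivial
  rw [sum_lieDer_mul_comp e (differentiableAt_of_contDiffOn (hκ.toOn.contDiffOn ht) hp)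
    (differentiableAt_of_contDiffOn (hΦ.toOn.contDiffOn ht) hp)
    (differentiableAt_of_contDiffOn (hβ.toOn.contDiffOn ht) hp) hf]
  exact (h2 t ht p hp).mul (hf.hasFDerivAt.comp_hasDerivWithinAt t (h1 t ht p hp))

theorem kappaEq_of_distrEq (hI : I.OrdConnected) (hI' : I.Nontrivial)
    (hΦ : SmoothFamily I O Φ) (hκ : SmoothFamily I O κ) (hβ : SmoothFamily I O β)
    (h : DistrEq e I O Φ κ β) : KappaEq e I O κ β := by
  rw [distrEq_iff_pointwise e hI hI' hΦ hκ hβ] at h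
  intro t ht p hp
  simpa using h t ht ⟨fun _ => 1, contDiffOn_const⟩ p hp

theorem phiEq_of_distrEq (hI : I.OrdConnected) (hI' : I.Nontrivial)
    (hΦ : SmoothFamily I O Φ) (hκ : SmoothFamily I O κ) (hβ : SmoothFamily I O β)
    (hdense : I ×ˢ (sq O : Set (𝔤 × 𝔤)) ⊆
      closure {q | q ∈ I ×ˢ (sq O : Set (𝔤 × 𝔤)) ∧ κ q.1 q.2 ≠ 0})
    (h : DistrEq e I O Φ κ β) : PhiEq I O Φ β := by
  have hκeq := kappaEq_of_distrEq e hI hI' hΦ hκ hβ h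
  rw [distrEq_iff_pointwise e hI hI' hΦ hκ hβ] at h
  have hU := uniqueDiffOn_of_ordConnected hI hI'
  -- Testing against linear functions gives the equation for `Φ_t` wherever `κ_t ≠ 0`.
  have key : EqOn (fun q : ℝ × (𝔤 × 𝔤) => velocity I Φ q.1 q.2)
      (fun q => lieDer (genField (β q.1)) (Φ q.1) q.2)
      {q | q ∈ I ×ˢ (sq O : Set (𝔤 × 𝔤)) ∧ κ q.1 q.2 ≠ 0} := by
    rintro ⟨t, p⟩ ⟨⟨ht, hp⟩, hne⟩
    have hp' : p ∈ sq O := hp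
    refine (SeparatingDual.eq_iff_forall_dual_eq (R := ℝ)).2 fun l => ?_
    have hl : DifferentiableAt ℝ l (Φ t p) := l.differentiableAt
    have e1 := h t ht ⟨l, l.contDiff.contDiffOn⟩ p hp
    simp only at e1
    rw [sum_lieDer_mul_comp e (differentiableAt_of_contDiffOn (hκ.toOn.contDiffOn ht) hp')
      (differentiableAt_of_contDiffOn (hΦ.toOn.contDiffOn ht) hp')
      (differentiableAt_of_contDiffOn (hβ.toOn.contDiffOn ht) hp') hl] at e1
    have e2 := (hκeq t ht p hp).mul
      (hl.hasFDerivAt.comp_hasDerivWithinAt t (hΦ.toOn.hasDerivWithinAt ht hp'))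
    have e3 := (hU t ht).eq_deriv _ e1 e2
    simp only [Function.comp_apply, add_right_inj, ContinuousLinearMap.fderiv] at e3
    exact (mul_left_cancel₀ hne e3).symm
  have c1 : ContinuousOn (fun q : ℝ × (𝔤 × 𝔤) => velocity I Φ q.1 q.2)
      (I ×ˢ (sq O : Set (𝔤 × 𝔤))) := (hΦ.toOn.velocity hU).continuousOn
  have c2 : ContinuousOn (fun q : ℝ × (𝔤 × 𝔤) => lieDer (genField (β q.1)) (Φ q.1) q.2)
      (I ×ˢ (sq O : Set (𝔤 × 𝔤))) := by
    have a : ContinuousOn (fun q : ℝ × (𝔤 × 𝔤) => fderiv ℝ (Φ q.1) q.2)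
      (I ×ˢ (sq O : Set (𝔤 × 𝔤))) := (hΦ.toOn.fderiv hU).continuousOn
    have hb : ContinuousOn (fun q : ℝ × (𝔤 × 𝔤) => genField (β q.1) q.2)
        (I ×ˢ (sq O : Set (𝔤 × 𝔤))) := by
      have : (fun q : ℝ × (𝔤 × 𝔤) => genField (β q.1) q.2) = fun q =>
          (∑ i, coordCLM e i (β q.1 q.2) • adField (e i) q.2) := by
        ext1 q
        exact (sum_repr_smul_adField e _ _).symm
      rw [this]
      refine continuousOn_finsetSum _ fun i _ => ?_
      exact ((coordCLM e i).continuous.comp_continuousOn hβ.continuousOn).smul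
        ((contDiff_adField (e i)).continuous.comp continuous_snd).continuousOn
    exact a.clm_apply hb
  have full := key.of_subset_closure c1 c2 (fun q hq => hq.1) hdense
  intro t ht p hp
  have := hΦ.toOn.hasDerivWithinAt ht hp
  rwa [show velocity I Φ t p = _ from full (show (t, p) ∈ _ from ⟨ht, hp⟩)] at this

end FiniteDim

/-! ### Exponentials in Banach algebras and linear differential equations -/

section BanachAlgebra

variable {𝔸 : Type*} [NormedRing 𝔸] [NormedAlgebra ℝ 𝔸] [CompleteSpace 𝔸]

theorem exp_add_of_commute {x y : 𝔸} (h : Commute x y) : exp (x + y) = exp x * exp y := by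
  let +nondep : NormedAlgebra ℚ 𝔸 := .restrictScalars ℚ ℝ 𝔸
  exact NormedSpace.exp_add_of_commute h

theorem exp_mul_exp_neg (x : 𝔸) : exp x * exp (-x) = 1 := by
  rw [← exp_add_of_commute (Commute.refl x).neg_right, add_neg_cancel, NormedSpace.exp_zero]

theorem exp_neg_mul_exp (x : 𝔸) : exp (-x) * exp x = 1 := by
  rw [← exp_add_of_commute (Commute.refl x).neg_left, neg_add_cancel, NormedSpace.exp_zero]

theorem hasDerivAt_exp_neg_smul (x : 𝔸) (t : ℝ) :
    HasDerivAt (fun s : ℝ => exp (-(s • x))) (-(x * exp (-(t • x)))) t := by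
  have := hasDerivAt_exp_smul_const' (𝕂 := ℝ) (-x) t
  simpa using this

theorem contDiff_exp : ContDiff ℝ ∞ (exp : 𝔸 → 𝔸) :=
  contDiff_iff_contDiffAt.2 fun x => (NormedSpace.exp_analytic (𝕂 := ℝ) x).contDiffAt

theorem hasDerivAt_exp_line (A B : 𝔸) (r : ℝ) :
    HasDerivAt (fun ε : ℝ => exp (r • (A + ε • B))) (fderiv ℝ exp (r • A) (r • B)) 0 := by
  have h1 : HasDerivAt (fun ε : ℝ => r • (A + ε • B)) (r • B) 0 := by
    have := ((((hasDerivAt_id (0 : ℝ)).smul_const B).const_add A).const_smul r)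
    rw [one_smul] at this
    exact this
  have h2 : HasFDerivAt (exp : 𝔸 → 𝔸) (fderiv ℝ exp (r • A)) (r • (A + (0 : ℝ) • B)) := by
    rw [zero_smul, add_zero]
    exact (contDiff_exp.differentiable (by simp) _).hasFDerivAt
  exact h2.comp_hasDerivAt 0 h1

/-- Differentiating the functional equation `exp((s + h) a) = exp(s a) exp(h a)` in `a`. -/
theorem fderiv_exp_add_smul (A B : 𝔸) (s h : ℝ) :
    fderiv ℝ exp ((s + h) • A) ((s + h) • B) =
      fderiv ℝ exp (s • A) (s • B) * exp (h • A) + exp (s • A) * fderiv ℝ exp (h • A) (h • B) := by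
  have h1 := (hasDerivAt_exp_line A B s).mul (hasDerivAt_exp_line A B h)
  have h2 := hasDerivAt_exp_line A B (s + h)
  have e : (fun ε : ℝ => exp ((s + h) • (A + ε • B))) =
      (fun ε : ℝ => exp (s • (A + ε • B))) * fun ε : ℝ => exp (h • (A + ε • B)) := by
    ext ε
    rw [add_smul, exp_add_of_commute (((Commute.refl _).smul_left _).smul_right _)]
    rfl
  rw [e] at h2
  simpa using h2.unique h1

theorem hasDerivAt_fderiv_exp_smul (A B : 𝔸) (s : ℝ) :
    HasDerivAt (fun r : ℝ => fderiv ℝ exp (r • A) (r • B))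
      (fderiv ℝ exp (s • A) (s • B) * A + exp (s • A) * B) s := by
  have h0 : HasDerivAt (fun r : ℝ => fderiv ℝ exp (r • A) (r • B)) B 0 := by
    have d : Differentiable ℝ (fderiv ℝ (exp : 𝔸 → 𝔸)) :=
      (contDiff_exp.fderiv_right (m := 1) (by norm_cast)).differentiable (by simp)
    have h1 : HasDerivAt (fun r : ℝ => r • A) A 0 := by
      simpa using (hasDerivAt_id (0 : ℝ)).smul_const A
    have h2 : HasDerivAt (fun r : ℝ => r • B) B 0 := by
      simpa using (hasDerivAt_id (0 : ℝ)).smul_const B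
    have := ((d _).hasFDerivAt.comp_hasDerivAt (0 : ℝ) h1).clm_apply h2
    simpa [(hasFDerivAt_exp_zero (𝕂 := ℝ) (𝔸 := 𝔸)).fderiv] using this
  have h1 : HasDerivAt (fun r : ℝ => fderiv ℝ exp (s • A) (s • B) * exp (r • A) +
      exp (s • A) * fderiv ℝ exp (r • A) (r • B))
      (fderiv ℝ exp (s • A) (s • B) * A + exp (s • A) * B) (s - s) := by
    rw [sub_self]
    have := ((hasDerivAt_exp_smul_const (𝕂 := ℝ) A 0).const_mul
      (fderiv ℝ exp (s • A) (s • B))).add (h0.const_mul (exp (s • A)))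
    rw [zero_smul, NormedSpace.exp_zero, one_mul] at this
    exact this
  have h2 := h1.comp_sub_const s s
  refine h2.congr_of_eventuallyEq (Eventually.of_forall fun r => ?_)
  have := fderiv_exp_add_smul A B s (r - s)
  rw [add_sub_cancel] at this
  exact this

/-- The left logarithmic derivative of the exponential, along the ray through `A`. -/
theorem hasDerivAt_exp_neg_mul_fderiv_exp (A B : 𝔸) (s : ℝ) :
    HasDerivAt (fun r : ℝ => exp (-(r • A)) * fderiv ℝ exp (r • A) (r • B))
      (B - (A * (exp (-(s • A)) * fderiv ℝ exp (s • A) (s • B)) -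
        (exp (-(s • A)) * fderiv ℝ exp (s • A) (s • B)) * A)) s := by
  refine ((hasDerivAt_exp_neg_smul A s).mul (hasDerivAt_fderiv_exp_smul A B s)).congr_deriv ?_
  rw [mul_add, ← mul_assoc (exp (-(s • A))) (exp (s • A)), exp_neg_mul_exp, one_mul]
  noncomm_ring

end BanachAlgebra

section LinearODE

variable {X : Type*} [NormedAddCommGroup X] [NormedSpace ℝ X] [CompleteSpace X]

theorem eq_exp_neg_apply_of_hasDerivAt (a : X →L[ℝ] X) {D : ℝ → X}
    (h : ∀ t ∈ Icc (0 : ℝ) 1, HasDerivAt D (-(a (D t))) t) :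
    ∀ t ∈ Icc (0 : ℝ) 1, D t = exp (-(t • a)) (D 0) := by
  have hG : ∀ t ∈ Icc (0 : ℝ) 1, HasDerivAt (fun t : ℝ => exp (t • a) (D t)) 0 t := fun t ht => by
    have := (hasDerivAt_exp_smul_const (𝕂 := ℝ) a t).clm_apply (h t ht)
    simpa using this
  intro t ht
  have h1 := constant_of_has_deriv_right_zero (a := 0) (b := 1)
    (fun t ht => (hG t ht).continuousAt.continuousWithinAt)
    (fun t ht => (hG t (Ico_subset_Icc_self ht)).hasDerivWithinAt) t ht
  simp only [zero_smul, NormedSpace.exp_zero, one_apply_eq_self] at h1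
  rw [← h1, ← mul_apply_eq_comp, exp_neg_mul_exp, one_apply_eq_self]

/-- Uniqueness for the linear equation `B' = v - a B`. -/
theorem eq_of_hasDerivAt_sub (a : X →L[ℝ] X) {v : X} {B C : ℝ → X}
    (hB : ∀ t ∈ Icc (0 : ℝ) 1, HasDerivAt B (v - a (B t)) t)
    (hC : ∀ t ∈ Icc (0 : ℝ) 1, HasDerivAt C (v - a (C t)) t) (h0 : B 0 = C 0) :
    ∀ t ∈ Icc (0 : ℝ) 1, B t = C t := by
  intro t ht
  have := eq_exp_neg_apply_of_hasDerivAt a (D := fun t => B t - C t) (fun t ht =>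
    ((hB t ht).sub (hC t ht)).congr_deriv (by rw [map_sub]; abel)) t ht
  rw [h0, sub_self, map_zero] at this
  exact sub_eq_zero.1 this

end LinearODE

/-! ### The functions `(1 - e⁻ᵃ)/a` and `(eᵃ - 1)/a` -/

section FunctionalCalculus

variable {𝔸 : Type*} [NormedRing 𝔸] [NormedAlgebra ℝ 𝔸]

/-- The coefficients of `(1 - e⁻ᵃ)/a`. -/
noncomputable def coeffOneSub (n : ℕ) : ℝ := (-1 : ℝ) ^ n / ((n + 1).factorial : ℝ)

/-- The entire function `(1 - e⁻ᵃ)/a` on a Banach algebra. -/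
noncomputable def oneSubExp (a : 𝔸) : 𝔸 := ∑' n, coeffOneSub n • a ^ n

omit [NormedAlgebra ℝ 𝔸] in
theorem norm_pow_le_mul_pow (a : 𝔸) (n : ℕ) : ‖a ^ n‖ ≤ (1 + ‖(1 : 𝔸)‖) * ‖a‖ ^ n := by
  rcases n.eq_zero_or_pos with rfl | hn
  · simp
  · exact (norm_pow_le' a hn).trans (le_mul_of_one_le_left (by positivity) (by simp))

theorem abs_coeffOneSub (n : ℕ) : |coeffOneSub n| = 1 / ((n + 1).factorial : ℝ) := by
  rw [coeffOneSub, abs_div, abs_pow, abs_neg, abs_one, one_pow, Nat.abs_cast]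

theorem abs_coeffOneSub_mul (n : ℕ) : |coeffOneSub n| * ((n + 1 : ℕ) : ℝ) = 1 / n.factorial := by
  rw [abs_coeffOneSub, Nat.factorial_succ]
  have : ((n + 1 : ℕ) : ℝ) ≠ 0 := by positivity
  push_cast at this ⊢
  field_simp

theorem oneSubExp_zero : oneSubExp (0 : 𝔸) = 1 := by
  rw [oneSubExp, tsum_eq_single 0]
  · simp [coeffOneSub]
  · intro n hn
    rw [zero_pow hn, smul_zero]

variable [CompleteSpace 𝔸]

theorem summable_coeffOneSub (a : 𝔸) : Summable fun n => coeffOneSub n • a ^ n := by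
  refine Summable.of_norm_bounded
    ((Real.summable_pow_div_factorial ‖a‖).mul_left (1 + ‖(1 : 𝔸)‖)) fun n => ?_
  rw [norm_smul, Real.norm_eq_abs, abs_coeffOneSub]
  have h1 : 1 / ((n + 1).factorial : ℝ) ≤ 1 / (n.factorial : ℝ) :=
    one_div_le_one_div_of_le (by positivity) (by exact_mod_cast Nat.factorial_le n.le_succ)
  calc 1 / ((n + 1).factorial : ℝ) * ‖a ^ n‖
      ≤ 1 / (n.factorial : ℝ) * ((1 + ‖(1 : 𝔸)‖) * ‖a‖ ^ n) :=
        mul_le_mul h1 (norm_pow_le_mul_pow a n) (norm_nonneg _) (by positivity)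
    _ = _ := by ring

/-- `t (1 - e^{-ta})/(ta) = ∫₀ᵗ e^{-sa} ds`. -/
theorem hasDerivAt_smul_oneSubExp (a : 𝔸) (t : ℝ) :
    HasDerivAt (fun s : ℝ => s • oneSubExp (s • a)) (exp (-(t • a))) t := by
  set R : ℝ := |t| + 1 with hR
  have hR0 : 0 < R := by positivity
  have e1 : (fun s : ℝ => s • oneSubExp (s • a)) =
      fun s => ∑' n, (coeffOneSub n * s ^ (n + 1)) • a ^ n := by
    ext1 s
    rw [oneSubExp, ← (summable_coeffOneSub _).tsum_const_smul]
    refine tsum_congr fun n => ?_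
    rw [smul_pow, smul_smul, smul_smul]
    congr 1
    ring
  have e2 : exp (-(t • a)) = ∑' n, (coeffOneSub n * ((n + 1 : ℕ) * t ^ n)) • a ^ n := by
    rw [NormedSpace.exp_eq_tsum ℝ]
    refine tsum_congr fun n => ?_
    rw [← neg_smul, smul_pow, smul_smul]
    congr 1
    rw [coeffOneSub, neg_pow t, Nat.factorial_succ]
    have : ((n + 1 : ℕ) : ℝ) ≠ 0 := by positivity
    push_cast at this ⊢
    field_simp
  have hd : ∀ (n : ℕ) (y : ℝ), HasDerivAt (fun s : ℝ => (coeffOneSub n * s ^ (n + 1)) • a ^ n)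
      ((coeffOneSub n * ((n + 1 : ℕ) * y ^ n)) • a ^ n) y := fun n y =>
    ((hasDerivAt_pow (n + 1) y).const_mul (coeffOneSub n)).smul_const (a ^ n)
  have hb : ∀ (n : ℕ) (y : ℝ), y ∈ Metric.ball (0 : ℝ) R →
      ‖(coeffOneSub n * ((n + 1 : ℕ) * y ^ n)) • a ^ n‖ ≤
        (1 + ‖(1 : 𝔸)‖) * ((R * ‖a‖) ^ n / n.factorial) := by
    intro n y hy
    have hy' : |y| ≤ R := by simpa using (mem_ball_zero_iff.1 hy).le
    rw [norm_smul, mul_pow, Real.norm_eq_abs, abs_mul, abs_mul, abs_pow, Nat.abs_cast]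
    calc |coeffOneSub n| * (((n + 1 : ℕ) : ℝ) * |y| ^ n) * ‖a ^ n‖
        = 1 / n.factorial * (|y| ^ n * ‖a ^ n‖) := by rw [← abs_coeffOneSub_mul]; ring
      _ ≤ 1 / n.factorial * (R ^ n * ((1 + ‖(1 : 𝔸)‖) * ‖a‖ ^ n)) := by
          gcongr
          exact norm_pow_le_mul_pow a n
      _ = (1 + ‖(1 : 𝔸)‖) * (R ^ n * ‖a‖ ^ n / n.factorial) := by ring
  have h0 : Summable fun n : ℕ => (coeffOneSub n * (0 : ℝ) ^ (n + 1)) • a ^ n := by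
    have : (fun n : ℕ => (coeffOneSub n * (0 : ℝ) ^ (n + 1)) • a ^ n) = fun _ => 0 := by
      ext n
      rw [zero_pow n.succ_ne_zero, mul_zero, zero_smul]
    rw [this]
    exact summable_zero
  have ht : t ∈ Metric.ball (0 : ℝ) R := by
    rw [mem_ball_zero_iff, Real.norm_eq_abs]; linarith
  have key := hasDerivAt_tsum_of_isPreconnected
    ((Real.summable_pow_div_factorial (R * ‖a‖)).mul_left (1 + ‖(1 : 𝔸)‖))
    Metric.isOpen_ball (convex_ball (0 : ℝ) R).isPreconnected (fun n y _ => hd n y) hb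
    (Metric.mem_ball_self hR0) h0 ht
  rw [e1, e2]
  exact key

omit [CompleteSpace 𝔸] in
theorem eq_of_hasDerivAt_zero {D : ℝ → 𝔸} (h : ∀ t, HasDerivAt D 0 t) : D 1 = D 0 :=
  constant_of_has_deriv_right_zero (a := 0) (b := 1)
    (fun t _ => (h t).continuousAt.continuousWithinAt)
    (fun t _ => (h t).hasDerivWithinAt) 1 (right_mem_Icc.2 zero_le_one)

theorem mul_oneSubExp (a : 𝔸) : a * oneSubExp a = 1 - exp (-a) := by
  have := eq_of_hasDerivAt_zero (D := fun t : ℝ => a * (t • oneSubExp (t • a)) + exp (-(t • a)))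
    fun t => (((hasDerivAt_smul_oneSubExp a t).const_mul a).add
      (hasDerivAt_exp_neg_smul a t)).congr_deriv (add_neg_cancel _)
  simp only [one_smul, zero_smul, mul_zero, neg_zero, NormedSpace.exp_zero, zero_add] at this
  exact eq_sub_of_add_eq this

/-- An element that intertwines `a` and `b` intertwines `(1 - e⁻ᵃ)/a` and `(1 - e⁻ᵇ)/b`. -/
theorem oneSubExp_intertwine {P a b : 𝔸} (h : P * a = b * P) :
    P * oneSubExp a = oneSubExp b * P := by
  have hn : ∀ n : ℕ, P * a ^ n = b ^ n * P := fun n => SemiconjBy.pow_right (a := P) h n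
  rw [oneSubExp, oneSubExp, ← (summable_coeffOneSub a).tsum_mul_left,
    ← (summable_coeffOneSub b).tsum_mul_right]
  refine tsum_congr fun n => ?_
  rw [mul_smul_comm, smul_mul_assoc, hn]

theorem oneSubExp_mul (a : 𝔸) : oneSubExp a * a = 1 - exp (-a) := by
  rw [← oneSubExp_intertwine rfl, mul_oneSubExp]

theorem exp_intertwine {P a b : 𝔸} (h : P * a = b * P) : P * exp a = exp b * P := by
  have h1 : ∀ c : 𝔸, exp c = 1 + c * oneSubExp (-c) := fun c => by
    have := mul_oneSubExp (-c)
    rw [neg_neg, neg_mul, neg_eq_iff_eq_neg, neg_sub] at this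
    rw [this]; abel
  have h2 : P * -a = -b * P := by rw [mul_neg, h, neg_mul]
  rw [h1 a, h1 b, mul_add, add_mul, mul_one, one_mul, ← mul_assoc, h, mul_assoc, mul_assoc,
    oneSubExp_intertwine h2]

/-- `(eᵃ - 1)/a = eᵃ (1 - e⁻ᵃ)/a`. -/
theorem oneSubExp_neg (a : 𝔸) : oneSubExp (-a) = exp a * oneSubExp a := by
  have := eq_of_hasDerivAt_zero
    (D := fun t : ℝ => exp (t • a) * (t • oneSubExp (t • a)) - t • oneSubExp (t • -a)) fun t => by
    refine (((hasDerivAt_exp_smul_const (𝕂 := ℝ) a t).mul (hasDerivAt_smul_oneSubExp a t)).sub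
      (hasDerivAt_smul_oneSubExp (-a) t)).congr_deriv ?_
    have h1 : a * t • oneSubExp (t • a) = 1 - exp (-(t • a)) := by
      rw [mul_smul_comm, ← smul_mul_assoc, mul_oneSubExp]
    rw [mul_assoc, h1, mul_sub, mul_one, exp_mul_exp_neg, smul_neg, neg_neg]
    abel
  simp only [one_smul, zero_smul, mul_zero, sub_zero] at this
  exact (sub_eq_zero.1 this).symm

theorem contDiff_oneSubExp : ContDiff ℝ ∞ (oneSubExp : 𝔸 → 𝔸) := by
  have hr : (FormalMultilinearSeries.ofScalars 𝔸 coeffOneSub).radius = ⊤ := by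
    refine FormalMultilinearSeries.ofScalars_radius_eq_top_of_tendsto _ _
      (Eventually.of_forall fun n => ?_) ?_
    · exact abs_pos.1 (by rw [abs_coeffOneSub]; positivity)
    · have : (fun n => ‖coeffOneSub n.succ‖ / ‖coeffOneSub n‖) =
          fun n : ℕ => 1 / (((n + 1 : ℕ) : ℝ) + 1) := by
        ext n
        rw [Real.norm_eq_abs, Real.norm_eq_abs, abs_coeffOneSub, abs_coeffOneSub,
          Nat.factorial_succ (n.succ)]
        have : (n.succ.factorial : ℝ) ≠ 0 := by positivity
        push_cast
        field_simp
      rw [this]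
      exact tendsto_one_div_add_atTop_nhds_zero_nat.comp (tendsto_add_atTop_nat 1)
  have h1 : (oneSubExp : 𝔸 → 𝔸) = (FormalMultilinearSeries.ofScalars 𝔸 coeffOneSub).sum := by
    rw [show (FormalMultilinearSeries.ofScalars 𝔸 coeffOneSub).sum =
      FormalMultilinearSeries.ofScalarsSum coeffOneSub from rfl,
      FormalMultilinearSeries.ofScalarsSum_eq_tsum]
    rfl
  rw [h1]
  have := (FormalMultilinearSeries.ofScalars 𝔸 coeffOneSub).hasFPowerSeriesOnBall (by rw [hr]; simp)
  refine contDiff_iff_contDiffAt.2 fun x => (this.analyticAt_of_mem ?_).contDiffAt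
  rw [hr]
  simp

end FunctionalCalculus

section Endomorphisms

variable {𝔤 : Type*} [NormedLieRing 𝔤] [NormedLieAlgebra 𝔤]

theorem expSubOneDiv_eq [FiniteDimensional ℝ 𝔤] (a : 𝔤 →L[ℝ] 𝔤) :
    expSubOneDiv a = exp a * oneSubExp a := by
  have : CompleteSpace 𝔤 := FiniteDimensional.complete ℝ 𝔤
  rw [← oneSubExp_neg]
  unfold expSubOneDiv oneSubExp
  refine tsum_congr fun n => ?_
  rw [← neg_one_smul ℝ a, smul_pow, smul_smul, coeffOneSub, div_mul_eq_mul_div, ← mul_pow,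
    neg_one_mul, neg_neg, one_pow]

end Endomorphisms

/-! ### The determinant and its derivative -/

section Determinant

variable {V : Type*} [NormedAddCommGroup V] [NormedSpace ℝ V] [FiniteDimensional ℝ V]

theorem contDiff_clm_det : ContDiff ℝ ∞ (fun a : V →L[ℝ] V => a.det) := by
  classical
  set b := Module.finBasis ℝ V
  have h1 : (fun a : V →L[ℝ] V => a.det) = fun a => ∑ σ : Equiv.Perm (Fin (Module.finrank ℝ V)),
      (Equiv.Perm.sign σ : ℝ) * ∏ i, b.repr (a (b i)) (σ i) := by
    ext a
    rw [ContinuousLinearMap.det, ← LinearMap.det_toMatrix b, Matrix.det_apply']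
    simp [LinearMap.toMatrix_apply]
  rw [h1]
  refine ContDiff.sum fun σ _ => contDiff_const.mul (contDiff_prod fun i _ => ?_)
  exact ((LinearMap.toContinuousLinearMap (b.coord (σ i))).comp
    (ContinuousLinearMap.apply ℝ V (b i))).contDiff

theorem fderiv_det_one (a : V →L[ℝ] V) :
    fderiv ℝ (fun a : V →L[ℝ] V => a.det) 1 a = LinearMap.trace ℝ V (a : V →ₗ[ℝ] V) := by
  classical
  set b := Module.finBasis ℝ V
  have h1 : HasDerivAt (fun r : ℝ => (1 + r • a).det)
      (fderiv ℝ (fun a : V →L[ℝ] V => a.det) 1 a) 0 := by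
    have h2 : HasDerivAt (fun r : ℝ => (1 : V →L[ℝ] V) + r • a) a 0 := by
      simpa using ((hasDerivAt_id (0 : ℝ)).smul_const a).const_add (1 : V →L[ℝ] V)
    have h3 : HasFDerivAt (fun a : V →L[ℝ] V => a.det)
        (fderiv ℝ (fun a : V →L[ℝ] V => a.det) 1) ((1 : V →L[ℝ] V) + (0 : ℝ) • a) := by
      rw [zero_smul, add_zero]
      exact (contDiff_clm_det.differentiable (by simp) _).hasFDerivAt
    exact h3.comp_hasDerivAt 0 h2
  set A := LinearMap.toMatrix b b (a : V →ₗ[ℝ] V) with hA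
  set p := (Matrix.det (1 + (Polynomial.X : Polynomial ℝ) • A.map Polynomial.C)).divX.divX with hp
  have e : (fun r : ℝ => ((1 : V →L[ℝ] V) + r • a).det) =
      fun r => 1 + A.trace * r + p.eval r * r ^ 2 := by
    ext r
    rw [← Matrix.det_one_add_smul, ContinuousLinearMap.det, ← LinearMap.det_toMatrix b]
    congr 1
    rw [hA, ← map_smul, ← LinearMap.toMatrix_one b, ← map_add]
    rfl
  have h4 : HasDerivAt (fun r : ℝ => 1 + A.trace * r + p.eval r * r ^ 2) A.trace 0 := by
    have h5 := (((hasDerivAt_id (0 : ℝ)).const_mul A.trace).const_add 1).add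
      ((p.hasDerivAt 0).mul (hasDerivAt_pow 2 (0 : ℝ)))
    refine h5.congr_deriv ?_
    simp
  rw [e] at h1
  rw [h1.unique h4, hA, LinearMap.trace_eq_matrix_trace ℝ b]

/-- Jacobi's formula for the derivative of a determinant at an invertible endomorphism. -/
theorem hasDerivAt_det {A : ℝ → V →L[ℝ] V} {A' B : V →L[ℝ] V} {t : ℝ} (hA : HasDerivAt A A' t)
    (hB : B * A t = 1) :
    HasDerivAt (fun s => (A s).det) ((A t).det * LinearMap.trace ℝ V (B * A' : V →L[ℝ] V)) t := by
  have hB' : A t * B = 1 := by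
    have h := mul_eq_one_comm.1 (congrArg (fun a : V →L[ℝ] V => (a : V →ₗ[ℝ] V)) hB)
    ext v
    exact LinearMap.congr_fun h v
  have h1 : HasDerivAt (fun s => B * A s) (B * A') t := hA.const_mul B
  have h2 : HasFDerivAt (fun a : V →L[ℝ] V => a.det)
      (fderiv ℝ (fun a : V →L[ℝ] V => a.det) 1) (B * A t) := by
    rw [hB]
    exact (contDiff_clm_det.differentiable (by simp) _).hasFDerivAt
  have h3 := (h2.comp_hasDerivAt t h1).const_mul (A t).det
  rw [fderiv_det_one] at h3
  refine h3.congr_of_eventuallyEq (Eventually.of_forall fun s => ?_)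
  change (A s).det = (A t).det * (B * A s).det
  have : A s = A t * (B * A s) := by rw [← mul_assoc, hB', one_mul]
  conv_lhs => rw [this]
  exact LinearMap.det_comp _ _

end Determinant

/-! ### The adjoint representation and the density `J` -/

section Adjoint

variable {𝔤 : Type*} [NormedLieRing 𝔤] [NormedLieAlgebra 𝔤] [FiniteDimensional ℝ 𝔤]

theorem completeSpace_lie : CompleteSpace 𝔤 := FiniteDimensional.complete ℝ 𝔤

attribute [local instance] completeSpace_lie

theorem adL_apply (x y : 𝔤) : adL x y = ⁅x, y⁆ := rfl

/-- The adjoint representation as a continuous linear map `𝔤 → End 𝔤`. -/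
noncomputable def adCLM : 𝔤 →L[ℝ] (𝔤 →L[ℝ] 𝔤) :=
  LinearMap.toContinuousLinearMap
    { toFun := adL
      map_add' := fun x y => by ext z; simp [adL_apply]
      map_smul' := fun c x => by ext z; simp [adL_apply] }

theorem adL_smul (t : ℝ) (x : 𝔤) : adL (t • x) = t • adL x := map_smul (adCLM (𝔤 := 𝔤)) t x

theorem adL_zero : adL (0 : 𝔤) = 0 := map_zero (adCLM (𝔤 := 𝔤))

theorem adL_lie (x y : 𝔤) : adL ⁅x, y⁆ = adL x * adL y - adL y * adL x := by
  ext z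
  simp [adL_apply]

theorem hasDerivAt_adL {c : ℝ → 𝔤} {c' : 𝔤} {t : ℝ} (h : HasDerivAt c c' t) :
    HasDerivAt (fun s => adL (c s)) (adL c') t :=
  (adCLM (𝔤 := 𝔤)).hasFDerivAt.comp_hasDerivAt t h

/-- The commutator `b ↦ a b - b a` as a continuous linear map. -/
noncomputable def commCLM (a : 𝔤 →L[ℝ] 𝔤) : (𝔤 →L[ℝ] 𝔤) →L[ℝ] (𝔤 →L[ℝ] 𝔤) :=
  ContinuousLinearMap.mul ℝ (𝔤 →L[ℝ] 𝔤) a - (ContinuousLinearMap.mul ℝ (𝔤 →L[ℝ] 𝔤)).flip a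

omit [FiniteDimensional ℝ 𝔤] in
theorem commCLM_apply (a b : 𝔤 →L[ℝ] 𝔤) : commCLM a b = a * b - b * a := rfl

theorem hasDerivAt_exp_smul_apply (x v : 𝔤) (t : ℝ) :
    HasDerivAt (fun s : ℝ => exp (s • adL x) v) ⁅x, exp (t • adL x) v⁆ t :=
  ((ContinuousLinearMap.apply ℝ 𝔤 v).hasFDerivAt.comp_hasDerivAt t
    (hasDerivAt_exp_smul_const' (𝕂 := ℝ) (adL x) t))

theorem hasDerivAt_smul_oneSubExp_apply (x v : 𝔤) (t : ℝ) :
    HasDerivAt (fun s : ℝ => s • oneSubExp (s • adL x) v)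
      (v - ⁅x, t • oneSubExp (t • adL x) v⁆) t := by
  have h := (ContinuousLinearMap.apply ℝ 𝔤 v).hasFDerivAt.comp_hasDerivAt t
    (hasDerivAt_smul_oneSubExp (adL x) t)
  refine h.congr_deriv ?_
  have h1 : (t • adL x) * oneSubExp (t • adL x) = 1 - exp (-(t • adL x)) := mul_oneSubExp _
  have h2 : ⁅x, t • oneSubExp (t • adL x) v⁆ = ((t • adL x) * oneSubExp (t • adL x)) v := by
    rw [lie_smul]; rfl
  rw [h2, h1]
  simp

/-- `e^{ad ξ}` is an automorphism of the Lie algebra. -/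
theorem adL_exp_apply (ξ v : 𝔤) :
    adL (exp (adL ξ) v) = exp (adL ξ) * adL v * exp (-adL ξ) := by
  have hD : ∀ t ∈ Icc (0 : ℝ) 1, HasDerivAt (fun s : ℝ => adL (exp (s • adL ξ) v))
      (0 - (-commCLM (adL ξ)) (adL (exp (t • adL ξ) v))) t := fun t _ =>
    (hasDerivAt_adL (hasDerivAt_exp_smul_apply ξ v t)).congr_deriv (by
      rw [adL_lie, neg_apply, commCLM_apply, zero_sub, neg_neg])
  have hC : ∀ t ∈ Icc (0 : ℝ) 1, HasDerivAt
      (fun s : ℝ => exp (s • adL ξ) * adL v * exp (-(s • adL ξ)))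
      (0 - (-commCLM (adL ξ)) (exp (t • adL ξ) * adL v * exp (-(t • adL ξ)))) t := fun t _ => by
    refine (((hasDerivAt_exp_smul_const' (𝕂 := ℝ) (adL ξ) t).mul_const (adL v)).mul
      (hasDerivAt_exp_neg_smul (adL ξ) t)).congr_deriv ?_
    have hc : adL ξ * exp (-(t • adL ξ)) = exp (-(t • adL ξ)) * adL ξ :=
      exp_intertwine (P := adL ξ) (by simp)
    rw [neg_apply, commCLM_apply, zero_sub, neg_neg, mul_neg, hc]
    simp only [mul_assoc, sub_eq_add_neg]
  have := eq_of_hasDerivAt_sub (-commCLM (adL ξ)) hD hC (by simp [NormedSpace.exp_zero]) 1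
    (right_mem_Icc.2 zero_le_one)
  simpa using this

theorem adL_exp_apply_mul (ξ v : 𝔤) :
    exp (adL ξ) * adL v = adL (exp (adL ξ) v) * exp (adL ξ) := by
  rw [adL_exp_apply, mul_assoc, exp_neg_mul_exp, mul_one]

/-- The differential of `x ↦ e^{ad x}`. -/
theorem fderiv_exp_adL (x v : 𝔤) :
    fderiv ℝ exp (adL x) (adL v) = exp (adL x) * adL (oneSubExp (adL x) v) := by
  have hB : ∀ t ∈ Icc (0 : ℝ) 1, HasDerivAt
      (fun s : ℝ => exp (-(s • adL x)) * fderiv ℝ exp (s • adL x) (s • adL v))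
      (adL v - commCLM (adL x)
        (exp (-(t • adL x)) * fderiv ℝ exp (t • adL x) (t • adL v))) t := fun t _ =>
    hasDerivAt_exp_neg_mul_fderiv_exp (adL x) (adL v) t
  have hC : ∀ t ∈ Icc (0 : ℝ) 1, HasDerivAt
      (fun s : ℝ => adL (s • oneSubExp (s • adL x) v))
      (adL v - commCLM (adL x) (adL (t • oneSubExp (t • adL x) v))) t := fun t _ =>
    (hasDerivAt_adL (hasDerivAt_smul_oneSubExp_apply x v t)).congr_deriv (by
      rw [commCLM_apply, ← adL_lie]
      exact map_sub (adCLM (𝔤 := 𝔤)) _ _)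
  have := eq_of_hasDerivAt_sub (commCLM (adL x)) hB hC (by simp [adL_zero]) 1
    (right_mem_Icc.2 zero_le_one)
  simp only [one_smul] at this
  rw [← this, ← mul_assoc, exp_mul_exp_neg, one_mul]

theorem contDiff_oneSubExp_adL : ContDiff ℝ ∞ (fun x : 𝔤 => oneSubExp (adL x)) :=
  contDiff_oneSubExp.comp (adCLM (𝔤 := 𝔤)).contDiff

theorem jac_eq (x : 𝔤) : jac x = (oneSubExp (adL x)).det := rfl

theorem contDiff_jac : ContDiff ℝ ∞ (jac : 𝔤 → ℝ) := contDiff_clm_det.comp contDiff_oneSubExp_adL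

theorem jac_zero : jac (0 : 𝔤) = 1 := by
  rw [jac_eq, adL_zero, oneSubExp_zero]
  exact LinearMap.det_id

theorem jac_exp_apply (ξ x : 𝔤) : jac (exp (adL ξ) x) = jac x := by
  have h := oneSubExp_intertwine (adL_exp_apply_mul ξ x)
  have h1 : oneSubExp (adL (exp (adL ξ) x)) = exp (adL ξ) * oneSubExp (adL x) * exp (-adL ξ) := by
    rw [h, mul_assoc, exp_mul_exp_neg, mul_one]
  rw [jac_eq, jac_eq, h1]
  have h2 : LinearMap.det ((exp (adL ξ) * exp (-adL ξ) : 𝔤 →L[ℝ] 𝔤) : 𝔤 →ₗ[ℝ] 𝔤) = 1 := by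
    rw [exp_mul_exp_neg]
    exact LinearMap.det_id
  rw [show ((exp (adL ξ) * exp (-adL ξ) : 𝔤 →L[ℝ] 𝔤) : 𝔤 →ₗ[ℝ] 𝔤) =
    (exp (adL ξ) : 𝔤 →L[ℝ] 𝔤).toLinearMap * (exp (-adL ξ) : 𝔤 →L[ℝ] 𝔤).toLinearMap from rfl,
    map_mul] at h2
  rw [ContinuousLinearMap.det, ContinuousLinearMap.det,
    show ((exp (adL ξ) * oneSubExp (adL x) * exp (-adL ξ) : 𝔤 →L[ℝ] 𝔤) : 𝔤 →ₗ[ℝ] 𝔤) =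
    (exp (adL ξ) : 𝔤 →L[ℝ] 𝔤).toLinearMap * (oneSubExp (adL x) : 𝔤 →L[ℝ] 𝔤).toLinearMap *
      (exp (-adL ξ) : 𝔤 →L[ℝ] 𝔤).toLinearMap from rfl, map_mul, map_mul, mul_right_comm, h2, one_mul]

/-- The density `J` is invariant under the adjoint action. -/
theorem fderiv_jac_lie (ξ x : 𝔤) : fderiv ℝ jac x ⁅ξ, x⁆ = 0 := by
  have h1 : HasFDerivAt (jac : 𝔤 → ℝ) (fderiv ℝ jac x) (exp ((0 : ℝ) • adL ξ) x) := by
    rw [zero_smul, NormedSpace.exp_zero]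
    exact (contDiff_jac.differentiable (by simp) _).hasFDerivAt
  have h2 := h1.comp_hasDerivAt (0 : ℝ) (hasDerivAt_exp_smul_apply ξ x 0)
  have h3 : (jac : 𝔤 → ℝ) ∘ (fun s : ℝ => exp (s • adL ξ) x) = fun _ => jac x := by
    ext s
    rw [Function.comp_apply, ← adL_smul, jac_exp_apply]
  rw [h3] at h2
  have := h2.unique (hasDerivAt_const (0 : ℝ) (jac x))
  simpa [NormedSpace.exp_zero] using this

/-- The radial derivative of `J`. -/
theorem fderiv_jac_self {x : 𝔤} {B : 𝔤 →L[ℝ] 𝔤} (hB : B * oneSubExp (adL x) = 1) :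
    fderiv ℝ jac x x = jac x * tr (B * exp (-adL x) - 1) := by
  have h1 : HasDerivAt (fun s : ℝ => oneSubExp (s • adL x))
      (exp (-adL x) - oneSubExp (adL x)) 1 := by
    have h := (hasDerivAt_inv (one_ne_zero (α := ℝ))).smul (hasDerivAt_smul_oneSubExp (adL x) 1)
    simp only [inv_one, one_smul, one_pow, neg_smul, ← sub_eq_add_neg] at h
    refine h.congr_of_eventuallyEq ?_
    filter_upwards [isOpen_ne.mem_nhds (one_ne_zero (α := ℝ))] with s hs
    exact (inv_smul_smul₀ hs _).symm
  have h2 := hasDerivAt_det h1 (B := B) (by rw [one_smul, hB])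
  rw [one_smul, mul_sub, hB] at h2
  have h3 : HasFDerivAt (jac : 𝔤 → ℝ) (fderiv ℝ jac x) ((1 : ℝ) • x) := by
    rw [one_smul]
    exact (contDiff_jac.differentiable (by simp) _).hasFDerivAt
  have h4 := h3.comp_hasDerivAt (1 : ℝ) ((hasDerivAt_id (1 : ℝ)).smul_const x)
  rw [one_smul] at h4
  refine h4.unique (h2.congr_of_eventuallyEq (Eventually.of_forall fun s => ?_))
  simp only [Function.comp_apply, id, jac_eq, adL_smul]

theorem divExpSubOne_eq {a B : 𝔤 →L[ℝ] 𝔤} (hB : B * oneSubExp a = 1) (hB' : oneSubExp a * B = 1) :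
    divExpSubOne a = B * exp (-a) := by
  rw [divExpSubOne, expSubOneDiv_eq]
  let u : (𝔤 →L[ℝ] 𝔤)ˣ := ⟨exp a * oneSubExp a, B * exp (-a),
    by rw [mul_assoc, ← mul_assoc (oneSubExp a), hB', one_mul, exp_mul_exp_neg],
    by rw [mul_assoc, ← mul_assoc (exp (-a)), exp_neg_mul_exp, one_mul, hB]⟩
  exact Ring.inverse_unit u

end Adjoint

/-! ### Logarithmic coordinates: the Maurer-Cartan equation and the differential of `exp` -/

section NormedSpaceLemmas

variable {V : Type*} [NormedAddCommGroup V] [NormedSpace ℝ V]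
  {N M : V → V →L[ℝ] V} {N' M' : V →L[ℝ] V →L[ℝ] V} {x : V}

theorem fderiv_apply_of_mul_eventually_eq_one (hN : HasFDerivAt N N' x) (hM : HasFDerivAt M M' x)
    (h : ∀ᶠ y in 𝓝 x, N y * M y = 1) (v w : V) : N' v (M x w) = -N x (M' v w) := by
  have h1 : HasFDerivAt (fun y => N y (M y w))
      ((N x).comp (M'.flip w) + N'.flip (M x w)) x := by
    have := hN.clm_apply (hM.clm_apply (hasFDerivAt_const w x))
    simpa using this
  have h2 : (fun y => N y (M y w)) =ᶠ[𝓝 x] fun _ => w := by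
    filter_upwards [h] with y hy using congrArg (fun L : V →L[ℝ] V => L w) hy
  have h3 := (h1.congr_of_eventuallyEq h2.symm).unique (hasFDerivAt_const w x)
  have h4 := congrArg (fun L : V →L[ℝ] V => L v) h3
  exact eq_neg_of_add_eq_zero_right h4

theorem fderiv_apply_of_eventually_apply_self (hN : HasFDerivAt N N' x)
    (h : ∀ᶠ y in 𝓝 x, N y y = y) (v : V) : N' v x + N x v = v := by
  have h1 := hN.clm_apply (hasFDerivAt_id x)
  have h3 := (h1.congr_of_eventuallyEq (h.mono fun y hy => hy.symm)).unique (hasFDerivAt_id x)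
  have h4 : N x v + N' v x = v := congrArg (fun L : V →L[ℝ] V => L v) h3
  rwa [add_comm] at h4

theorem hasDerivAt_smul_ray {t : ℝ} (hN : HasFDerivAt N N' (t • x)) (v : V) :
    HasDerivAt (fun s : ℝ => s • N (s • x) v) (N (t • x) v + t • N' x v) t := by
  have d1 : HasDerivAt (fun s : ℝ => s • x) x t := by
    simpa using (hasDerivAt_id t).smul_const x
  have d2 : HasDerivAt (fun s : ℝ => N (s • x) v) (N' x v) t :=
    (ContinuousLinearMap.apply ℝ V v).hasFDerivAt.comp_hasDerivAt t (hN.comp_hasDerivAt t d1)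
  refine ((hasDerivAt_id t).smul d2).congr_deriv ?_
  simp [add_comm]

end NormedSpaceLemmas

section LogCoordinates

variable {𝔤 : Type*} [NormedLieRing 𝔤] [NormedLieAlgebra 𝔤] [FiniteDimensional ℝ 𝔤]

attribute [local instance] completeSpace_lie

/-- The endomorphism `(1 - e^{-ad x})/ad x`, which is the differential of the exponential map at `x`
after left translation to the unit. -/
noncomputable def leftDexp (x : 𝔤) : 𝔤 →L[ℝ] 𝔤 := oneSubExp (adL x)

theorem contDiff_leftDexp : ContDiff ℝ ∞ (leftDexp : 𝔤 → 𝔤 →L[ℝ] 𝔤) := contDiff_oneSubExp_adL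

theorem hasFDerivAt_leftDexp (x : 𝔤) :
    HasFDerivAt (leftDexp : 𝔤 → 𝔤 →L[ℝ] 𝔤) (fderiv ℝ leftDexp x) x :=
  (contDiff_leftDexp.differentiable (by simp) x).hasFDerivAt

theorem oneSubExp_apply_of_apply_eq_zero {a : 𝔤 →L[ℝ] 𝔤} {v : 𝔤} (h : a v = 0) :
    oneSubExp a v = v := by
  have hn : ∀ n, n ≠ 0 → (coeffOneSub n • a ^ n) v = 0 := fun n hn => by
    obtain ⟨k, rfl⟩ := Nat.exists_eq_succ_of_ne_zero hn
    rw [pow_succ]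
    simp [h]
  have h1 := (summable_coeffOneSub a).hasSum.mapL (ContinuousLinearMap.apply ℝ 𝔤 v)
  have h2 := hasSum_single 0 (f := fun n => (coeffOneSub n • a ^ n) v) fun n h0 => hn n h0
  have h3 := h1.unique h2
  rw [pow_zero, show coeffOneSub 0 = 1 by simp [coeffOneSub], one_smul] at h3
  exact h3

theorem exp_apply_of_apply_eq_zero {a : 𝔤 →L[ℝ] 𝔤} {v : 𝔤} (h : a v = 0) : exp a v = v := by
  have h1 := oneSubExp_mul (-a)
  rw [neg_neg] at h1
  have h2 := congrArg (fun b : 𝔤 →L[ℝ] 𝔤 => b v) h1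
  simp only [mul_apply_eq_comp, neg_apply, h, neg_zero, map_zero,
    sub_apply, one_apply_eq_self] at h2
  exact (sub_eq_zero.1 h2.symm).symm

theorem leftDexp_smul_self (t : ℝ) (x : 𝔤) : leftDexp (t • x) x = x :=
  oneSubExp_apply_of_apply_eq_zero (by simp [adL_apply])

/-- Let `M x` be the value at `x` of a frame of vector fields on a star-shaped set `U`, with the
structure constants of `𝔤`, whose integral curves through the origin are the rays. Then the
inverse of `M x` is `(1 - e^{-ad x})/ad x`. Indeed `t ↦ t M(tx)⁻¹ v` solves the
differential equation `B' = v - [x, B]`. The Maurer-Cartan equation is a by-product. -/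
theorem frame_inverse_eq {U : Opens 𝔤} (hU : StarConvex ℝ (0 : 𝔤) (U : Set 𝔤)) (h0 : (0 : 𝔤) ∈ U)
    {M : 𝔤 → 𝔤 →L[ℝ] 𝔤} (hM : ∀ x ∈ U, DifferentiableAt ℝ M x) (hu : ∀ x ∈ U, IsUnit (M x))
    (hbr : ∀ x ∈ U, ∀ v w, fderiv ℝ M x (M x v) w - fderiv ℝ M x (M x w) v = M x ⁅v, w⁆)
    (hself : ∀ x ∈ U, M x x = x) :
    (∀ x ∈ U, Ring.inverse (M x) = leftDexp x) ∧ ∀ x ∈ U, ∀ a b,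
      fderiv ℝ leftDexp x a b - fderiv ℝ leftDexp x b a = -⁅leftDexp x a, leftDexp x b⁆ := by
  set N : 𝔤 → 𝔤 →L[ℝ] 𝔤 := fun x => Ring.inverse (M x) with hN
  have hNM : ∀ x ∈ U, N x * M x = 1 := fun x hx => Ring.inverse_mul_cancel _ (hu x hx)
  have hMN : ∀ x ∈ U, M x * N x = 1 := fun x hx => Ring.mul_inverse_cancel _ (hu x hx)
  have hNd : ∀ x ∈ U, HasFDerivAt N (fderiv ℝ N x) x := fun x hx => by
    obtain ⟨u, hu'⟩ := hu x hx
    have h1 : DifferentiableAt ℝ (Ring.inverse : (𝔤 →L[ℝ] 𝔤) → _) (M x) := by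
      rw [← hu']
      exact (contDiffAt_ringInverse ℝ u (n := 1)).differentiableAt (by simp)
    exact (h1.comp x (hM x hx)).hasFDerivAt
  have hmc : ∀ x ∈ U, ∀ a b, fderiv ℝ N x a b - fderiv ℝ N x b a = -⁅N x a, N x b⁆ := by
    intro x hx a b
    -- Differentiate `N M = 1`.
    have key : ∀ h w, fderiv ℝ N x h (M x w) = -N x (fderiv ℝ M x h w) :=
      fderiv_apply_of_mul_eventually_eq_one (hNd x hx) (hM x hx).hasFDerivAt
        (by filter_upwards [U.isOpen.mem_nhds hx] with y hy using hNM y hy)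
    have ha : ∀ c, M x (N x c) = c := fun c => congrArg (fun L : 𝔤 →L[ℝ] 𝔤 => L c) (hMN x hx)
    have hb : ∀ c, N x (M x c) = c := fun c => congrArg (fun L : 𝔤 →L[ℝ] 𝔤 => L c) (hNM x hx)
    have h1 := hbr x hx (N x a) (N x b)
    have h2 := key a (N x b)
    have h3 := key b (N x a)
    rw [ha] at h2 h3
    rw [ha, ha] at h1
    rw [h2, h3, ← neg_sub', ← map_sub, h1, hb]
  have hNself : ∀ x ∈ U, N x x = x := fun x hx => by
    have : N x (M x x) = x := congrArg (fun L : 𝔤 →L[ℝ] 𝔤 => L x) (hNM x hx)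
    rwa [hself x hx] at this
  -- Differentiate `N(y) y = y`.
  have hNself' : ∀ x ∈ U, ∀ v, fderiv ℝ N x v x + N x v = v := fun x hx =>
    fderiv_apply_of_eventually_apply_self (hNd x hx)
      (by filter_upwards [U.isOpen.mem_nhds hx] with y hy using hNself y hy)
  have hsm : ∀ x ∈ U, ∀ t ∈ Icc (0 : ℝ) 1, t • x ∈ U := fun x hx t ht =>
    hU.smul_mem hx ht.1 ht.2
  have hray : ∀ x ∈ U, ∀ t ∈ Icc (0 : ℝ) 1, N (t • x) x = x := fun x hx t ht => by
    rcases eq_or_ne t 0 with rfl | hne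
    · rw [zero_smul]
      have := hNself' 0 h0 x
      rwa [map_zero, zero_add] at this
    · have := hNself _ (hsm x hx t ht)
      rw [map_smul] at this
      exact smul_right_injective _ hne this
  have main : ∀ x ∈ U, N x = leftDexp x := by
    intro x hx
    ext v
    have hB : ∀ t ∈ Icc (0 : ℝ) 1, HasDerivAt (fun s : ℝ => s • N (s • x) v)
        (v - adL x (t • N (t • x) v)) t := fun t ht => by
      have hx' := hsm x hx t ht
      refine (hasDerivAt_smul_ray (hNd _ hx') v).congr_deriv ?_
      have e1 := hmc _ hx' x v
      rw [hray x hx t ht] at e1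
      have e2 := hNself' _ hx' v
      have e3 : t • fderiv ℝ N (t • x) x v = fderiv ℝ N (t • x) v (t • x) - ⁅x, t • N (t • x) v⁆ := by
        rw [sub_eq_iff_eq_add] at e1
        rw [e1, smul_add, smul_neg, map_smul, lie_smul]
        abel
      rw [e3, adL_apply, eq_sub_iff_add_eq.2 e2]
      abel
    have hC : ∀ t ∈ Icc (0 : ℝ) 1, HasDerivAt (fun s : ℝ => s • oneSubExp (s • adL x) v)
        (v - adL x (t • oneSubExp (t • adL x) v)) t := fun t _ =>
      hasDerivAt_smul_oneSubExp_apply x v t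
    have := eq_of_hasDerivAt_sub (adL x) hB hC (by simp) 1 (right_mem_Icc.2 zero_le_one)
    simpa [leftDexp] using this
  refine ⟨main, fun x hx a b => ?_⟩
  have e : N =ᶠ[𝓝 x] leftDexp := by
    filter_upwards [U.isOpen.mem_nhds hx] with y hy using main y hy
  rw [← e.fderiv_eq, ← main x hx]
  exact hmc x hx a b

end LogCoordinates

/-! ### The Campbell-Hausdorff function of a local group in logarithmic coordinates -/

section LocalGroupLaw

variable {𝔤 : Type*} [NormedLieRing 𝔤] [NormedLieAlgebra 𝔤] [FiniteDimensional ℝ 𝔤]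

attribute [local instance] completeSpace_lie

/-- The properties of `Φ(x, y) = log(exp(x) exp(y))` that determine its differential: it is a smooth
map `O² → U` with the two unit laws, left translation is compatible with the left trivialization
`leftDexp` of the tangent bundle of `U`, and that trivialization satisfies the Maurer-Cartan
equation. -/
structure IsLocalGroupLaw (U O : Opens 𝔤) (Φ : 𝔤 × 𝔤 → 𝔤) : Prop where
  zero_mem : (0 : 𝔤) ∈ O
  subset : O ≤ U
  starConvex_U : StarConvex ℝ (0 : 𝔤) (U : Set 𝔤)
  starConvex_O : StarConvex ℝ (0 : 𝔤) (O : Set 𝔤)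
  smooth : ContDiffOn ℝ ∞ Φ (sq O : Set (𝔤 × 𝔤))
  mem : ∀ x ∈ O, ∀ y ∈ O, Φ (x, y) ∈ U
  right_zero : ∀ x ∈ O, Φ (x, 0) = x
  left_zero : ∀ x ∈ O, Φ (0, x) = x
  left_translation : ∀ x ∈ O, ∀ y ∈ O, ∀ w,
    leftDexp (Φ (x, y)) (fderiv ℝ Φ (x, y) (0, w)) = leftDexp y w
  maurerCartan : ∀ x ∈ U, ∀ a b,
    fderiv ℝ leftDexp x a b - fderiv ℝ leftDexp x b a = -⁅leftDexp x a, leftDexp x b⁆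
  isUnit : ∀ x ∈ U, IsUnit (leftDexp x)

namespace IsLocalGroupLaw

variable {U O : Opens 𝔤} {Φ : 𝔤 × 𝔤 → 𝔤} (h : IsLocalGroupLaw U O Φ)
include h

theorem smul_mem {x : 𝔤} (hx : x ∈ O) {t : ℝ} (ht : t ∈ Icc (0 : ℝ) 1) : t • x ∈ O :=
  h.starConvex_O.smul_mem hx ht.1 ht.2

theorem contDiffAt {x y : 𝔤} (hx : x ∈ O) (hy : y ∈ O) : ContDiffAt ℝ ∞ Φ (x, y) :=
  h.smooth.contDiffAt ((sq O).isOpen.mem_nhds ⟨hx, hy⟩)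

theorem hasFDerivAt {x y : 𝔤} (hx : x ∈ O) (hy : y ∈ O) :
    HasFDerivAt Φ (fderiv ℝ Φ (x, y)) (x, y) :=
  ((h.contDiffAt hx hy).differentiableAt (by simp)).hasFDerivAt

theorem hasDerivAt_right {x y : 𝔤} {t : ℝ} (hx : x ∈ O) (hy : t • y ∈ O) :
    HasDerivAt (fun s : ℝ => Φ (x, s • y)) (fderiv ℝ Φ (x, t • y) (0, y)) t := by
  have d1 : HasDerivAt (fun s : ℝ => (x, s • y)) (0, y) t := by
    have d2 : HasDerivAt (fun s : ℝ => s • y) y t := by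
      simpa using (hasDerivAt_id t).smul_const y
    exact (hasDerivAt_const t x).prodMk d2
  exact (h.hasFDerivAt hx hy).comp_hasDerivAt t d1

theorem hasDerivAt_left {x y : 𝔤} {t : ℝ} (hy : t • y ∈ O) (hx : x ∈ O) :
    HasDerivAt (fun s : ℝ => Φ (s • y, x)) (fderiv ℝ Φ (t • y, x) (y, 0)) t := by
  have d1 : HasDerivAt (fun s : ℝ => (s • y, x)) (y, 0) t := by
    have d2 : HasDerivAt (fun s : ℝ => s • y) y t := by
      simpa using (hasDerivAt_id t).smul_const y
    exact d2.prodMk (hasDerivAt_const t x)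
  exact (h.hasFDerivAt hy hx).comp_hasDerivAt t d1

theorem left_translation_ray {x y : 𝔤} {t : ℝ} (hx : x ∈ O) (hy : t • y ∈ O) :
    leftDexp (Φ (x, t • y)) (fderiv ℝ Φ (x, t • y) (0, y)) = y := by
  rw [h.left_translation x hx _ hy, leftDexp_smul_self]

end IsLocalGroupLaw

end LocalGroupLaw

section SecondDerivative

variable {V W : Type*} [NormedAddCommGroup V] [NormedSpace ℝ V] [NormedAddCommGroup W]
  [NormedSpace ℝ W]

/-- The antisymmetric part of the derivative of a pulled back one-form: for `θ : W → End W` and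
`Φ : V → W`, if `θ(Φ) Φ'(b)` is constant in the direction `a`, then the derivative of `θ(Φ) Φ'(a)`
in the direction `b` is the exterior derivative `dθ(Φ'(b), Φ'(a))`. -/
theorem fderiv_pullback_form {θ : W → W →L[ℝ] W} {Φ : V → W} {p a b : V} {c : W}
    (hθ : DifferentiableAt ℝ θ (Φ p)) (hΦ : ContDiffAt ℝ ∞ Φ p) {r : ℝ → V} {t : ℝ}
    (hr : HasDerivAt r b t) (hrt : r t = p)
    (hconst : ∀ᶠ s in 𝓝 (0 : ℝ), θ (Φ (p + s • a)) (fderiv ℝ Φ (p + s • a) b) = c) :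
    HasDerivAt (fun s => θ (Φ (r s)) (fderiv ℝ Φ (r s) a))
      (fderiv ℝ θ (Φ p) (fderiv ℝ Φ p b) (fderiv ℝ Φ p a) -
        fderiv ℝ θ (Φ p) (fderiv ℝ Φ p a) (fderiv ℝ Φ p b)) t := by
  have hΦ1 : HasFDerivAt Φ (fderiv ℝ Φ p) p := (hΦ.differentiableAt (by simp)).hasFDerivAt
  have hΦ2 : HasFDerivAt (fderiv ℝ Φ) (fderiv ℝ (fderiv ℝ Φ) p) p :=
    ((hΦ.fderiv_right (m := 1) (by norm_cast)).differentiableAt (by simp)).hasFDerivAt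
  have hsymm : IsSymmSndFDerivAt ℝ Φ p := hΦ.isSymmSndFDerivAt (by
    rw [minSmoothness_of_isRCLikeNormedField]; exact WithTop.coe_le_coe.2 le_top)
  -- The derivative of `θ(Φ) Φ'(v)` along a curve.
  have key : ∀ (v w : V) (q : ℝ → V) (τ : ℝ), HasDerivAt q w τ → q τ = p →
      HasDerivAt (fun s => θ (Φ (q s)) (fderiv ℝ Φ (q s) v))
        (fderiv ℝ θ (Φ p) (fderiv ℝ Φ p w) (fderiv ℝ Φ p v) +
          θ (Φ p) (fderiv ℝ (fderiv ℝ Φ) p w v)) τ := by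
    intro v w q τ hq hqτ
    subst hqτ
    have d1 : HasDerivAt (fun s => θ (Φ (q s))) (fderiv ℝ θ (Φ (q τ)) (fderiv ℝ Φ (q τ) w)) τ :=
      hθ.hasFDerivAt.comp_hasDerivAt τ (hΦ1.comp_hasDerivAt τ hq)
    have d2 : HasDerivAt (fun s => fderiv ℝ Φ (q s) v) (fderiv ℝ (fderiv ℝ Φ) (q τ) w v) τ :=
      (ContinuousLinearMap.apply ℝ W v).hasFDerivAt.comp_hasDerivAt τ (hΦ2.comp_hasDerivAt τ hq)
    exact d1.clm_apply d2
  have h1 := key a b r t hr hrt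
  have h2 := key b a (fun s : ℝ => p + s • a) 0
    (by simpa using ((hasDerivAt_id (0 : ℝ)).smul_const a).const_add p) (by simp)
  have h3 := (h2.congr_of_eventuallyEq (hconst.mono fun s hs => hs.symm)).unique
    (hasDerivAt_const (0 : ℝ) c)
  refine h1.congr_deriv ?_
  rw [hsymm.eq b a, eq_neg_of_add_eq_zero_right h3, ← sub_eq_add_neg]

end SecondDerivative

section LocalGroupLaw

variable {𝔤 : Type*} [NormedLieRing 𝔤] [NormedLieAlgebra 𝔤] [FiniteDimensional ℝ 𝔤]

attribute [local instance] completeSpace_lie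

namespace IsLocalGroupLaw

variable {U O : Opens 𝔤} {Φ : 𝔤 × 𝔤 → 𝔤} (h : IsLocalGroupLaw U O Φ)
include h

/-- The differential of the Campbell-Hausdorff function in the first variable, by the Maurer-Cartan
equation along `t ↦ Φ(x, t y)`. -/
theorem right_translation {x y : 𝔤} (hx : x ∈ O) (hy : y ∈ O) (v : 𝔤) :
    leftDexp (Φ (x, y)) (fderiv ℝ Φ (x, y) (v, 0)) = exp (-adL y) (leftDexp x v) := by
  have hD : ∀ t ∈ Icc (0 : ℝ) 1, HasDerivAt
      (fun s : ℝ => leftDexp (Φ (x, s • y)) (fderiv ℝ Φ (x, s • y) (v, 0)))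
      (-(adL y (leftDexp (Φ (x, t • y)) (fderiv ℝ Φ (x, t • y) (v, 0))))) t := by
    intro t ht
    have hty := h.smul_mem hy ht
    have hconst : ∀ᶠ s in 𝓝 (0 : ℝ), leftDexp (Φ ((x, t • y) + s • ((v, 0) : 𝔤 × 𝔤)))
        (fderiv ℝ Φ ((x, t • y) + s • ((v, 0) : 𝔤 × 𝔤)) (0, y)) = y := by
      have hc : Tendsto (fun s : ℝ => x + s • v) (𝓝 0) (𝓝 x) := by
        have : Continuous fun s : ℝ => x + s • v := by fun_prop
        simpa using this.tendsto 0
      filter_upwards [hc.eventually (O.isOpen.mem_nhds hx)] with s hs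
      have := h.left_translation_ray hs hty
      simpa using this
    have d1 : HasDerivAt (fun s : ℝ => (x, s • y)) (0, y) t := by
      have d2 : HasDerivAt (fun s : ℝ => s • y) y t := by
        simpa using (hasDerivAt_id t).smul_const y
      exact (hasDerivAt_const t x).prodMk d2
    have := fderiv_pullback_form (θ := leftDexp) (hasFDerivAt_leftDexp _).differentiableAt
      (h.contDiffAt hx hty) d1 rfl hconst
    refine this.congr_deriv ?_
    rw [h.maurerCartan _ (h.mem x hx _ hty), h.left_translation_ray hx hty, adL_apply]
  have := eq_exp_neg_apply_of_hasDerivAt (adL y) hD 1 (right_mem_Icc.2 zero_le_one)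
  simp only [one_smul, zero_smul] at this
  rw [this, h.right_zero x hx]
  congr 2
  have d1 := h.hasFDerivAt hx h.zero_mem
  have d2 : HasFDerivAt (fun x' : 𝔤 => (x', (0 : 𝔤))) (ContinuousLinearMap.inl ℝ 𝔤 𝔤) x :=
    hasFDerivAt_prodMk_left x 0
  have d3 := d1.comp x d2
  have d4 : Φ ∘ (fun x' : 𝔤 => (x', (0 : 𝔤))) =ᶠ[𝓝 x] id := by
    filter_upwards [O.isOpen.mem_nhds hx] with x' hx' using h.right_zero x' hx'
  exact congrArg (fun L : 𝔤 →L[ℝ] 𝔤 => L v)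
    ((d3.congr_of_eventuallyEq d4.symm).unique (hasFDerivAt_id x))

/-- The differential of the Campbell-Hausdorff function. -/
theorem leftDexp_fderiv {x y : 𝔤} (hx : x ∈ O) (hy : y ∈ O) (v w : 𝔤) :
    leftDexp (Φ (x, y)) (fderiv ℝ Φ (x, y) (v, w)) =
      exp (-adL y) (leftDexp x v) + leftDexp y w := by
  rw [← h.right_translation hx hy, ← h.left_translation x hx y hy, ← map_add, ← map_add]
  simp

theorem exp_adL_ray {x y : 𝔤} (hx : x ∈ O) (hy : y ∈ O) {t : ℝ} (ht : t ∈ Icc (0 : ℝ) 1) :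
    exp (adL (Φ (x, t • y))) = exp (adL x) * exp (t • adL y) := by
  have hD : ∀ t ∈ Icc (0 : ℝ) 1, HasDerivAt
      (fun s : ℝ => exp (adL (Φ (x, s • y))) * exp (-(s • adL y))) 0 t := by
    intro t ht
    have hty := h.smul_mem hy ht
    have d1 : HasDerivAt (fun s : ℝ => exp (adL (Φ (x, s • y))))
        (exp (adL (Φ (x, t • y))) * adL y) t := by
      have d2 := ((contDiff_exp (𝔸 := 𝔤 →L[ℝ] 𝔤)).differentiable (by simp)
        (adL (Φ (x, t • y)))).hasFDerivAt.comp_hasDerivAt t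
        (hasDerivAt_adL (h.hasDerivAt_right hx hty))
      refine d2.congr_deriv ?_
      rw [fderiv_exp_adL]
      congr 2
      exact h.left_translation_ray hx hty
    refine (d1.mul (hasDerivAt_exp_neg_smul (adL y) t)).congr_deriv ?_
    rw [mul_neg, mul_assoc, add_neg_cancel]
  have := constant_of_has_deriv_right_zero (a := 0) (b := 1)
    (fun t ht => (hD t ht).continuousAt.continuousWithinAt)
    (fun t ht => (hD t (Ico_subset_Icc_self ht)).hasDerivWithinAt) t ht
  simp only [zero_smul, neg_zero, NormedSpace.exp_zero, mul_one, h.right_zero x hx] at this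
  rw [← this, mul_assoc, exp_neg_mul_exp, mul_one]

theorem exp_adL {x y : 𝔤} (hx : x ∈ O) (hy : y ∈ O) :
    exp (adL (Φ (x, y))) = exp (adL x) * exp (adL y) := by
  simpa using h.exp_adL_ray hx hy (right_mem_Icc.2 zero_le_one)

theorem exp_neg_adL {x y : 𝔤} (hx : x ∈ O) (hy : y ∈ O) :
    exp (-adL (Φ (x, y))) = exp (-adL y) * exp (-adL x) := by
  have e1 : exp (-adL y) * exp (-adL x) * exp (adL (Φ (x, y))) = 1 := by
    rw [h.exp_adL hx hy, mul_assoc, ← mul_assoc (exp (-adL x)), exp_neg_mul_exp, one_mul,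
      exp_neg_mul_exp]
  exact (left_inv_eq_right_inv e1 (exp_mul_exp_neg _)).symm

/-- Local uniqueness for the equation `leftDexp(w) ẇ = c` on `U`. -/
theorem eventuallyEq_of_leftDexp_eq {a b a' b' : ℝ → 𝔤} {c : 𝔤} {t : ℝ} (hat : a t ∈ U)
    (had : ∀ᶠ s in 𝓝 t, HasDerivAt a (a' s) s) (hbd : ∀ᶠ s in 𝓝 t, HasDerivAt b (b' s) s)
    (ha : ∀ᶠ s in 𝓝 t, leftDexp (a s) (a' s) = c) (hb : ∀ᶠ s in 𝓝 t, leftDexp (b s) (b' s) = c)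
    (hab : a t = b t) : a =ᶠ[𝓝 t] b := by
  set v : 𝔤 → 𝔤 := fun w => Ring.inverse (leftDexp w) c with hv
  have hvc : ContDiffAt ℝ 1 v (a t) := by
    obtain ⟨u, hu⟩ := h.isUnit _ hat
    have h1 : ContDiffAt ℝ 1 (Ring.inverse : (𝔤 →L[ℝ] 𝔤) → _) (leftDexp (a t)) := by
      rw [← hu]
      exact contDiffAt_ringInverse ℝ u
    exact (h1.comp (a t) (contDiff_leftDexp.contDiffAt.of_le (by simp))).clm_apply
      contDiffAt_const
  obtain ⟨K, s, hs, hK⟩ := hvc.exists_lipschitzOnWith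
  have hv' : ∀ w ∈ U, ∀ w', leftDexp w w' = c → w' = v w := fun w hw w' hw' => by
    rw [hv, ← hw']
    exact (congrArg (fun L : 𝔤 →L[ℝ] 𝔤 => L w') (Ring.inverse_mul_cancel _ (h.isUnit w hw))).symm
  have key : ∀ {d d' : ℝ → 𝔤}, d t = a t → (∀ᶠ s in 𝓝 t, HasDerivAt d (d' s) s) →
      (∀ᶠ s in 𝓝 t, leftDexp (d s) (d' s) = c) →
      ∀ᶠ r in 𝓝 t, HasDerivAt d (v (d r)) r ∧ d r ∈ s := by
    intro d d' hdt hd hd'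
    have hc : Tendsto d (𝓝 t) (𝓝 (a t)) := hdt ▸ hd.self_of_nhds.continuousAt
    filter_upwards [hd, hd', hc.eventually hs, hc.eventually (U.isOpen.mem_nhds hat)] with
      r h1 h2 h3 h4
    exact ⟨hv' _ h4 _ h2 ▸ h1, h3⟩
  exact ODE_solution_unique_of_eventually (v := fun _ => v) (s := fun _ => s)
    (Eventually.of_forall fun _ => hK) (key rfl had ha) (key hab.symm hbd hb) hab

/-- `log(exp(y) exp(x)) = e^{ad y} log(exp(x) exp(y))`. Both `t ↦ Φ(ty, x)` and
`t ↦ e^{t ad y} Φ(x, ty)` start at `x` and solve the equation `leftDexp(w) ẇ = e^{-ad x} y`, which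
has unique solutions as long as they stay in `U`; the first one does. -/
theorem swap {x y : 𝔤} (hx : x ∈ O) (hy : y ∈ O) : Φ (y, x) = exp (adL y) (Φ (x, y)) := by
  set a : ℝ → 𝔤 := fun t => Φ (t • y, x) with ha
  set b : ℝ → 𝔤 := fun t => exp (t • adL y) (Φ (x, t • y)) with hb
  set a' : ℝ → 𝔤 := fun t => fderiv ℝ Φ (t • y, x) (y, 0) with ha'
  set b' : ℝ → 𝔤 := fun t =>
    ⁅y, b t⁆ + exp (t • adL y) (fderiv ℝ Φ (x, t • y) (0, y)) with hb'
  have had : ∀ t : ℝ, t • y ∈ O → HasDerivAt a (a' t) t := fun t ht => h.hasDerivAt_left ht hx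
  have hbd : ∀ t : ℝ, t • y ∈ O → HasDerivAt b (b' t) t := fun t ht =>
    (hasDerivAt_exp_smul_const' (𝕂 := ℝ) (adL y) t).clm_apply (h.hasDerivAt_right hx ht)
  have haeq : ∀ t : ℝ, t • y ∈ O → leftDexp (a t) (a' t) = exp (-adL x) y := fun t ht => by
    rw [ha, ha']
    simp only
    rw [h.right_translation ht hx, leftDexp_smul_self]
  have hbeq : ∀ t : ℝ, t • y ∈ O → leftDexp (b t) (b' t) = exp (-adL x) y := fun t ht => by
    have hP : exp (adL (t • y)) y = y := exp_apply_of_apply_eq_zero (by simp [adL_apply])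
    have hP' : exp (-adL (t • y)) (exp (-adL x) y) = exp (-adL (Φ (x, t • y))) y := by
      rw [h.exp_neg_adL hx ht]; rfl
    have hbt : b t = exp (adL (t • y)) (Φ (x, t • y)) := by rw [hb, adL_smul]
    have hint : exp (adL (t • y)) * adL (Φ (x, t • y)) = adL (b t) * exp (adL (t • y)) := by
      rw [hbt, adL_exp_apply_mul]
    have h1 : leftDexp (b t) (exp (adL (t • y)) (fderiv ℝ Φ (x, t • y) (0, y))) = y := by
      have := congrArg (fun L : 𝔤 →L[ℝ] 𝔤 => L (fderiv ℝ Φ (x, t • y) (0, y)))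
        (oneSubExp_intertwine hint)
      refine this.symm.trans ?_
      change exp (adL (t • y)) (leftDexp _ _) = y
      rw [h.left_translation_ray hx ht, hP]
    have h2 : exp (-adL (b t)) y = exp (-adL x) y := by
      have e := congrArg (fun L : 𝔤 →L[ℝ] 𝔤 => L y)
        (exp_intertwine (P := exp (adL (t • y))) (a := -adL (Φ (x, t • y))) (b := -adL (b t))
          (by rw [mul_neg, neg_mul, hint]))
      change exp (adL (t • y)) (exp (-adL (Φ (x, t • y))) y) =
        exp (-adL (b t)) (exp (adL (t • y)) y) at e
      rw [hP] at e
      rw [← e, ← hP']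
      exact congrArg (fun L : 𝔤 →L[ℝ] 𝔤 => L (exp (-adL x) y)) (exp_mul_exp_neg _)
    have h3 : leftDexp (b t) ⁅y, b t⁆ = exp (-adL (b t)) y - y := by
      have e := congrArg (fun L : 𝔤 →L[ℝ] 𝔤 => L y) (oneSubExp_mul (adL (b t)))
      change leftDexp (b t) ⁅b t, y⁆ = y - exp (-adL (b t)) y at e
      rw [← lie_skew, map_neg, e, neg_sub]
    rw [hb']
    simp only
    rw [map_add, h3, ← adL_smul, h1, h2, sub_add_cancel]
  have hopen : IsOpen {t : ℝ | t • y ∈ O} :=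
    O.isOpen.preimage (continuous_id.smul continuous_const)
  have hseg : ∀ t ∈ Icc (0 : ℝ) 1, t • y ∈ O := fun t ht => h.smul_mem hy ht
  have hcl : IsClosed ({t | a t = b t} ∩ Icc (0 : ℝ) 1) := by
    have hca : ContinuousOn a (Icc 0 1) := fun t ht =>
      (had t (hseg t ht)).continuousAt.continuousWithinAt
    have hcb : ContinuousOn b (Icc 0 1) := fun t ht =>
      (hbd t (hseg t ht)).continuousAt.continuousWithinAt
    rw [inter_comm]
    exact isClosed_Icc.isClosed_eq hca hcb
  have := hcl.Icc_subset_of_forall_mem_nhdsWithin (a := 0) (b := 1) (s := {t | a t = b t})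
    (by simp [ha, hb, h.left_zero x hx, h.right_zero x hx]) (fun t ht => by
      have ht' := hseg t (Ico_subset_Icc_self ht.2)
      have hev : ∀ᶠ s in 𝓝 t, s • y ∈ O := hopen.mem_nhds ht'
      exact mem_nhdsWithin_of_mem_nhds (h.eventuallyEq_of_leftDexp_eq (h.mem _ ht' x hx)
        (hev.mono had) (hev.mono hbd) (hev.mono haeq) (hev.mono hbeq) ht.1))
    (right_mem_Icc.2 zero_le_one)
  simpa [ha, hb] using this

end IsLocalGroupLaw

end LocalGroupLaw

/-! ### The exponential map of a Lie group -/

section GroupExp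

variable {E : Type*} [NormedAddCommGroup E] [NormedSpace ℝ E]
  {G : Type*} [TopologicalSpace G] [ChartedSpace E G] [Group G] [LieGroup 𝓘(ℝ, E) ∞ G]

/-- A Lie group is Hausdorff, being a topological group whose points are closed. -/
theorem t2Space_of_lieGroup (E G : Type*) [NormedAddCommGroup E] [NormedSpace ℝ E]
    [TopologicalSpace G] [ChartedSpace E G] [Group G] [LieGroup 𝓘(ℝ, E) ∞ G] : T2Space G := by
  have : IsTopologicalGroup G := topologicalGroup_of_lieGroup 𝓘(ℝ, E) ∞
  have : T1Space G := ChartedSpace.t1Space E G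
  infer_instance

theorem mdifferentiable_mul_left (g : G) : MDifferentiable 𝓘(ℝ, E) 𝓘(ℝ, E) (g * ·) :=
  (contMDiff_mul_left (I := 𝓘(ℝ, E)) (n := ∞)).mdifferentiable (by simp)

theorem mfderiv_mul_left_mulInvariantVectorField (v : GroupLieAlgebra 𝓘(ℝ, E) G) (g h : G) :
    mfderiv 𝓘(ℝ, E) 𝓘(ℝ, E) (g * ·) h (mulInvariantVectorField v h) =
      mulInvariantVectorField v (g * h) := by
  have e : (fun x => g * h * x) = (g * ·) ∘ (h * ·) := by
    ext x; simp [mul_assoc]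
  have e2 := mfderiv_comp (I := 𝓘(ℝ, E)) (I' := 𝓘(ℝ, E)) (I'' := 𝓘(ℝ, E)) (1 : G)
    (g := (g * ·)) (f := (h * ·)) (mdifferentiable_mul_left g _) (mdifferentiable_mul_left h _)
  rw [← e] at e2
  have e3 : ∀ k, k = h → (mfderiv 𝓘(ℝ, E) 𝓘(ℝ, E) (g * ·) k : E →L[ℝ] E) =
      mfderiv 𝓘(ℝ, E) 𝓘(ℝ, E) (g * ·) h := by
    rintro _ rfl; rfl
  refine Eq.trans ?_ (congrArg (fun L : E →L[ℝ] E => L v) e2).symm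
  exact (congrArg (fun L : E →L[ℝ] E => L (mulInvariantVectorField v h)) (e3 _ (mul_one h))).symm

theorem contMDiff_one_mulInvariantVectorField (v : GroupLieAlgebra 𝓘(ℝ, E) G) :
    ContMDiff 𝓘(ℝ, E) 𝓘(ℝ, E).tangent 1
      (fun g : G => (⟨g, mulInvariantVectorField v g⟩ : TangentBundle 𝓘(ℝ, E) G)) :=
  (contMDiff_mulInvariantVectorField v).of_le (by
    rw [minSmoothness_of_isRCLikeNormedField]; norm_num)

/-- Left translates of integral curves of left-invariant fields are integral curves. -/
theorem isMIntegralCurveOn_mul_left {v : GroupLieAlgebra 𝓘(ℝ, E) G} {γ : ℝ → G} {s : Set ℝ}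
    (h : IsMIntegralCurveOn (I := 𝓘(ℝ, E)) γ (mulInvariantVectorField v) s) (g : G) :
    IsMIntegralCurveOn (I := 𝓘(ℝ, E)) (fun t => g * γ t) (mulInvariantVectorField v) s := by
  intro t ht
  have h1 := (mdifferentiable_mul_left (E := E) g (γ t)).hasMFDerivAt.comp_hasMFDerivWithinAt t
    (h t ht)
  refine h1.congr_mfderiv ?_
  rw [← mfderiv_mul_left_mulInvariantVectorField]
  ext
  exact (mfderiv 𝓘(ℝ, E) 𝓘(ℝ, E) (g * ·) (γ t) : E →L[ℝ] E).map_smul _ _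

variable [CompleteSpace E]

/-- Left-invariant vector fields are complete: by left translation the integral curves through all
points are defined on a common interval. -/
theorem exists_isMIntegralCurve_mulInvariantVectorField (v : GroupLieAlgebra 𝓘(ℝ, E) G) :
    ∃ γ : ℝ → G, γ 0 = 1 ∧ IsMIntegralCurve (I := 𝓘(ℝ, E)) γ (mulInvariantVectorField v) := by
  have : T2Space G := t2Space_of_lieGroup E G
  have hv := contMDiff_one_mulInvariantVectorField v
  obtain ⟨γ, h0, hγ⟩ := exists_isMIntegralCurveAt_of_contMDiffAt_boundaryless 0
    (hv.contMDiffAt (x := 1))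
  obtain ⟨ε, hε, hγ⟩ := isMIntegralCurveAt_iff'.1 hγ
  rw [Real.ball_eq_Ioo, zero_sub, zero_add] at hγ
  exact exists_isMIntegralCurve_of_isMIntegralCurveOn hv hε
    (fun x => ⟨fun t => x * γ t, by simp [h0], isMIntegralCurveOn_mul_left hγ x⟩) 1

variable {𝔤 : Type*} [NormedLieRing 𝔤] [NormedLieAlgebra 𝔤]
  (φ : 𝔤 ≃ₗ⁅ℝ⁆ GroupLieAlgebra 𝓘(ℝ, E) G)

/-- The rays `t ↦ exp(t x)` are the integral curves of the left-invariant vector fields. -/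
theorem isMIntegralCurve_lieExp (x : 𝔤) :
    IsMIntegralCurve (I := 𝓘(ℝ, E)) (fun t : ℝ => lieExp φ (t • x))
      (mulInvariantVectorField (φ x)) ∧ lieExp φ (0 : 𝔤) = 1 := by
  have : T2Space G := t2Space_of_lieGroup E G
  have key : ∀ (y : 𝔤) (γ : ℝ → G), γ 0 = 1 →
      IsMIntegralCurve (I := 𝓘(ℝ, E)) γ (mulInvariantVectorField (φ y)) → lieExp φ y = γ 1 := by
    intro y γ h0 hγ
    have hex := exists_isMIntegralCurve_mulInvariantVectorField (φ y)
    rw [lieExp, dif_pos hex]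
    rw [isMIntegralCurve_Ioo_eq_of_contMDiff_boundaryless (t₀ := 0)
      (contMDiff_one_mulInvariantVectorField (φ y)) hγ hex.choose_spec.2
      (by rw [h0, hex.choose_spec.1])]
  obtain ⟨γ, h0, hγ⟩ := exists_isMIntegralCurve_mulInvariantVectorField (φ x)
  have hray : ∀ t : ℝ, lieExp φ (t • x) = γ t := fun t => by
    have := key (t • x) (γ ∘ (· * t)) (by simp [h0]) (by
      have := hγ.comp_mul t
      rwa [← mulInvariantVectorField_smul, ← LieEquiv.coe_toLinearEquiv, ← map_smul] at this)
    simpa using this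
  refine ⟨?_, ?_⟩
  · rw [funext hray]; exact hγ
  · simpa [h0] using hray 0

end GroupExp

/-! ### The exponential map in the left trivialization -/

section LogChart

variable {E : Type*} [NormedAddCommGroup E] [NormedSpace ℝ E] [CompleteSpace E]
  {G : Type*} [TopologicalSpace G] [ChartedSpace E G] [Group G] [LieGroup 𝓘(ℝ, E) ∞ G]
  {𝔤 : Type*} [NormedLieRing 𝔤] [NormedLieAlgebra 𝔤] [FiniteDimensional ℝ 𝔤]
  {φ : 𝔤 ≃ₗ⁅ℝ⁆ GroupLieAlgebra 𝓘(ℝ, E) G} {U O : Opens 𝔤}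

attribute [local instance] completeSpace_lie

omit [FiniteDimensional ℝ 𝔤] in
theorem mulInvariantVectorField_injective (φ : 𝔤 ≃ₗ⁅ℝ⁆ GroupLieAlgebra 𝓘(ℝ, E) G) (g : G) {v w : 𝔤}
    (h : mulInvariantVectorField (φ v) g = mulInvariantVectorField (φ w) g) : v = w := by
  have key : ∀ u : GroupLieAlgebra 𝓘(ℝ, E) G,
      (mfderiv 𝓘(ℝ, E) 𝓘(ℝ, E) (g⁻¹ * ·) g : E →L[ℝ] E) (mulInvariantVectorField u g) = u := by
    intro u
    refine (mfderiv_mul_left_mulInvariantVectorField u g⁻¹ g).trans ?_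
    have e1 : ∀ k : G, k = 1 → (mulInvariantVectorField u k : E) = u := by
      rintro _ rfl
      have : (fun x : G => 1 * x) = id := by ext; simp
      rw [mulInvariantVectorField, this, mfderiv_id]
      rfl
    exact e1 _ (inv_mul_cancel g)
  have h1 := key (φ v)
  rw [h] at h1
  exact φ.injective (h1.symm.trans (key (φ w)))

/-- The pull-back under the exponential map of the left-invariant frame of the group. -/
noncomputable def leftFrame (φ : 𝔤 ≃ₗ⁅ℝ⁆ GroupLieAlgebra 𝓘(ℝ, E) G) (x : 𝔤) : 𝔤 →L[ℝ] 𝔤 :=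
  LinearMap.toContinuousLinearMap
    { toFun := fun v => VectorField.mpullback 𝓘(ℝ, 𝔤) 𝓘(ℝ, E) (lieExp φ)
        (mulInvariantVectorField (φ v)) x
      map_add' := fun v w => by
        rw [map_add, mulInvariantVectorField_add, VectorField.mpullback_add_apply]
        rfl
      map_smul' := fun c v => by
        rw [map_smul, mulInvariantVectorField_smul, VectorField.mpullback_const_smul_apply]
        rfl }

theorem leftFrame_apply (φ : 𝔤 ≃ₗ⁅ℝ⁆ GroupLieAlgebra 𝓘(ℝ, E) G) (x v : 𝔤) : leftFrame φ x v =
    VectorField.mpullback 𝓘(ℝ, 𝔤) 𝓘(ℝ, E) (lieExp φ) (mulInvariantVectorField (φ v)) x := rfl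

namespace Admissible

variable (h : Admissible φ U O)
include h

omit [FiniteDimensional ℝ 𝔤] in
theorem isInvertible_mfderiv {x : 𝔤} (hx : x ∈ U) :
    (mfderiv 𝓘(ℝ, 𝔤) 𝓘(ℝ, E) (lieExp φ) x).IsInvertible :=
  ⟨(h.localDiffeo ⟨x, hx⟩).mfderivToContinuousLinearEquiv (by simp), rfl⟩

omit [FiniteDimensional ℝ 𝔤] in
theorem contMDiffAt {x : 𝔤} (hx : x ∈ U) : ContMDiffAt 𝓘(ℝ, 𝔤) 𝓘(ℝ, E) ∞ (lieExp φ) x :=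
  IsLocalDiffeomorphAt.contMDiffAt (h.localDiffeo ⟨x, hx⟩)

theorem mfderiv_leftFrame {x : 𝔤} (hx : x ∈ U) (v : 𝔤) :
    mfderiv 𝓘(ℝ, 𝔤) 𝓘(ℝ, E) (lieExp φ) x (leftFrame φ x v) =
      mulInvariantVectorField (φ v) (lieExp φ x) :=
  (h.isInvertible_mfderiv hx).self_apply_inverse _

theorem isUnit_leftFrame {x : 𝔤} (hx : x ∈ U) : IsUnit (leftFrame φ x) := by
  have hinj : Function.Injective (leftFrame φ x) := fun v w hvw => by
    refine mulInvariantVectorField_injective φ (lieExp φ x) ?_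
    rw [← h.mfderiv_leftFrame hx, ← h.mfderiv_leftFrame hx, hvw]
  have hinj' : Function.Injective (leftFrame φ x : 𝔤 →ₗ[ℝ] 𝔤) := hinj
  refine ⟨(LinearEquiv.ofInjectiveEndo _ hinj').toContinuousLinearEquiv.toUnit, ?_⟩
  ext v
  rfl

theorem contDiffAt_leftFrame {x : 𝔤} (hx : x ∈ U) (v : 𝔤) :
    ContDiffAt ℝ 1 (fun y => leftFrame φ y v) x := by
  have h1 := ContMDiffAt.mpullback_vectorField_preimage (m := 1) (n := ∞)
    (contMDiff_one_mulInvariantVectorField (φ v)).contMDiffAt (h.contMDiffAt hx)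
    (h.isInvertible_mfderiv hx) (by norm_num; exact WithTop.coe_le_coe.2 le_top)
  exact contMDiffAt_vectorSpace_iff_contDiffAt.1 h1

theorem differentiableAt_leftFrame {x : 𝔤} (hx : x ∈ U) : DifferentiableAt ℝ (leftFrame φ) x := by
  have : ContDiffOn ℝ 1 (leftFrame φ) (U : Set 𝔤) :=
    contDiffOn_clm_apply.2 fun v y hy => (h.contDiffAt_leftFrame hy v).contDiffWithinAt
  exact (this.differentiableOn (by simp) x hx).differentiableAt (U.isOpen.mem_nhds hx)

theorem leftFrame_bracket {x : 𝔤} (hx : x ∈ U) (v w : 𝔤) :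
    fderiv ℝ (leftFrame φ) x (leftFrame φ x v) w - fderiv ℝ (leftFrame φ) x (leftFrame φ x w) v =
      leftFrame φ x ⁅v, w⁆ := by
  have h1 : leftFrame φ x ⁅v, w⁆ = VectorField.lieBracket ℝ (fun y => leftFrame φ y v)
      (fun y => leftFrame φ y w) x := by
    rw [leftFrame_apply, LieEquiv.map_lie, GroupLieAlgebra.bracket_def,
      mulInvariantVector_mlieBracket,
      VectorField.mpullback_mlieBracket (n := ∞) (mdifferentiableAt_mulInvariantVectorField _)
        (mdifferentiableAt_mulInvariantVectorField _) (h.contMDiffAt hx)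
        (by rw [minSmoothness_of_isRCLikeNormedField]; norm_cast),
      ← VectorField.mlieBracketWithin_univ, VectorField.mlieBracketWithin_eq_lieBracketWithin]
    exact congrFun VectorField.lieBracketWithin_univ x
  have h2 : ∀ u, fderiv ℝ (fun y => leftFrame φ y u) x = (fderiv ℝ (leftFrame φ) x).flip u :=
    fun u => by
      rw [fderiv_clm_apply (h.differentiableAt_leftFrame hx) (differentiableAt_const u)]
      simp
  rw [h1, VectorField.lieBracket, h2, h2]
  rfl

theorem mfderiv_lieExp_self {x : 𝔤} (hx : x ∈ U) :
    mfderiv 𝓘(ℝ, 𝔤) 𝓘(ℝ, E) (lieExp φ) x x = mulInvariantVectorField (φ x) (lieExp φ x) := by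
  have h1 := (isMIntegralCurve_lieExp φ x).1 1
  have h2 : HasMFDerivAt 𝓘(ℝ, ℝ) 𝓘(ℝ, 𝔤) (fun t : ℝ => t • x) 1
      (ContinuousLinearMap.smulRight (1 : ℝ →L[ℝ] ℝ) x) :=
    HasFDerivAt.hasMFDerivAt (by simpa using! ((hasDerivAt_id (1 : ℝ)).smul_const x).hasFDerivAt)
  have hx' : (fun t : ℝ => t • x) 1 = x := one_smul _ _
  have h3 : HasMFDerivAt 𝓘(ℝ, 𝔤) 𝓘(ℝ, E) (lieExp φ) ((fun t : ℝ => t • x) 1)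
      (mfderiv 𝓘(ℝ, 𝔤) 𝓘(ℝ, E) (lieExp φ) ((fun t : ℝ => t • x) 1)) := by
    rw [hx']
    exact ((h.contMDiffAt hx).mdifferentiableAt (by simp)).hasMFDerivAt
  have h4 := hasMFDerivAt_unique (h3.comp 1 h2) h1
  have h5 := congrArg (fun L : ℝ →L[ℝ] E => L 1) h4
  have e : ∀ y : 𝔤, y = x →
      (mfderiv 𝓘(ℝ, 𝔤) 𝓘(ℝ, E) (lieExp φ) y : 𝔤 →L[ℝ] E) ((1 : ℝ) • x) =
        (1 : ℝ) • (mulInvariantVectorField (φ x) (lieExp φ y) : E) →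
      (mfderiv 𝓘(ℝ, 𝔤) 𝓘(ℝ, E) (lieExp φ) x : 𝔤 →L[ℝ] E) x =
        (mulInvariantVectorField (φ x) (lieExp φ x) : E) := by
    rintro _ rfl h
    rwa [one_smul, one_smul] at h
  exact e _ hx' h5

theorem leftFrame_self {x : 𝔤} (hx : x ∈ U) : leftFrame φ x x = x := by
  obtain ⟨L, hL⟩ := h.isInvertible_mfderiv hx
  refine L.injective ?_
  have e1 := h.mfderiv_leftFrame hx x
  rw [← h.mfderiv_lieExp_self hx, ← hL] at e1
  exact e1

omit [FiniteDimensional ℝ 𝔤] in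
theorem zero_mem_U : (0 : 𝔤) ∈ U := h.subset h.zero_mem

theorem inverse_leftFrame : (∀ x ∈ U, Ring.inverse (leftFrame φ x) = leftDexp x) ∧ ∀ x ∈ U, ∀ a b,
    fderiv ℝ leftDexp x a b - fderiv ℝ leftDexp x b a = -⁅leftDexp x a, leftDexp x b⁆ :=
  frame_inverse_eq h.starConvex_U h.zero_mem_U (fun _ hx => h.differentiableAt_leftFrame hx)
    (fun _ hx => h.isUnit_leftFrame hx) (fun _ hx => h.leftFrame_bracket hx)
    fun _ hx => h.leftFrame_self hx

/-- The differential of the exponential map. -/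
theorem mfderiv_lieExp {x : 𝔤} (hx : x ∈ U) (v : 𝔤) :
    mfderiv 𝓘(ℝ, 𝔤) 𝓘(ℝ, E) (lieExp φ) x v =
      mulInvariantVectorField (φ (leftDexp x v)) (lieExp φ x) := by
  rw [← h.mfderiv_leftFrame hx, ← h.inverse_leftFrame.1 x hx]
  have : leftFrame φ x (Ring.inverse (leftFrame φ x) v) = v :=
    congrArg (fun L : 𝔤 →L[ℝ] 𝔤 => L v) (Ring.mul_inverse_cancel _ (h.isUnit_leftFrame hx))
  rw [this]

omit [FiniteDimensional ℝ 𝔤] in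
theorem lieLog_lieExp {x : 𝔤} (hx : x ∈ U) : lieLog φ U (lieExp φ x) = x :=
  h.injOn.leftInvOn_invFunOn hx

theorem contMDiffAt_lieLog {x : 𝔤} (hx : x ∈ U) :
    ContMDiffAt 𝓘(ℝ, E) 𝓘(ℝ, 𝔤) ∞ (lieLog φ U) (lieExp φ x) := by
  have hl : IsLocalDiffeomorphAt 𝓘(ℝ, 𝔤) 𝓘(ℝ, E) ∞ (lieExp φ) x := h.localDiffeo ⟨x, hx⟩
  have hx' : hl.localInverse (lieExp φ x) = x :=
    hl.localInverse_left_inv hl.localInverse_mem_target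
  refine hl.localInverse_contMDiffAt.congr_of_eventuallyEq ?_
  have hU : ∀ᶠ g in 𝓝 (lieExp φ x), hl.localInverse g ∈ U :=
    hl.localInverse_contMDiffAt.continuousAt.eventually (U.isOpen.mem_nhds (by rwa [hx']))
  filter_upwards [hU, hl.localInverse_eventuallyEq_right] with g hg hg'
  have := h.lieLog_lieExp hg
  rwa [show lieExp φ (hl.localInverse g) = g from hg'] at this

theorem bch_mem {x y : 𝔤} (hx : x ∈ O) (hy : y ∈ O) :
    bch φ U (x, y) ∈ U ∧ lieExp φ (bch φ U (x, y)) = lieExp φ x * lieExp φ y := by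
  obtain ⟨z, hz, hz'⟩ := h.mul_mem x hx y hy
  have : bch φ U (x, y) = z := by rw [bch, ← hz', h.lieLog_lieExp hz]
  rw [this]
  exact ⟨hz, hz'⟩

theorem contDiffOn_bch : ContDiffOn ℝ ∞ (bch φ U) (sq O : Set (𝔤 × 𝔤)) := by
  rintro ⟨x, y⟩ ⟨hx, hy⟩
  refine ContDiffAt.contDiffWithinAt (ContMDiffAt.contDiffAt ?_)
  have h1 : ContMDiffAt 𝓘(ℝ, 𝔤 × 𝔤) 𝓘(ℝ, E) ∞ (fun p : 𝔤 × 𝔤 => lieExp φ p.1) (x, y) :=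
    ContMDiffAt.comp (x, y) (h.contMDiffAt (h.subset hx)) contDiff_fst.contMDiff.contMDiffAt
  have h2 : ContMDiffAt 𝓘(ℝ, 𝔤 × 𝔤) 𝓘(ℝ, E) ∞ (fun p : 𝔤 × 𝔤 => lieExp φ p.2) (x, y) :=
    ContMDiffAt.comp (x, y) (h.contMDiffAt (h.subset hy)) contDiff_snd.contMDiff.contMDiffAt
  refine ContMDiffAt.comp (x, y) ?_ (h1.mul h2)
  have h3 := h.contMDiffAt_lieLog (h.bch_mem hx hy).1
  rwa [(h.bch_mem hx hy).2] at h3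

theorem bch_left_translation {x y : 𝔤} (hx : x ∈ O) (hy : y ∈ O) (w : 𝔤) :
    leftDexp (bch φ U (x, y)) (fderiv ℝ (bch φ U) (x, y) (0, w)) = leftDexp y w := by
  have hz := h.bch_mem hx hy
  refine mulInvariantVectorField_injective φ (lieExp φ x * lieExp φ y) ?_
  have h1 : HasMFDerivAt 𝓘(ℝ, 𝔤) 𝓘(ℝ, E) ((lieExp φ x * ·) ∘ lieExp φ) y _ :=
    (mdifferentiable_mul_left (E := E) (lieExp φ x) (lieExp φ y)).hasMFDerivAt.comp y
      ((h.contMDiffAt (h.subset hy)).mdifferentiableAt (by simp)).hasMFDerivAt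
  have d1 : HasFDerivAt (fun y' => bch φ U (x, y'))
      ((fderiv ℝ (bch φ U) (x, y)).comp (ContinuousLinearMap.inr ℝ 𝔤 𝔤)) y :=
    ((h.contDiffOn_bch.contDiffAt ((sq O).isOpen.mem_nhds ⟨hx, hy⟩)).differentiableAt
      (by simp)).hasFDerivAt.comp y (hasFDerivAt_prodMk_right x y)
  have h2 : HasMFDerivAt 𝓘(ℝ, 𝔤) 𝓘(ℝ, E) (lieExp φ ∘ fun y' => bch φ U (x, y')) y _ :=
    HasMFDerivAt.comp y ((h.contMDiffAt hz.1).mdifferentiableAt (by simp)).hasMFDerivAt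
      d1.hasMFDerivAt
  have he : ((lieExp φ x * ·) ∘ lieExp φ) =ᶠ[𝓝 y] (lieExp φ ∘ fun y' => bch φ U (x, y')) := by
    filter_upwards [O.isOpen.mem_nhds hy] with y' hy' using (h.bch_mem hx hy').2.symm
  have h3 := congrArg (fun L : 𝔤 →L[ℝ] E => L w)
    (hasMFDerivAt_unique (h2.congr_of_eventuallyEq he) h1)
  have e1 : (mfderiv 𝓘(ℝ, E) 𝓘(ℝ, E) (lieExp φ x * ·) (lieExp φ y) : E →L[ℝ] E)
      ((mfderiv 𝓘(ℝ, 𝔤) 𝓘(ℝ, E) (lieExp φ) y : 𝔤 →L[ℝ] E) w) =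
      (mulInvariantVectorField (φ (leftDexp y w)) (lieExp φ x * lieExp φ y) : E) := by
    rw [← mfderiv_mul_left_mulInvariantVectorField, ← h.mfderiv_lieExp (h.subset hy)]
  have e2 : (mfderiv 𝓘(ℝ, 𝔤) 𝓘(ℝ, E) (lieExp φ) (bch φ U (x, y)) : 𝔤 →L[ℝ] E)
      (fderiv ℝ (bch φ U) (x, y) (0, w)) =
      (mulInvariantVectorField (φ (leftDexp (bch φ U (x, y)) (fderiv ℝ (bch φ U) (x, y) (0, w))))
        (lieExp φ x * lieExp φ y) : E) := by
    rw [← hz.2]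
    exact h.mfderiv_lieExp hz.1 _
  exact (e2.symm.trans h3).trans e1

/-- Logarithmic coordinates on a Lie group define a local group law. -/
theorem isLocalGroupLaw : IsLocalGroupLaw U O (bch φ U) where
  zero_mem := h.zero_mem
  subset := h.subset
  starConvex_U := h.starConvex_U
  starConvex_O := h.starConvex_O
  smooth := h.contDiffOn_bch
  mem x hx y hy := (h.bch_mem hx hy).1
  right_zero x hx := by
    simp only [bch, (isMIntegralCurve_lieExp φ x).2, mul_one, h.lieLog_lieExp (h.subset hx)]
  left_zero x hx := by
    simp only [bch, (isMIntegralCurve_lieExp φ x).2, one_mul, h.lieLog_lieExp (h.subset hx)]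
  left_translation x hx y hy w := h.bch_left_translation hx hy w
  maurerCartan := h.inverse_leftFrame.2
  isUnit x hx := by
    rw [← h.inverse_leftFrame.1 x hx, Ring.inverse_of_isUnit (h.isUnit_leftFrame hx)]
    exact Units.isUnit _

end Admissible

end LogChart

/-! ### Rescaled families -/

section Rescaling

variable {𝔤 : Type*} [NormedLieRing 𝔤] [NormedLieAlgebra 𝔤] [FiniteDimensional ℝ 𝔤]
  {ι : Type*} [Fintype ι] (e : Module.Basis ι ℝ (𝔤 × 𝔤)) {O : Opens 𝔤}
  {F : Type*} [NormedAddCommGroup F] [NormedSpace ℝ F]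

omit [FiniteDimensional ℝ 𝔤] in
theorem smul_mem_sq (hO : StarConvex ℝ (0 : 𝔤) (O : Set 𝔤)) {t : ℝ} (ht : t ∈ Ioc (0 : ℝ) 1)
    {p : 𝔤 × 𝔤} (hp : p ∈ sq O) : t • p ∈ sq O :=
  ⟨hO.smul_mem hp.1 ht.1.le ht.2, hO.smul_mem hp.2 ht.1.le ht.2⟩

theorem smoothFamily_comp_smul (hO : StarConvex ℝ (0 : 𝔤) (O : Set 𝔤)) {f : 𝔤 × 𝔤 → F}
    (hf : ContDiffOn ℝ ∞ f (sq O : Set (𝔤 × 𝔤))) :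
    SmoothFamily (Ioc 0 1) O (fun t p => f (t • p)) :=
  hf.comp (contDiff_fst.smul contDiff_snd).contDiffOn fun _ hq => smul_mem_sq hO hq.1 hq.2

theorem smoothFamily_rescale (hO : StarConvex ℝ (0 : 𝔤) (O : Set 𝔤)) {f : 𝔤 × 𝔤 → F}
    (hf : ContDiffOn ℝ ∞ f (sq O : Set (𝔤 × 𝔤))) : SmoothFamily (Ioc 0 1) O (rescale f) :=
  (contDiffOn_fst.inv fun _ hq => hq.1.1.ne').smul (smoothFamily_comp_smul hO hf)

omit [FiniteDimensional ℝ 𝔤] in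
theorem adField_smul_smul (a b : ℝ) (ξ p : 𝔤 × 𝔤) :
    adField (a • ξ) (b • p) = (a * b) • adField ξ p := by
  ext <;> simp [adField, mul_smul, smul_comm a b, ← smul_neg]

omit [FiniteDimensional ℝ 𝔤] in
theorem hasDerivAt_comp_smul {f : 𝔤 × 𝔤 → F} {t : ℝ} {p : 𝔤 × 𝔤}
    (hf : DifferentiableAt ℝ f (t • p)) :
    HasDerivAt (fun s : ℝ => f (s • p)) (fderiv ℝ f (t • p) p) t :=
  hf.hasFDerivAt.comp_hasDerivAt t (by simpa using (hasDerivAt_id t).smul_const p)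

omit [FiniteDimensional ℝ 𝔤] in
theorem fderiv_comp_smul_apply {f : 𝔤 × 𝔤 → F} {t : ℝ} {p : 𝔤 × 𝔤}
    (hf : DifferentiableAt ℝ f (t • p)) (v : 𝔤 × 𝔤) :
    fderiv ℝ (fun q => f (t • q)) p v = fderiv ℝ f (t • p) (t • v) := by
  have : HasFDerivAt (fun q : 𝔤 × 𝔤 => t • q) (t • ContinuousLinearMap.id ℝ (𝔤 × 𝔤)) p :=
    (hasFDerivAt_id p).const_smul t
  have h2 : HasFDerivAt (fun q => f (t • q)) _ p := hf.hasFDerivAt.comp p this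
  rw [h2.fderiv]
  simp

/-- For rescaled families, the equation `Φ̇_t = L(X^{β_t}) Φ_t` holds for all `t` if it holds
at `t = 1`, where it is an equation for the Euler field. -/
theorem phiEq_rescale_iff (hO : StarConvex ℝ (0 : 𝔤) (O : Set 𝔤)) {Φ : 𝔤 × 𝔤 → 𝔤}
    {β : 𝔤 × 𝔤 → 𝔤 × 𝔤} (hΦ : ContDiffOn ℝ ∞ Φ (sq O : Set (𝔤 × 𝔤))) :
    PhiEq (Ioc 0 1) O (rescale Φ) (rescale β) ↔
      ∀ q ∈ sq O, fderiv ℝ Φ q q - Φ q = fderiv ℝ Φ q (genField β q) := by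
  have h1 : ∀ t ∈ Ioc (0 : ℝ) 1, ∀ p ∈ sq O, HasDerivWithinAt (fun s => rescale Φ s p)
      ((t ^ 2)⁻¹ • (fderiv ℝ Φ (t • p) (t • p) - Φ (t • p))) (Ioc 0 1) t := by
    intro t ht p hp
    have hd := differentiableAt_of_contDiffOn hΦ (smul_mem_sq hO ht hp)
    refine (((hasDerivAt_inv ht.1.ne').smul (hasDerivAt_comp_smul hd)).congr_deriv
      ?_).hasDerivWithinAt
    rw [map_smul, smul_sub, smul_smul, neg_smul, ← sub_eq_add_neg]
    congr 2
    have := ht.1.ne'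
    field_simp
  have h2 : ∀ t ∈ Ioc (0 : ℝ) 1, ∀ p ∈ sq O, lieDer (genField (rescale β t)) (rescale Φ t) p =
      (t ^ 2)⁻¹ • fderiv ℝ Φ (t • p) (genField β (t • p)) := by
    intro t ht p hp
    have hd := differentiableAt_of_contDiffOn hΦ (smul_mem_sq hO ht hp)
    have e1 : genField (rescale β t) p = (t ^ 2)⁻¹ • genField β (t • p) := by
      have := adField_smul_smul t⁻¹ t⁻¹ (β (t • p)) (t • p)
      rw [inv_smul_smul₀ ht.1.ne', ← mul_inv, ← pow_two] at this
      exact this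
    have e2 : fderiv ℝ (rescale Φ t) p (genField (rescale β t) p) =
        t⁻¹ • fderiv ℝ (fun q => Φ (t • q)) p (genField (rescale β t) p) := by
      have hd' : DifferentiableAt ℝ (fun q => Φ (t • q)) p :=
        hd.comp p (differentiableAt_id.const_smul t)
      have : rescale Φ t = fun q => t⁻¹ • Φ (t • q) := rfl
      rw [this, fderiv_fun_const_smul hd']
      rfl
    rw [lieDer, e2, fderiv_comp_smul_apply hd, map_smul, inv_smul_smul₀ ht.1.ne', e1, map_smul]
  constructor
  · intro h q hq
    have ht : (1 : ℝ) ∈ Ioc (0 : ℝ) 1 := ⟨one_pos, le_rfl⟩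
    have := (uniqueDiffOn_Ioc (0 : ℝ) 1 1 ht).eq_deriv _ (h1 1 ht q hq) (h 1 ht q hq)
    rw [h2 1 ht q hq] at this
    simpa using this
  · intro h t ht p hp
    rw [h2 t ht p hp, ← h _ (smul_mem_sq hO ht hp)]
    exact h1 t ht p hp

theorem kappaEq_rescale_iff (hO : StarConvex ℝ (0 : 𝔤) (O : Set 𝔤)) {κ : 𝔤 × 𝔤 → ℝ}
    {β : 𝔤 × 𝔤 → 𝔤 × 𝔤} (hκ : ContDiffOn ℝ ∞ κ (sq O : Set (𝔤 × 𝔤)))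
    (hβ : ContDiffOn ℝ ∞ β (sq O : Set (𝔤 × 𝔤))) :
    KappaEq e (Ioc 0 1) O (fun t p => κ (t • p)) (rescale β) ↔ ∀ q ∈ sq O,
      fderiv ℝ κ q q = ∑ i, lieDer (adField (e i)) (fun p => e.repr (β p) i * κ p) q := by
  have h1 : ∀ t ∈ Ioc (0 : ℝ) 1, ∀ p ∈ sq O, HasDerivWithinAt (fun s : ℝ => κ (s • p))
      (t⁻¹ * fderiv ℝ κ (t • p) (t • p)) (Ioc 0 1) t := by
    intro t ht p hp
    have hd := differentiableAt_of_contDiffOn hκ (smul_mem_sq hO ht hp)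
    refine ((hasDerivAt_comp_smul hd).congr_deriv ?_).hasDerivWithinAt
    rw [map_smul, smul_eq_mul, inv_mul_cancel_left₀ ht.1.ne']
  have h2 : ∀ t ∈ Ioc (0 : ℝ) 1, ∀ p ∈ sq O, ∀ i,
      lieDer (adField (e i)) (fun q => e.repr (rescale β t q) i * κ (t • q)) p =
        t⁻¹ * lieDer (adField (e i)) (fun p => e.repr (β p) i * κ p) (t • p) := by
    intro t ht p hp i
    have hq := smul_mem_sq hO ht hp
    have hd : DifferentiableAt ℝ (fun p => e.repr (β p) i * κ p) (t • p) :=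
      (differentiableAt_of_contDiffOn (contDiffOn_coord e hβ i) hq).mul
        (differentiableAt_of_contDiffOn hκ hq)
    have e1 : (fun q => e.repr (rescale β t q) i * κ (t • q)) =
        fun q => t⁻¹ • (e.repr (β (t • q)) i * κ (t • q)) := by
      ext q
      simp [rescale, mul_assoc]
    have hd' : DifferentiableAt ℝ (fun q => e.repr (β (t • q)) i * κ (t • q)) p :=
      hd.comp p (differentiableAt_id.const_smul t)
    have e3 : t • adField (e i) p = adField (e i) (t • p) := by
      have := adField_smul_smul 1 t (e i) p
      rw [one_smul, one_mul] at this
      exact this.symm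
    rw [e1, lieDer, fderiv_fun_const_smul hd']
    change t⁻¹ • fderiv ℝ (fun q => e.repr (β (t • q)) i * κ (t • q)) p (adField (e i) p) = _
    rw [fderiv_comp_smul_apply (f := fun p => e.repr (β p) i * κ p) hd, e3]
    rfl
  have h3 : ∀ t ∈ Ioc (0 : ℝ) 1, ∀ p ∈ sq O,
      ∑ i, lieDer (adField (e i)) (fun q => e.repr (rescale β t q) i * κ (t • q)) p =
        t⁻¹ * ∑ i, lieDer (adField (e i)) (fun p => e.repr (β p) i * κ p) (t • p) := by
    intro t ht p hp
    rw [Finset.mul_sum]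
    exact Finset.sum_congr rfl fun i _ => h2 t ht p hp i
  constructor
  · intro h q hq
    have ht : (1 : ℝ) ∈ Ioc (0 : ℝ) 1 := ⟨one_pos, le_rfl⟩
    have := (uniqueDiffOn_Ioc (0 : ℝ) 1 1 ht).eq_deriv _ (h1 1 ht q hq) (h 1 ht q hq)
    rw [h3 1 ht q hq] at this
    simpa using this
  · intro h t ht p hp
    rw [h3 t ht p hp, ← h _ (smul_mem_sq hO ht hp)]
    exact h1 t ht p hp

end Rescaling

/-! ### The divergence -/

section Divergence

variable {𝔤 : Type*} [NormedLieRing 𝔤] [NormedLieAlgebra 𝔤] [FiniteDimensional ℝ 𝔤]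
  {ι : Type*} [Fintype ι] (e : Module.Basis ι ℝ (𝔤 × 𝔤)) {O : Opens 𝔤}

/-- The sum `∑ᵢ Lᵢ βⁱ` is the trace of `ξ ↦ dβ(X^ξ)`, hence independent of the basis. -/
theorem sum_repr_fderiv_adField {β : 𝔤 × 𝔤 → 𝔤 × 𝔤} {x y : 𝔤}
    (hβ : DifferentiableAt ℝ β (x, y)) :
    ∑ i, e.repr (fderiv ℝ β (x, y) (adField (e i) (x, y))) i =
      tr (adL x ∘L fderiv ℝ (fun x' => (β (x', y)).1) x +
        adL y ∘L fderiv ℝ (fun y' => (β (x, y')).2) y) := by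
  classical
  set D : 𝔤 × 𝔤 →ₗ[ℝ] 𝔤 × 𝔤 := (fderiv ℝ β (x, y) : 𝔤 × 𝔤 →ₗ[ℝ] 𝔤 × 𝔤) with hD
  set a : 𝔤 →ₗ[ℝ] 𝔤 := (adL x : 𝔤 →ₗ[ℝ] 𝔤) with ha
  set b : 𝔤 →ₗ[ℝ] 𝔤 := (adL y : 𝔤 →ₗ[ℝ] 𝔤) with hb
  have e1 : ∑ i, e.repr (fderiv ℝ β (x, y) (adField (e i) (x, y))) i =
      LinearMap.trace ℝ _ (D ∘ₗ (LinearMap.inl ℝ 𝔤 𝔤 ∘ₗ a ∘ₗ LinearMap.fst ℝ 𝔤 𝔤 +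
        LinearMap.inr ℝ 𝔤 𝔤 ∘ₗ b ∘ₗ LinearMap.snd ℝ 𝔤 𝔤)) := by
    rw [LinearMap.trace_eq_matrix_trace ℝ e, Matrix.trace]
    refine Finset.sum_congr rfl fun i _ => ?_
    rw [Matrix.diag_apply, LinearMap.toMatrix_apply]
    have : adField (e i) (x, y) = (LinearMap.inl ℝ 𝔤 𝔤 ∘ₗ a ∘ₗ LinearMap.fst ℝ 𝔤 𝔤 +
        LinearMap.inr ℝ 𝔤 𝔤 ∘ₗ b ∘ₗ LinearMap.snd ℝ 𝔤 𝔤) (e i) := by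
      simp [adField, ha, hb, adL_apply]
    rw [this]
    rfl
  have d1 : (fderiv ℝ (fun x' => (β (x', y)).1) x : 𝔤 →ₗ[ℝ] 𝔤) =
      LinearMap.fst ℝ 𝔤 𝔤 ∘ₗ D ∘ₗ LinearMap.inl ℝ 𝔤 𝔤 := by
    have h1 : HasFDerivAt (fun x' => β (x', y)) _ x :=
      hβ.hasFDerivAt.comp x (hasFDerivAt_prodMk_left x y)
    rw [h1.fst.fderiv]
    rfl
  have d2 : (fderiv ℝ (fun y' => (β (x, y')).2) y : 𝔤 →ₗ[ℝ] 𝔤) =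
      LinearMap.snd ℝ 𝔤 𝔤 ∘ₗ D ∘ₗ LinearMap.inr ℝ 𝔤 𝔤 := by
    have h1 : HasFDerivAt (fun y' => β (x, y')) _ y :=
      hβ.hasFDerivAt.comp y (hasFDerivAt_prodMk_right x y)
    rw [h1.snd.fderiv]
    rfl
  have e2 : tr (adL x ∘L fderiv ℝ (fun x' => (β (x', y)).1) x +
      adL y ∘L fderiv ℝ (fun y' => (β (x, y')).2) y) =
      LinearMap.trace ℝ 𝔤 (a ∘ₗ LinearMap.fst ℝ 𝔤 𝔤 ∘ₗ D ∘ₗ LinearMap.inl ℝ 𝔤 𝔤) +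
        LinearMap.trace ℝ 𝔤 (b ∘ₗ LinearMap.snd ℝ 𝔤 𝔤 ∘ₗ D ∘ₗ LinearMap.inr ℝ 𝔤 𝔤) := by
    rw [← d1, ← d2, ← map_add]
    rfl
  rw [e1, e2, LinearMap.comp_add, map_add]
  congr 1
  · exact LinearMap.trace_comp_comm' (a ∘ₗ LinearMap.fst ℝ 𝔤 𝔤) (D ∘ₗ LinearMap.inl ℝ 𝔤 𝔤)
  · exact LinearMap.trace_comp_comm' (b ∘ₗ LinearMap.snd ℝ 𝔤 𝔤) (D ∘ₗ LinearMap.inr ℝ 𝔤 𝔤)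

/-- The Leibniz rule `∑ᵢ Lᵢ(βⁱ κ) = L(X^β) κ + κ ∑ᵢ Lᵢ βⁱ`. -/
theorem sum_lieDer_mul {β : 𝔤 × 𝔤 → 𝔤 × 𝔤} {κ : 𝔤 × 𝔤 → ℝ} {x y : 𝔤}
    (hβ : DifferentiableAt ℝ β (x, y)) (hκ : DifferentiableAt ℝ κ (x, y)) :
    ∑ i, lieDer (adField (e i)) (fun p => e.repr (β p) i * κ p) (x, y) =
      fderiv ℝ κ (x, y) (genField β (x, y)) + κ (x, y) *
        tr (adL x ∘L fderiv ℝ (fun x' => (β (x', y)).1) x +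
          adL y ∘L fderiv ℝ (fun y' => (β (x, y')).2) y) := by
  have hβi : ∀ i, HasFDerivAt (fun q => e.repr (β q) i)
      ((coordCLM e i).comp (fderiv ℝ β (x, y))) (x, y) := fun i =>
    (coordCLM e i).hasFDerivAt.comp (x, y) hβ.hasFDerivAt
  have h1 : ∀ i, lieDer (adField (e i)) (fun p => e.repr (β p) i * κ p) (x, y) =
      fderiv ℝ κ (x, y) (e.repr (β (x, y)) i • adField (e i) (x, y)) +
        κ (x, y) * e.repr (fderiv ℝ β (x, y) (adField (e i) (x, y))) i := fun i => by
    rw [lieDer_mul (hβi i).differentiableAt hκ, lieDer, (hβi i).fderiv, lieDer, map_smul, add_comm,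
      mul_comm _ (κ (x, y))]
    rfl
  rw [Finset.sum_congr rfl fun i _ => h1 i, Finset.sum_add_distrib, ← Finset.mul_sum, ← map_sum,
    sum_repr_smul_adField, sum_repr_fderiv_adField e hβ]
  rfl

end Divergence

/-! ### The algebraic form of the equations -/

/-- The logarithmic derivative of `√a √b / √c`. -/
theorem hasDerivAt_sqrt_mul_sqrt_div_sqrt {a b c : ℝ → ℝ} {a' b' c' t : ℝ} (ha : HasDerivAt a a' t)
    (hb : HasDerivAt b b' t) (hc : HasDerivAt c c' t) (ha0 : 0 < a t) (hb0 : 0 < b t)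
    (hc0 : 0 < c t) :
    HasDerivAt (fun s => Real.sqrt (a s) * Real.sqrt (b s) / Real.sqrt (c s))
      (Real.sqrt (a t) * Real.sqrt (b t) / Real.sqrt (c t) *
        (1 / 2 * (a' / a t + b' / b t - c' / c t))) t := by
  have hA := Real.sqrt_pos.2 ha0
  have hB := Real.sqrt_pos.2 hb0
  have hC := Real.sqrt_pos.2 hc0
  refine (((ha.sqrt ha0.ne').mul (hb.sqrt hb0.ne')).div (hc.sqrt hc0.ne') hC.ne').congr_deriv ?_
  simp only [Pi.mul_apply]
  have eA := Real.sq_sqrt ha0.le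
  have eB := Real.sq_sqrt hb0.le
  have eC := Real.sq_sqrt hc0.le
  set A := Real.sqrt (a t)
  set B := Real.sqrt (b t)
  set C := Real.sqrt (c t)
  rw [← eA, ← eB, ← eC]
  field_simp

section AlgebraicForm

variable {𝔤 : Type*} [NormedLieRing 𝔤] [NormedLieAlgebra 𝔤] [FiniteDimensional ℝ 𝔤]
  {ι : Type*} [Fintype ι] (e : Module.Basis ι ℝ (𝔤 × 𝔤))

attribute [local instance] completeSpace_lie

namespace IsLocalGroupLaw

variable {U O : Opens 𝔤} {Φ : 𝔤 × 𝔤 → 𝔤} (h : IsLocalGroupLaw U O Φ)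
include h

/-- The Jacobian is positive on `U`, since it is `1` at the origin and has no zeros. -/
theorem jac_pos {x : 𝔤} (hx : x ∈ U) : 0 < jac x := by
  have hne : ∀ y ∈ U, jac y ≠ 0 := fun y hy h0 => by
    have h1 := Ring.inverse_mul_cancel _ (h.isUnit y hy)
    have h2 := congrArg (fun c : 𝔤 →L[ℝ] 𝔤 => LinearMap.det (c : 𝔤 →ₗ[ℝ] 𝔤)) h1
    have h3 : LinearMap.det (((Ring.inverse (leftDexp y) : 𝔤 →L[ℝ] 𝔤) : 𝔤 →ₗ[ℝ] 𝔤) ∘ₗ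
        (leftDexp y : 𝔤 →ₗ[ℝ] 𝔤)) = LinearMap.det (LinearMap.id : 𝔤 →ₗ[ℝ] 𝔤) := h2
    rw [LinearMap.det_comp, LinearMap.det_id] at h3
    have h4 : LinearMap.det (leftDexp y : 𝔤 →ₗ[ℝ] 𝔤) = 0 := h0
    rw [h4, mul_zero] at h3
    exact zero_ne_one h3
  by_contra hneg
  have hc : ContinuousOn (fun t : ℝ => jac (t • x)) (Icc 0 1) :=
    (contDiff_jac.continuous.comp (continuous_id.smul continuous_const)).continuousOn
  obtain ⟨t, ht, h0⟩ := intermediate_value_Icc' zero_le_one hc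
    (show (0 : ℝ) ∈ Icc _ _ by simpa [jac_zero] using not_lt.1 hneg)
  exact hne _ (h.starConvex_U.smul_mem hx ht.1 ht.2) h0

theorem fderiv_jac_div_jac {x : 𝔤} (hx : x ∈ U) :
    fderiv ℝ jac x x / jac x = tr (divExpSubOne (adL x)) - tr (1 : 𝔤 →L[ℝ] 𝔤) := by
  have h1 : Ring.inverse (leftDexp x) * oneSubExp (adL x) = 1 :=
    Ring.inverse_mul_cancel _ (h.isUnit x hx)
  have h2 : oneSubExp (adL x) * Ring.inverse (leftDexp x) = 1 :=
    Ring.mul_inverse_cancel _ (h.isUnit x hx)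
  rw [fderiv_jac_self h1, mul_div_cancel_left₀ _ (h.jac_pos hx).ne', ← divExpSubOne_eq h1 h2]
  exact map_sub (LinearMap.trace ℝ 𝔤) _ _

theorem contDiffOn_density : ContDiffOn ℝ ∞
    (fun p => Real.sqrt (jac p.1) * Real.sqrt (jac p.2) / Real.sqrt (jac (Φ p)))
    (sq O : Set (𝔤 × 𝔤)) := by
  have h1 : ContDiffOn ℝ ∞ (fun p : 𝔤 × 𝔤 => Real.sqrt (jac p.1)) (sq O : Set (𝔤 × 𝔤)) :=
    (contDiff_jac.comp contDiff_fst).contDiffOn.sqrt fun p hp => (h.jac_pos (h.subset hp.1)).ne'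
  have h2 : ContDiffOn ℝ ∞ (fun p : 𝔤 × 𝔤 => Real.sqrt (jac p.2)) (sq O : Set (𝔤 × 𝔤)) :=
    (contDiff_jac.comp contDiff_snd).contDiffOn.sqrt fun p hp => (h.jac_pos (h.subset hp.2)).ne'
  have h3 : ContDiffOn ℝ ∞ (fun p : 𝔤 × 𝔤 => Real.sqrt (jac (Φ p))) (sq O : Set (𝔤 × 𝔤)) :=
    (contDiff_jac.comp_contDiffOn h.smooth).sqrt fun p hp =>
      (h.jac_pos (h.mem _ hp.1 _ hp.2)).ne'
  exact (h1.mul h2).div h3 fun p hp => (Real.sqrt_pos.2 (h.jac_pos (h.mem _ hp.1 _ hp.2))).ne'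

theorem density_pos {p : 𝔤 × 𝔤} (hp : p ∈ sq O) :
    0 < Real.sqrt (jac p.1) * Real.sqrt (jac p.2) / Real.sqrt (jac (Φ p)) :=
  div_pos (mul_pos (Real.sqrt_pos.2 (h.jac_pos (h.subset hp.1)))
    (Real.sqrt_pos.2 (h.jac_pos (h.subset hp.2))))
    (Real.sqrt_pos.2 (h.jac_pos (h.mem _ hp.1 _ hp.2)))

/-- The Euler form of the equation for `Φ` is transformed by the invertible operator
`e^{ad y} leftDexp(Φ(x, y))` into the first Kashiwara-Vergne equation. -/
theorem fderiv_sub_eq_iff {x y : 𝔤} (hx : x ∈ O) (hy : y ∈ O) (ξ : 𝔤 × 𝔤) :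
    fderiv ℝ Φ (x, y) (x, y) - Φ (x, y) = fderiv ℝ Φ (x, y) (adField ξ (x, y)) ↔
      (1 - exp (-adL x)) ξ.1 + (exp (adL y) - 1) ξ.2 = x + y - Φ (y, x) := by
  set z := Φ (x, y) with hz
  have hEE : ∀ v : 𝔤, exp (adL y) (exp (-adL y) v) = v := fun v =>
    congrArg (fun L : 𝔤 →L[ℝ] 𝔤 => L v) (exp_mul_exp_neg (adL y))
  have hEE' : ∀ v : 𝔤, exp (-adL y) (exp (adL y) v) = v := fun v =>
    congrArg (fun L : 𝔤 →L[ℝ] 𝔤 => L v) (exp_neg_mul_exp (adL y))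
  have hEy : exp (adL y) y = y := exp_apply_of_apply_eq_zero (by simp [adL_apply])
  have hN : ∀ v : 𝔤, leftDexp v v = v := fun v => by
    simpa using leftDexp_smul_self 1 v
  have hNad : ∀ v w : 𝔤, leftDexp v (-⁅w, v⁆) = w - exp (-adL v) w := fun v w => by
    rw [lie_skew]
    exact congrArg (fun L : 𝔤 →L[ℝ] 𝔤 => L w) (oneSubExp_mul (adL v))
  have hinj : Function.Injective fun v => exp (adL y) (leftDexp z v) := by
    intro v w hvw
    have h1 := congrArg (fun c : 𝔤 => exp (-adL y) c) hvw
    simp only [hEE'] at h1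
    have h2 : ∀ v, Ring.inverse (leftDexp z) (leftDexp z v) = v := fun v =>
      congrArg (fun L : 𝔤 →L[ℝ] 𝔤 => L v) (Ring.inverse_mul_cancel _ (h.isUnit z (h.mem x hx y hy)))
    rw [← h2 v, h1, h2]
  have hl : exp (adL y) (leftDexp z (fderiv ℝ Φ (x, y) (x, y) - z)) = x + y - Φ (y, x) := by
    rw [map_sub, h.leftDexp_fderiv hx hy, hN, hN, hN, h.swap hx hy, map_sub, map_add, hEE, hEy]
  have hr : exp (adL y) (leftDexp z (fderiv ℝ Φ (x, y) (adField ξ (x, y)))) =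
      (1 - exp (-adL x)) ξ.1 + (exp (adL y) - 1) ξ.2 := by
    rw [adField, h.leftDexp_fderiv hx hy, hNad, hNad, map_add, hEE, map_sub, hEE]
    rfl
  rw [← hl, ← hr, hinj.eq_iff.symm]
  exact eq_comm

/-- Given the equation for `Φ`, the Euler form of the equation for the density is the second
Kashiwara-Vergne equation: apply `d log κ` to `p - X^ξ(p)`, which `dΦ` maps to `Φ(p)`, and use the
invariance of `J` under the adjoint action. -/
theorem fderiv_density_sub {x y : 𝔤} (hx : x ∈ O) (hy : y ∈ O) {ξ : 𝔤 × 𝔤}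
    (hΦ : fderiv ℝ Φ (x, y) (x, y) - Φ (x, y) = fderiv ℝ Φ (x, y) (adField ξ (x, y)))
    {κ : 𝔤 × 𝔤 → ℝ}
    (hκ : κ = fun p => Real.sqrt (jac p.1) * Real.sqrt (jac p.2) / Real.sqrt (jac (Φ p))) :
    fderiv ℝ κ (x, y) (x, y) - fderiv ℝ κ (x, y) (adField ξ (x, y)) = κ (x, y) *
      (1 / 2 * tr (divExpSubOne (adL x) + divExpSubOne (adL y) -
        divExpSubOne (adL (Φ (x, y))) - 1)) := by
  have hp : ((x, y) : 𝔤 × 𝔤) ∈ sq O := ⟨hx, hy⟩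
  have hκd : HasFDerivAt κ (fderiv ℝ κ (x, y)) (x, y) := by
    rw [hκ]
    exact (differentiableAt_of_contDiffOn h.contDiffOn_density hp).hasFDerivAt
  have hκa : ∀ p, κ p = Real.sqrt (jac p.1) * Real.sqrt (jac p.2) / Real.sqrt (jac (Φ p)) :=
    fun p => congrFun hκ p
  have hJ : ∀ v : 𝔤, HasFDerivAt (jac : 𝔤 → ℝ) (fderiv ℝ jac v) v := fun v =>
    (contDiff_jac.differentiable (by simp) v).hasFDerivAt
  set u : 𝔤 × 𝔤 := (x, y) - adField ξ (x, y) with hu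
  have hline : HasDerivAt (fun s : ℝ => ((x, y) : 𝔤 × 𝔤) + s • u) u 0 := by
    simpa using ((hasDerivAt_id (0 : ℝ)).smul_const u).const_add ((x, y) : 𝔤 × 𝔤)
  have h0 : ((x, y) : 𝔤 × 𝔤) + (0 : ℝ) • u = (x, y) := by simp
  have d1 : HasDerivAt (fun s : ℝ => κ ((x, y) + s • u)) (fderiv ℝ κ (x, y) u) 0 := by
    rw [← h0] at hκd
    have := hκd.comp_hasDerivAt 0 hline
    rwa [h0] at this
  have da : HasDerivAt (fun s : ℝ => jac ((x, y) + s • u).1) (fderiv ℝ jac x x) 0 := by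
    have := (show HasFDerivAt (jac : 𝔤 → ℝ) _ ((x, y) + (0 : ℝ) • u).1 from
      hJ _).comp_hasDerivAt 0 hline.fst
    refine this.congr_deriv ?_
    rw [h0, hu, adField]
    change fderiv ℝ jac x (x - -⁅ξ.1, x⁆) = _
    rw [sub_neg_eq_add, map_add, fderiv_jac_lie, add_zero]
  have db : HasDerivAt (fun s : ℝ => jac ((x, y) + s • u).2) (fderiv ℝ jac y y) 0 := by
    have := (show HasFDerivAt (jac : 𝔤 → ℝ) _ ((x, y) + (0 : ℝ) • u).2 from
      hJ _).comp_hasDerivAt 0 hline.snd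
    refine this.congr_deriv ?_
    rw [h0, hu, adField]
    change fderiv ℝ jac y (y - -⁅ξ.2, y⁆) = _
    rw [sub_neg_eq_add, map_add, fderiv_jac_lie, add_zero]
  have dc : HasDerivAt (fun s : ℝ => jac (Φ ((x, y) + s • u)))
      (fderiv ℝ jac (Φ (x, y)) (Φ (x, y))) 0 := by
    have hΦd := h.hasFDerivAt hx hy
    rw [← h0] at hΦd
    have := (hJ _).comp_hasDerivAt 0 (hΦd.comp_hasDerivAt 0 hline)
    refine this.congr_deriv ?_
    simp only [Function.comp_apply]
    rw [h0, hu, map_sub, ← hΦ, sub_sub_cancel]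
  have d2 := hasDerivAt_sqrt_mul_sqrt_div_sqrt da db dc (by rw [h0]; exact h.jac_pos (h.subset hx))
    (by rw [h0]; exact h.jac_pos (h.subset hy)) (by rw [h0]; exact h.jac_pos (h.mem x hx y hy))
  have key := d1.unique (d2.congr_of_eventuallyEq (Eventually.of_forall fun s => hκa _))
  rw [h0] at key
  rw [← map_sub, ← hu, key, h.fderiv_jac_div_jac (h.subset hx), h.fderiv_jac_div_jac (h.subset hy),
    h.fderiv_jac_div_jac (h.mem x hx y hy), hκa]
  have : tr (divExpSubOne (adL x) + divExpSubOne (adL y) - divExpSubOne (adL (Φ (x, y))) - 1) =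
      tr (divExpSubOne (adL x)) + tr (divExpSubOne (adL y)) -
        tr (divExpSubOne (adL (Φ (x, y)))) - tr (1 : 𝔤 →L[ℝ] 𝔤) := by
    unfold tr
    rw [← map_add, ← map_sub, ← map_sub]
    rfl
  rw [this]
  ring

/-- The equations for the rescaled families are equivalent to the algebraic equations. -/
theorem phiEq_and_kappaEq_iff {β : 𝔤 × 𝔤 → 𝔤 × 𝔤} (hβ : ContDiffOn ℝ ∞ β (sq O : Set (𝔤 × 𝔤)))
    {κ : 𝔤 × 𝔤 → ℝ}
    (hκ : κ = fun p => Real.sqrt (jac p.1) * Real.sqrt (jac p.2) / Real.sqrt (jac (Φ p))) :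
    (PhiEq (Ioc 0 1) O (rescale Φ) (rescale β) ∧
      KappaEq e (Ioc 0 1) O (fun t p => κ (t • p)) (rescale β)) ↔
    (∀ x ∈ O, ∀ y ∈ O, (1 - exp (-adL x)) (β (x, y)).1 + (exp (adL y) - 1) (β (x, y)).2 =
      x + y - Φ (y, x)) ∧
    (∀ x ∈ O, ∀ y ∈ O,
      tr (adL x ∘L fderiv ℝ (fun x' => (β (x', y)).1) x +
          adL y ∘L fderiv ℝ (fun y' => (β (x, y')).2) y) =
        1 / 2 * tr (divExpSubOne (adL x) + divExpSubOne (adL y) -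
          divExpSubOne (adL (Φ (x, y))) - 1)) := by
  have hκs : ContDiffOn ℝ ∞ κ (sq O : Set (𝔤 × 𝔤)) := by
    rw [hκ]; exact h.contDiffOn_density
  rw [phiEq_rescale_iff h.starConvex_O h.smooth, kappaEq_rescale_iff e h.starConvex_O hκs hβ]
  have h1 : (∀ q ∈ sq O, fderiv ℝ Φ q q - Φ q = fderiv ℝ Φ q (genField β q)) ↔
      ∀ x ∈ O, ∀ y ∈ O, (1 - exp (-adL x)) (β (x, y)).1 + (exp (adL y) - 1) (β (x, y)).2 =
        x + y - Φ (y, x) :=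
    ⟨fun H x hx y hy => (h.fderiv_sub_eq_iff hx hy _).1 (H (x, y) ⟨hx, hy⟩),
      fun H q hq => (h.fderiv_sub_eq_iff hq.1 hq.2 _).2 (H q.1 hq.1 q.2 hq.2)⟩
  rw [← h1]
  refine and_congr_right fun hΦ => ?_
  have h2 : ∀ x ∈ O, ∀ y ∈ O, (fderiv ℝ κ (x, y) (x, y) =
      ∑ i, lieDer (adField (e i)) (fun p => e.repr (β p) i * κ p) (x, y) ↔
      tr (adL x ∘L fderiv ℝ (fun x' => (β (x', y)).1) x +
          adL y ∘L fderiv ℝ (fun y' => (β (x, y')).2) y) =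
        1 / 2 * tr (divExpSubOne (adL x) + divExpSubOne (adL y) -
          divExpSubOne (adL (Φ (x, y))) - 1)) := by
    intro x hx y hy
    have hp : ((x, y) : 𝔤 × 𝔤) ∈ sq O := ⟨hx, hy⟩
    have hpos : κ (x, y) ≠ 0 := by
      rw [hκ]; exact (h.density_pos hp).ne'
    rw [sum_lieDer_mul e (differentiableAt_of_contDiffOn hβ hp)
      (differentiableAt_of_contDiffOn hκs hp), ← sub_eq_iff_eq_add', genField,
      h.fderiv_density_sub hx hy (hΦ _ hp) hκ, mul_right_inj' hpos]
    exact eq_comm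
  exact ⟨fun H x hx y hy => (h2 x hx y hy).1 (H (x, y) ⟨hx, hy⟩),
    fun H q hq => (h2 q.1 hq.1 q.2 hq.2).2 (H q.1 hq.1 q.2 hq.2)⟩

end IsLocalGroupLaw

end AlgebraicForm

section Versions

variable {𝔤 : Type*} [NormedLieRing 𝔤] [NormedLieAlgebra 𝔤] [FiniteDimensional ℝ 𝔤]
  {E : Type*} [NormedAddCommGroup E] [NormedSpace ℝ E] [CompleteSpace E]
  {G : Type*} [TopologicalSpace G] [ChartedSpace E G] [Group G] [LieGroup 𝓘(ℝ, E) ∞ G]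
  {ι : Type*} [Fintype ι] (e : Module.Basis ι ℝ (𝔤 × 𝔤))
  {φ : 𝔤 ≃ₗ⁅ℝ⁆ GroupLieAlgebra 𝓘(ℝ, E) G} {U O : Opens 𝔤} {β : 𝔤 × 𝔤 → 𝔤 × 𝔤}

omit [FiniteDimensional ℝ 𝔤] in
theorem Admissible.mono (h : Admissible φ U O) {O' : Opens 𝔤} (hO : O' ≤ O) (h0 : (0 : 𝔤) ∈ O')
    (hs : StarConvex ℝ (0 : 𝔤) (O' : Set 𝔤)) : Admissible φ U O' where
  zero_mem := h0
  subset := hO.trans h.subset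
  starConvex_U := h.starConvex_U
  starConvex_O := hs
  injOn := h.injOn
  localDiffeo := h.localDiffeo
  mul_mem x hx y hy := h.mul_mem x (hO hx) y (hO hy)

theorem condII_iff_condIII (h : Admissible φ U O)
    (hβ : ContDiffOn ℝ ∞ β (sq O : Set (𝔤 × 𝔤))) : CondII e φ U O β ↔ CondIII φ U O β :=
  h.isLocalGroupLaw.phiEq_and_kappaEq_iff e hβ rfl

theorem condI_iff_condII (h : Admissible φ U O)
    (hβ : ContDiffOn ℝ ∞ β (sq O : Set (𝔤 × 𝔤))) : CondI e φ U O β ↔ CondII e φ U O β := by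
  have hI : (Ioc (0 : ℝ) 1).OrdConnected := ordConnected_Ioc
  have hI' : (Ioc (0 : ℝ) 1).Nontrivial :=
    ⟨1, ⟨one_pos, le_rfl⟩, 1 / 2, ⟨by norm_num, by norm_num⟩, by norm_num⟩
  have hl := h.isLocalGroupLaw
  have hΦ := smoothFamily_rescale h.starConvex_O hl.smooth
  have hκ := smoothFamily_comp_smul h.starConvex_O hl.contDiffOn_density
  have hβ' := smoothFamily_rescale h.starConvex_O hβ
  refine ⟨fun H => ⟨phiEq_of_distrEq e hI hI' hΦ hκ hβ' (fun q hq => subset_closure ⟨hq, ?_⟩) H,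
    kappaEq_of_distrEq e hI hI' hΦ hκ hβ' H⟩,
    fun H => distrEq_of_phiEq_kappaEq e hI hI' hΦ hκ hβ' H.1 H.2⟩
  exact (hl.density_pos (smul_mem_sq h.starConvex_O hq.1 hq.2)).ne'

omit [FiniteDimensional ℝ 𝔤] in
theorem kvStatement_congr {C C' : Opens 𝔤 → (𝔤 × 𝔤 → 𝔤 × 𝔤) → Prop}
    (hC : ∀ O' ≤ O, (0 : 𝔤) ∈ O' → StarConvex ℝ (0 : 𝔤) (O' : Set 𝔤) → ∀ β,
      ContDiffOn ℝ ∞ β (sq O' : Set (𝔤 × 𝔤)) → (C O' β ↔ C' O' β)) :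
    KVStatement O C ↔ KVStatement O C' :=
  exists_congr fun O' => and_congr_right fun hO => and_congr_right fun h0 =>
    and_congr_right fun hs => exists_congr fun β => and_congr_right fun hβ =>
      hC O' hO h0 hs β hβ.smooth

end Versions

end KV

theorem lemma2p1 {𝔤 : Type*} [KV.NormedLieRing 𝔤] [KV.NormedLieAlgebra 𝔤] [FiniteDimensional ℝ 𝔤]
    {ι : Type*} [Fintype ι] (e : Module.Basis ι ℝ (𝔤 × 𝔤)) :
    (∀ (I : Set ℝ) (O : Opens 𝔤) (Φ : ℝ → 𝔤 × 𝔤 → 𝔤) (κ : ℝ → 𝔤 × 𝔤 → ℝ)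
        (β : ℝ → 𝔤 × 𝔤 → 𝔤 × 𝔤),
      I.OrdConnected → I.Nontrivial →
      KV.SmoothFamily I O Φ → KV.SmoothFamily I O κ → KV.SmoothFamily I O β →
      (KV.PhiEq I O Φ β ∧ KV.KappaEq e I O κ β → KV.DistrEq e I O Φ κ β) ∧
      (I ×ˢ (KV.sq O : Set (𝔤 × 𝔤)) ⊆
          closure {q | q ∈ I ×ˢ (KV.sq O : Set (𝔤 × 𝔤)) ∧ κ q.1 q.2 ≠ 0} →
        (KV.DistrEq e I O Φ κ β ↔ KV.PhiEq I O Φ β ∧ KV.KappaEq e I O κ β))) ∧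
    (∀ {E : Type*} [NormedAddCommGroup E] [NormedSpace ℝ E] [CompleteSpace E]
        {G : Type*} [TopologicalSpace G] [ChartedSpace E G] [Group G] [LieGroup 𝓘(ℝ, E) ∞ G]
        (φ : 𝔤 ≃ₗ⁅ℝ⁆ GroupLieAlgebra 𝓘(ℝ, E) G) (U O : Opens 𝔤), KV.Admissible φ U O →
      (∀ β : 𝔤 × 𝔤 → 𝔤 × 𝔤, ContDiffOn ℝ ∞ β (KV.sq O : Set (𝔤 × 𝔤)) →
        (KV.CondI e φ U O β ↔ KV.CondII e φ U O β) ∧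
        (KV.CondII e φ U O β ↔ KV.CondIII φ U O β)) ∧
      (KV.KVStatement O (fun O' β => KV.CondI e φ U O' β) ↔
        KV.KVStatement O (fun O' β => KV.CondII e φ U O' β)) ∧
      (KV.KVStatement O (fun O' β => KV.CondII e φ U O' β) ↔
        KV.KVStatement O (fun O' β => KV.CondIII φ U O' β))) := by
  refine ⟨fun I O Φ κ β hI hI' hΦ hκ hβ => ?_, fun {E} _ _ _ {G} _ _ _ _ φ U O hA => ?_⟩
  · have h1 : KV.PhiEq I O Φ β ∧ KV.KappaEq e I O κ β → KV.DistrEq e I O Φ κ β := fun h =>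
      KV.distrEq_of_phiEq_kappaEq e hI hI' hΦ hκ hβ h.1 h.2
    exact ⟨h1, fun hdense => ⟨fun h => ⟨KV.phiEq_of_distrEq e hI hI' hΦ hκ hβ hdense h,
      KV.kappaEq_of_distrEq e hI hI' hΦ hκ hβ h⟩, h1⟩⟩
  · exact ⟨fun β hβ => ⟨KV.condI_iff_condII e hA hβ, KV.condII_iff_condIII e hA hβ⟩,
      KV.kvStatement_congr fun O' hO h0 hs β hβ => KV.condI_iff_condII e (hA.mono hO h0 hs) hβ,
      KV.kvStatement_congr fun O' hO h0 hs β hβ => KV.condII_iff_condIII e (hA.mono hO h0 hs) hβ⟩
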